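/- Let $n\ge 3$ and $T>T_1=2\pi/\sqrt{n-2}$. Let $S^1(T)=\mathbb R/T\mathbb Z$ be the circle of length $T$, $(S^{n-1},d\xi^2)$ the standard unit sphere, and $g_0=dt^2+d\xi^2$ the product metric on $S^1(T)\times S^{n-1}$. A *pseudo-cylindric metric* is a metric $g_c=u_c^{4/(n-2)}g_0$ of constant scalar curvature, where $u_c$ is a smooth positive non-constant function on $S^1(T)\times S^{n-1}$. A *Derdzinski metric* is a warped product metric $ds^2+h(s)^{4/n}g_N$ on $S^1(L)\times N$ (with $L>0$), where $(N,g_N)$ is an $(n-1)$-dimensional Einstein manifold of scalar curvature $R>0$ and $h$ is a smooth, positive, non-constant, $L$-periodic solution of $$h''-\frac{nR}{4(n-1)}\,h^{1-4/n}=-\frac n4\,C\,h\qquad\text{for some constant } C>0 .$$ Then every pseudo-cylindric metric $g_c$ on $S^1(T)\times S^{n-1}$ has harmonic curvature (its Riemann curvature tensor is divergence free), and its Ricci tensor is not parallel. Moreover, there are $L>0$, a Derdzinski metric $g_D=ds^2+h(s)^{4/n}d\xi^2$ on $S^1(L)\times S^{n-1}$ with fibre the standard unit sphere, and a diffeomorphism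 $F:S^1(L)\times S^{n-1}\to S^1(T)\times S^{n-1}$ with $F^*g_c=g_D$; this $F$ is a conformal transformation from $g_D$ to $g_0$, that is, $F^*g_0=\psi\,g_D$ for a smooth positive function $\psi$. -/

import Mathlib

set_option maxSynthPendingDepth 3

open scoped Manifold ContDiff
open Set Metric

noncomputable section

/-! ### Riemannian geometry in one coordinate domain

`E` is a finite-dimensional real vector space and `G : E → E →L[ℝ] E →L[ℝ] ℝ` a field of symmetric
nondegenerate bilinear forms, defined near the point under consideration. The formulas are the usual
coordinate formulas, written without a choice of a basis of `E`. -/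
namespace Coord

variable {E : Type*} [NormedAddCommGroup E] [NormedSpace ℝ E]

/-- Exchanging the two arguments of a bilinear map. -/
def flipL (F : Type*) [NormedAddCommGroup F] [NormedSpace ℝ F] :
    (E →L[ℝ] E →L[ℝ] F) →L[ℝ] (E →L[ℝ] E →L[ℝ] F) :=
  (ContinuousLinearMap.flipₗᵢ ℝ E E F).toContinuousLinearEquiv.toContinuousLinearMap

theorem flipL_apply {F : Type*} [NormedAddCommGroup F] [NormedSpace ℝ F]
    (B : E →L[ℝ] E →L[ℝ] F) (v w : E) : flipL F B v w = B w v := rfl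

/-- The Koszul expression `½ (D_v G(w,z) + D_w G(v,z) - D_z G(v,w))`, as a trilinear form in
`v, w, z`. -/
def koszul (G : E → E →L[ℝ] E →L[ℝ] ℝ) (x : E) : E →L[ℝ] E →L[ℝ] E →L[ℝ] ℝ :=
  (2⁻¹ : ℝ) • (fderiv ℝ G x + (fderiv ℝ G x).flip - flipL ℝ ∘L (fderiv ℝ G x).flip)

theorem koszul_apply (G : E → E →L[ℝ] E →L[ℝ] ℝ) (x v w z : E) :
    koszul G x v w z =
      2⁻¹ * (fderiv ℝ G x v w z + fderiv ℝ G x w v z - fderiv ℝ G x z v w) := rfl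

/-- The Christoffel symbols `Γ(v,w)` of the Levi-Civita connection of `G`:
`G(Γ(v,w), z) = ½ (D_v G(w,z) + D_w G(v,z) - D_z G(v,w))`. -/
def christoffel (G : E → E →L[ℝ] E →L[ℝ] ℝ) (x : E) : E →L[ℝ] E →L[ℝ] E :=
  (ContinuousLinearMap.compL ℝ E (E →L[ℝ] ℝ) E (G x).inverse) ∘L (koszul G x)

theorem christoffel_apply (G : E → E →L[ℝ] E →L[ℝ] ℝ) (x v w : E) :
    christoffel G x v w = (G x).inverse (koszul G x v w) := rfl

/-- The curvature tensor `R(v,w)z` of the Levi-Civita connection of `G`. -/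
def riemann (G : E → E →L[ℝ] E →L[ℝ] ℝ) (x : E) : E →L[ℝ] E →L[ℝ] E →L[ℝ] E :=
  fderiv ℝ (christoffel G) x - (fderiv ℝ (christoffel G) x).flip +
    (ContinuousLinearMap.compL ℝ E E E).bilinearComp (christoffel G x) (christoffel G x) -
    ((ContinuousLinearMap.compL ℝ E E E).bilinearComp (christoffel G x) (christoffel G x)).flip

theorem riemann_apply (G : E → E →L[ℝ] E →L[ℝ] ℝ) (x v w z : E) :
    riemann G x v w z =
      fderiv ℝ (christoffel G) x v w z - fderiv ℝ (christoffel G) x w v z +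
        christoffel G x v (christoffel G x w z) - christoffel G x w (christoffel G x v z) := rfl

/-- `(∇_a R)(v,w)z`, the covariant derivative of the curvature tensor, as a linear map in `a`. -/
def covRiemann (G : E → E →L[ℝ] E →L[ℝ] ℝ) (x v w z : E) : E →ₗ[ℝ] E where
  toFun a := fderiv ℝ (riemann G) x a v w z + christoffel G x a (riemann G x v w z)
    - riemann G x (christoffel G x a v) w z - riemann G x v (christoffel G x a w) z
    - riemann G x v w (christoffel G x a z)
  map_add' a b := by
    simp only [map_add, _root_.add_apply]; abel
  map_smul' c a := by
    simp only [map_smul, _root_.smul_apply, smul_sub, smul_add, RingHom.id_apply]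

/-- The divergence of the curvature tensor: the trace of `a ↦ (∇_a R)(v,w)z`. -/
def divRiemann (G : E → E →L[ℝ] E →L[ℝ] ℝ) (x v w z : E) : ℝ :=
  LinearMap.trace ℝ E (covRiemann G x v w z)

variable [FiniteDimensional ℝ E]

variable (E) in
/-- The trace of an endomorphism, as a continuous linear map. -/
def traceL : (E →L[ℝ] E) →L[ℝ] ℝ :=
  LinearMap.toContinuousLinearMap (LinearMap.trace ℝ E ∘ₗ ContinuousLinearMap.coeLM ℝ)

/-- The Ricci tensor: `Ric(w,z)` is the trace of `v ↦ R(v,w)z`. -/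
def ricci (G : E → E →L[ℝ] E →L[ℝ] ℝ) (x : E) : E →L[ℝ] E →L[ℝ] ℝ :=
  (ContinuousLinearMap.compL ℝ E (E →L[ℝ] E) ℝ (traceL E)) ∘L (flipL E ∘L (riemann G x).flip)

theorem ricci_apply (G : E → E →L[ℝ] E →L[ℝ] ℝ) (x w z : E) :
    ricci G x w z = LinearMap.trace ℝ E (((riemann G x).flip w).flip z : E →L[ℝ] E) := rfl

/-- The covariant derivative of the Ricci tensor, `(∇_a Ric)(v,w)`. -/
def covRicci (G : E → E →L[ℝ] E →L[ℝ] ℝ) (x a v w : E) : ℝ :=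
  fderiv ℝ (ricci G) x a v w - ricci G x (christoffel G x a v) w -
    ricci G x v (christoffel G x a w)

/-- The scalar curvature: the trace of the Ricci tensor with respect to `G`. -/
def scalar (G : E → E →L[ℝ] E →L[ℝ] ℝ) (x : E) : ℝ :=
  traceL E ((G x).inverse ∘L ricci G x)

end Coord

/-! ### Metrics on manifolds, and their curvature -/

section Manifolds

/-- A field of bilinear forms on the tangent spaces of `M`. -/
abbrev MetricTensor {E : Type*} [NormedAddCommGroup E] [NormedSpace ℝ E]
    {H : Type*} [TopologicalSpace H] (I : ModelWithCorners ℝ E H)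
    (M : Type*) [TopologicalSpace M] [ChartedSpace H M] :=
  ∀ x : M, TangentSpace I x →L[ℝ] TangentSpace I x →L[ℝ] ℝ

variable {E : Type*} [NormedAddCommGroup E] [NormedSpace ℝ E]
  {H : Type*} [TopologicalSpace H] {I : ModelWithCorners ℝ E H}
  {M : Type*} [TopologicalSpace M] [ChartedSpace H M]
  {E' : Type*} [NormedAddCommGroup E'] [NormedSpace ℝ E']
  {H' : Type*} [TopologicalSpace H'] {J : ModelWithCorners ℝ E' H'}
  {N : Type*} [TopologicalSpace N] [ChartedSpace H' N]

/-- The pull-back `f^* g`: `(f^* g)_x(v,w) = g_{f x}(df_x v, df_x w)`. -/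
def MetricTensor.pullback (I : ModelWithCorners ℝ E H) (f : M → N) (g : MetricTensor J N) :
    MetricTensor I M := fun x =>
  ContinuousLinearMap.bilinearComp (E := E') (F := E') (E' := E) (F' := E) (g (f x))
    (mfderiv I J f x) (mfderiv I J f x)

theorem MetricTensor.pullback_apply (f : M → N) (g : MetricTensor J N) (x : M)
    (v w : TangentSpace I x) :
    MetricTensor.pullback I f g x v w = g (f x) (mfderiv I J f x v) (mfderiv I J f x w) := rfl

/-- The expression of `g` in the preferred chart at `p`, a field of bilinear forms on the model
space (meaningful on the target of the chart). -/
def MetricTensor.inChart (g : MetricTensor I M) (p : M) : E → E →L[ℝ] E →L[ℝ] ℝ :=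
  MetricTensor.pullback 𝓘(ℝ, E) (extChartAt I p).symm g

/-- The curvature of `g` is harmonic: the curvature tensor is divergence free. -/
def HasHarmonicCurvature (g : MetricTensor I M) : Prop :=
  ∀ (p : M) (v w z : E), Coord.divRiemann (g.inChart p) (extChartAt I p p) v w z = 0

variable [FiniteDimensional ℝ E]

/-- The scalar curvature of `g` at `p`. -/
def scalarCurvature (g : MetricTensor I M) (p : M) : ℝ :=
  Coord.scalar (g.inChart p) (extChartAt I p p)

/-- The Ricci tensor of `g` is parallel: `∇ Ric = 0`. -/
def HasParallelRicci (g : MetricTensor I M) : Prop :=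
  ∀ (p : M) (a v w : E), Coord.covRicci (g.inChart p) (extChartAt I p p) a v w = 0

/-- `g` is an Einstein metric with (constant) scalar curvature `R`: `Ric = (R / dim M) g`. -/
def IsEinstein (g : MetricTensor I M) (R : ℝ) : Prop :=
  ∀ (p : M) (v w : E), Coord.ricci (g.inChart p) (extChartAt I p p) v w =
    R / (Module.finrank ℝ E : ℝ) * g.inChart p (extChartAt I p p) v w

end Manifolds

/-! ### The circle of length `T`, as a manifold -/

section Circle

variable (T : ℝ) [hT : Fact (0 < T)]

/-- The charts of `ℝ / Tℤ` are the inverses of the restrictions of the projection `ℝ → ℝ / Tℤ` to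
the open intervals of length `T`. -/
instance AddCircle.chartedSpaceReal : ChartedSpace ℝ (AddCircle T) where
  atlas := Set.range fun a : ℝ => (AddCircle.openPartialHomeomorphCoe T a).symm
  chartAt x := (AddCircle.openPartialHomeomorphCoe T
    ((AddCircle.equivIco T 0 x : ℝ) - T / 2)).symm
  mem_chart_source x := by
    intro h
    have h : x = (((AddCircle.equivIco T 0 x : ℝ) - T / 2 : ℝ) : AddCircle T) := h
    have hx : x = ((AddCircle.equivIco T 0 x : ℝ) : AddCircle T) :=
      ((AddCircle.equivIco T 0).symm_apply_apply x).symm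
    have h' := hx.symm.trans h
    generalize (AddCircle.equivIco T 0 x : ℝ) = y at h'
    have hpos := hT.out
    have h2 : ((T / 2 : ℝ) : AddCircle T) = 0 := by
      have : (T / 2 : ℝ) = y - (y - T / 2) := by ring
      rw [this, AddCircle.coe_sub, h', sub_self]
    obtain ⟨m, hm⟩ := (AddCircle.coe_eq_zero_iff T).1 h2
    rw [zsmul_eq_mul] at hm
    have hm' : (m : ℝ) = 1 / 2 := by
      field_simp
      nlinarith
    have h3 : (0 : ℝ) < m ∧ (m : ℝ) < 1 := by constructor <;> linarith
    have h4 : 0 < m ∧ m < 1 := by exact_mod_cast h3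
    omega
  chart_mem_atlas x := ⟨_, rfl⟩

/-- Away from the left end point of the interval, the chart is locally a translation. -/
theorem AddCircle.equivIco_coe_eventuallyEq (a t : ℝ) (h : (t : AddCircle T) ≠ a) :
    ∃ b : ℝ, ∀ᶠ s : ℝ in nhds t, (AddCircle.equivIco T a (s : AddCircle T) : ℝ) = s + b := by
  have hpos := hT.out
  have hcoe : ∀ s : ℝ, (AddCircle.equivIco T a (s : AddCircle T) : ℝ) = toIcoMod hpos a s :=
    fun s => rfl
  have hmem := toIcoMod_mem_Ico hpos a t
  have hne : a ≠ toIcoMod hpos a t := by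
    intro e
    apply h
    rw [e, ← hcoe]
    exact ((AddCircle.equivIco T a).symm_apply_apply (t : AddCircle T)).symm
  have hlt : a < toIcoMod hpos a t := lt_of_le_of_ne hmem.1 hne
  refine ⟨-(toIcoDiv hpos a t • T), ?_⟩
  have e1 : toIcoMod hpos a t = t - toIcoDiv hpos a t • T := rfl
  have hopen : ∀ᶠ s : ℝ in nhds t, s - toIcoDiv hpos a t • T ∈ Ioo a (a + T) := by
    have hc : Continuous fun s : ℝ => s - toIcoDiv hpos a t • T := by fun_prop
    exact hc.continuousAt.eventually (isOpen_Ioo.mem_nhds (by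
      change t - toIcoDiv hpos a t • T ∈ Ioo a (a + T)
      exact e1 ▸ ⟨hlt, hmem.2⟩))
  filter_upwards [hopen] with s hs
  rw [hcoe, ← sub_eq_add_neg]
  have := toIcoDiv_eq_of_sub_zsmul_mem_Ico hpos (Ioo_subset_Ico_self hs)
  simp only [toIcoMod, this]

instance AddCircle.isManifoldReal : IsManifold 𝓘(ℝ, ℝ) ∞ (AddCircle T) := by
  apply isManifold_of_contDiffOn
  rintro _ _ ⟨a, rfl⟩ ⟨b, rfl⟩ t ht
  have htb : (t : AddCircle T) ≠ b := by
    have := ht.1.2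
    simpa using this
  obtain ⟨c, hc⟩ := AddCircle.equivIco_coe_eventuallyEq T b t htb
  apply ContDiffAt.contDiffWithinAt
  exact (contDiffAt_id.add contDiffAt_const : ContDiffAt ℝ ∞ (fun s : ℝ => s + c) t).congr_of_eventuallyEq hc

/-- The metric `dt²` on `ℝ / Tℤ`. All transition maps of the charts are locally translations, so
every tangent space is canonically `ℝ`. -/
def circleMetric : MetricTensor 𝓘(ℝ, ℝ) (AddCircle T) := fun _ => ContinuousLinearMap.mul ℝ ℝ

/-- The projection `ℝ → ℝ / Tℤ` is a local isometry. -/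
theorem circleMetric_pullback (t v w : ℝ) :
    MetricTensor.pullback 𝓘(ℝ, ℝ) (fun s : ℝ => (s : AddCircle T)) (circleMetric T) t v w
      = v * w := by
  have hm : HasMFDerivAt 𝓘(ℝ, ℝ) 𝓘(ℝ, ℝ) (fun s : ℝ => (s : AddCircle T)) t
      (ContinuousLinearMap.id ℝ ℝ) := by
    refine ⟨(AddCircle.continuous_mk' T).continuousAt, ?_⟩
    have hsrc := mem_chart_source ℝ (t : AddCircle T)
    obtain ⟨c, hc⟩ := AddCircle.equivIco_coe_eventuallyEq T _ t hsrc
    have : HasFDerivAt (fun s : ℝ => s + c) (ContinuousLinearMap.id ℝ ℝ) t :=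
      (hasFDerivAt_id t).add_const c
    simp only [mfld_simps]
    exact ((this.congr_of_eventuallyEq hc)).hasFDerivWithinAt
  change ContinuousLinearMap.mul ℝ ℝ
    (mfderiv 𝓘(ℝ, ℝ) 𝓘(ℝ, ℝ) (fun s : ℝ => (s : AddCircle T)) t v)
    (mfderiv 𝓘(ℝ, ℝ) 𝓘(ℝ, ℝ) (fun s : ℝ => (s : AddCircle T)) t w) = v * w
  rw [hm.mfderiv]
  rfl

end Circle

/-! ### Spheres, cylinders, pseudo-cylindric metrics and Derdzinski metrics -/

/-- The unit sphere `S^k` in `ℝ^{k+1}`. -/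
abbrev UnitSphere (k : ℕ) : Type := sphere (0 : EuclideanSpace ℝ (Fin (k + 1))) 1

/-- The Euclidean metric of `ℝ^m`. -/
def euclideanMetric (m : ℕ) :
    MetricTensor 𝓘(ℝ, EuclideanSpace ℝ (Fin m)) (EuclideanSpace ℝ (Fin m)) := fun _ =>
  (innerSL ℝ : EuclideanSpace ℝ (Fin m) →L[ℝ] EuclideanSpace ℝ (Fin m) →L[ℝ] ℝ)

/-- The standard metric `dξ²` of the unit sphere, induced by the Euclidean metric. -/
def roundMetric (k : ℕ) : MetricTensor (𝓡 k) (UnitSphere k) :=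
  MetricTensor.pullback (𝓡 k) (fun ξ => (ξ : EuclideanSpace ℝ (Fin (k + 1))))
    (euclideanMetric (k + 1))

section Warped

variable {E : Type*} [NormedAddCommGroup E] [NormedSpace ℝ E]
  {H : Type*} [TopologicalSpace H] {I : ModelWithCorners ℝ E H}
  {N : Type*} [TopologicalSpace N] [ChartedSpace H N]

/-- The warped product metric `dt² + φ(t) g_N` on `S¹(L) × N`. -/
def warpedMetric (L : ℝ) [Fact (0 < L)] (φ : AddCircle L → ℝ) (gN : MetricTensor I N) :
    MetricTensor (𝓘(ℝ, ℝ).prod I) (AddCircle L × N) := fun x =>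
  MetricTensor.pullback (𝓘(ℝ, ℝ).prod I) Prod.fst (circleMetric L) x +
    φ x.1 • MetricTensor.pullback (𝓘(ℝ, ℝ).prod I) Prod.snd gN x

/-- Derdzinski metrics on `S¹(L) × N`, where `N` has dimension `n - 1`: the metrics
`dt² + h(t)^{4/n} g_N`, where `g_N` is an Einstein metric of positive scalar curvature `R` and `h`
is a smooth, positive, nonconstant `L`-periodic solution of
`h'' - (n R / (4 (n - 1))) h^{1 - 4/n} = - (n / 4) C h` for some constant `C > 0`. -/
def IsDerdzinskiMetric [FiniteDimensional ℝ E] (n : ℕ) (L : ℝ) [Fact (0 < L)]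
    (gN : MetricTensor I N) (g : MetricTensor (𝓘(ℝ, ℝ).prod I) (AddCircle L × N)) : Prop :=
  Module.finrank ℝ E + 1 = n ∧
  ∃ R : ℝ, 0 < R ∧ IsEinstein gN R ∧
  ∃ h : AddCircle L → ℝ,
    (∀ t, 0 < h t) ∧ (¬ ∃ c, ∀ t, h t = c) ∧ ContDiff ℝ ∞ (fun t : ℝ => h t) ∧
    (∃ C : ℝ, 0 < C ∧ ∀ t : ℝ,
      iteratedDeriv 2 (fun s : ℝ => h s) t
        - n * R / (4 * ((n : ℝ) - 1)) * h t ^ (1 - 4 / (n : ℝ)) = - (n / 4 * C * h t)) ∧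
    g = warpedMetric L (fun t => h t ^ (4 / (n : ℝ))) gN

end Warped

/-- The model with corners of `S¹ × S^k`. -/
abbrev cylinderModel (k : ℕ) := 𝓘(ℝ, ℝ).prod (𝓡 k)

/-- The cylindric metric `dt² + dξ²` on `S¹(T) × S^k`. -/
def cylinderMetric (T : ℝ) [Fact (0 < T)] (k : ℕ) :
    MetricTensor (cylinderModel k) (AddCircle T × UnitSphere k) := fun x =>
  MetricTensor.pullback (cylinderModel k) Prod.fst (circleMetric T) x +
    MetricTensor.pullback (cylinderModel k) Prod.snd (roundMetric k) x

/-- Pseudo-cylindric metrics on `S¹(T) × S^{n-1}`: the metrics `u^{4/(n-2)} (dt² + dξ²)` of constant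
scalar curvature, where `u` is a smooth, positive, nonconstant function on `S¹(T) × S^{n-1}`. -/
def IsPseudoCylindric (n : ℕ) (T : ℝ) [Fact (0 < T)]
    (g : MetricTensor (cylinderModel (n - 1)) (AddCircle T × UnitSphere (n - 1))) : Prop :=
  ∃ u : AddCircle T × UnitSphere (n - 1) → ℝ,
    ContMDiff (cylinderModel (n - 1)) 𝓘(ℝ, ℝ) ∞ u ∧ (∀ x, 0 < u x) ∧ (¬ ∃ c, ∀ x, u x = c) ∧
    (∀ x, g x = u x ^ (4 / ((n : ℝ) - 2)) • cylinderMetric T (n - 1) x) ∧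
    ∃ c : ℝ, ∀ x, scalarCurvature g x = c

end

/-! Write k = n - 1 and a = (n - 2)/2. Polar coordinates (t, ξ) ↦ e^t ξ identify the cover ℝ × S^k
of the cylinder with the punctured space ℝⁿ ∖ {0} and turn dt² + dξ² into |x|⁻²|dx|². The metric
u^{4/(n-2)} g₀ becomes v^{4/(n-2)}|dx|² with v(x) = |x|^{-a} u(log|x|, x/|x|) (`coneDensity`). In a
chart, the cylinder is seen through polar coordinates up to a shift of t by a period. Since
curvature is natural under local diffeomorphisms, curvature statements are proved for conformally
flat metrics on ℝⁿ ∖ {0} and transported.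

Harmonic curvature. The curvature tensor of e^{2f}|dx|² is a Kulkarni–Nomizu product of the metric
with the Schouten tensor, which satisfies the Codazzi equation. Constant scalar curvature makes the
trace of the Schouten tensor constant, so every contraction in div R cancels or vanishes
(`divRiemann_conf_eq_zero`). No symmetry of u is needed here.

Rotational symmetry. Constant scalar curvature c means Δv = -K v^{(a+2)/a} with K = c(n-2)/(4(n-1)).
Comparison at a maximum of u gives c > 0, and compactness gives v ≥ b|x|^{-a} with b = min u > 0.
Thus v blows up at 0 and decays more slowly at infinity than its Kelvin transforms. The method of
moving spheres then shows that v dominates its Kelvin transform outside every sphere that does not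
enclose the origin (`IsSingularSolution.below`). Spheres degenerating to hyperplanes through 0 give
v(σy) ≤ v(y) for reflections σ, applied in both directions, so v is radial
(`IsSingularSolution.eq_of_norm_eq`) and u = w(t) satisfies w'' = a² w - K w^{(a+2)/a}.

Ricci tensor not parallel. Write the metric as e^{2h}(dt² + dξ²) with h = (2/(n-2)) log w. The
component of ∇Ric in the direction ∂_t would give h''' = 2h'h'', so h'' e^{-2h} would be constant.
Together with the scalar curvature equation this determines e^{2h} at critical points, so max h =
min h and u would be constant (`not_hasParallelRicci`).

Derdzinski form. Arc length s = ∫ w^{2/(n-2)} dt on the circle factor makes the metric ds² +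
w^{4/(n-2)} dξ². With h = w^{n/(n-2)} the fibre factor is h^{4/n}, and the equation of w becomes the
Derdzinski equation (`derdzinski_equation`, `exists_isDerdzinskiMetric`). -/

noncomputable section

open Filter Topology

/-! ### Naturality of the curvature under local diffeomorphisms. -/

namespace Coord

variable {E : Type*} [NormedAddCommGroup E] [NormedSpace ℝ E]
  {E' : Type*} [NormedAddCommGroup E'] [NormedSpace ℝ E']

/-- `G` is a smooth field of symmetric nondegenerate bilinear forms near `x`. -/
def IsMetricNear (G : E → E →L[ℝ] E →L[ℝ] ℝ) (x : E) : Prop :=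
  ∀ᶠ y in 𝓝 x, ContDiffAt ℝ ∞ G y ∧ (∀ v w, G y v w = G y w v) ∧ (G y).IsInvertible

/-- `Φ` is smooth with invertible derivative near `x`. -/
def IsLocalDiffeoNear (Φ : E → E') (x : E) : Prop :=
  ∀ᶠ y in 𝓝 x, ContDiffAt ℝ ∞ Φ y ∧ (fderiv ℝ Φ y).IsInvertible

/-- The pull-back of a field of bilinear forms. -/
def pull (Φ : E → E') (G : E' → E' →L[ℝ] E' →L[ℝ] ℝ) : E → E →L[ℝ] E →L[ℝ] ℝ :=
  fun y => (G (Φ y)).bilinearComp (fderiv ℝ Φ y) (fderiv ℝ Φ y)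

theorem pull_apply (Φ : E → E') (G : E' → E' →L[ℝ] E' →L[ℝ] ℝ) (x v w : E) :
    pull Φ G x v w = G (Φ x) (fderiv ℝ Φ x v) (fderiv ℝ Φ x w) := rfl

theorem IsMetricNear.eventually {G : E → E →L[ℝ] E →L[ℝ] ℝ} {x : E} (h : IsMetricNear G x) :
    ∀ᶠ y in 𝓝 x, IsMetricNear G y := eventually_eventually_nhds.2 h

theorem IsLocalDiffeoNear.eventually {Φ : E → E'} {x : E} (h : IsLocalDiffeoNear Φ x) :
    ∀ᶠ y in 𝓝 x, IsLocalDiffeoNear Φ y := eventually_eventually_nhds.2 h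

theorem IsLocalDiffeoNear.contDiffAt {Φ : E → E'} {x : E} (h : IsLocalDiffeoNear Φ x) :
    ContDiffAt ℝ ∞ Φ x := h.self_of_nhds.1

theorem IsLocalDiffeoNear.surjective {Φ : E → E'} {x : E} (h : IsLocalDiffeoNear Φ x) :
    Function.Surjective (fderiv ℝ Φ x) := by
  obtain ⟨e, he⟩ := h.self_of_nhds.2
  rw [← he]
  exact e.surjective

theorem IsMetricNear.contDiffAt {G : E → E →L[ℝ] E →L[ℝ] ℝ} {x : E} (h : IsMetricNear G x) :
    ContDiffAt ℝ ∞ G x := h.self_of_nhds.1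

theorem IsMetricNear.symm {G : E → E →L[ℝ] E →L[ℝ] ℝ} {x : E} (h : IsMetricNear G x) (v w : E) :
    G x v w = G x w v := h.self_of_nhds.2.1 v w

theorem IsMetricNear.isInvertible {G : E → E →L[ℝ] E →L[ℝ] ℝ} {x : E} (h : IsMetricNear G x) :
    (G x).IsInvertible := h.self_of_nhds.2.2

theorem IsMetricNear.apply_inverse {G : E → E →L[ℝ] E →L[ℝ] ℝ} {x : E} (h : IsMetricNear G x)
    (l : E →L[ℝ] ℝ) : G x ((G x).inverse l) = l := by
  obtain ⟨e, he⟩ := h.isInvertible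
  rw [← he, ContinuousLinearMap.inverse_equiv]
  exact e.apply_symm_apply l

theorem IsMetricNear.ext {G : E → E →L[ℝ] E →L[ℝ] ℝ} {x : E} (h : IsMetricNear G x)
    {v w : E} (hvw : ∀ z, G x v z = G x w z) : v = w := by
  obtain ⟨e, he⟩ := h.isInvertible
  apply e.injective
  ext z
  simpa [← he] using hvw z

theorem IsMetricNear.apply_christoffel {G : E → E →L[ℝ] E →L[ℝ] ℝ} {x : E}
    (h : IsMetricNear G x) (v w z : E) : G x (christoffel G x v w) z = koszul G x v w z := by
  rw [christoffel_apply, h.apply_inverse]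

theorem fderiv_apply₂ {G : E → E →L[ℝ] E →L[ℝ] E'} {x : E} (h : DifferentiableAt ℝ G x)
    (a b c : E) : fderiv ℝ G x a b c = fderiv ℝ (fun y => G y b c) x a := by
  have := ((h.hasFDerivAt.clm_apply (hasFDerivAt_const b x)).clm_apply (hasFDerivAt_const c x))
  rw [this.fderiv]
  simp

theorem contDiffAt_koszul {G : E → E →L[ℝ] E →L[ℝ] ℝ} {x : E} (h : ContDiffAt ℝ ∞ G x) :
    ContDiffAt ℝ ∞ (koszul G) x := by
  have h1 : ContDiffAt ℝ ∞ (fderiv ℝ G) x := h.fderiv_right (m := ∞) (by simp)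
  have h2 : ContDiffAt ℝ ∞ (fun y => (fderiv ℝ G y).flip) x :=
    (ContinuousLinearMap.flipₗᵢ ℝ E E (E →L[ℝ] ℝ)).toContinuousLinearEquiv.contDiff.contDiffAt.comp x h1
  have h3 : ContDiffAt ℝ ∞ (fun y => flipL ℝ ∘L (fderiv ℝ G y).flip) x :=
    contDiffAt_const.clm_comp h2
  exact ((h1.add h2).sub h3).const_smul (2⁻¹ : ℝ)

theorem IsMetricNear.contDiffAt_christoffel [CompleteSpace E] {G : E → E →L[ℝ] E →L[ℝ] ℝ} {x : E}
    (h : IsMetricNear G x) : ContDiffAt ℝ ∞ (christoffel G) x := by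
  have h1 : ContDiffAt ℝ ∞ (fun y => (G y).inverse) x := by
    obtain ⟨e, he⟩ := h.isInvertible
    have := contDiffAt_map_inverse (n := ∞) e
    rw [he] at this
    exact this.comp x h.contDiffAt
  exact ((ContinuousLinearMap.compL ℝ E (E →L[ℝ] ℝ) E).contDiff.contDiffAt.comp x h1).clm_comp
    (contDiffAt_koszul h.contDiffAt)

theorem contDiffAt_riemann {G : E → E →L[ℝ] E →L[ℝ] ℝ} {x : E}
    (h : ContDiffAt ℝ ∞ (christoffel G) x) : ContDiffAt ℝ ∞ (riemann G) x := by
  have h1 : ContDiffAt ℝ ∞ (fderiv ℝ (christoffel G)) x := h.fderiv_right (m := ∞) (by simp)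
  have hf : ContDiff ℝ ∞ (fun A : E →L[ℝ] E →L[ℝ] E →L[ℝ] E => A.flip) :=
    (ContinuousLinearMap.flipₗᵢ ℝ E E (E →L[ℝ] E)).toContinuousLinearEquiv.contDiff
  have h2 : ContDiffAt ℝ ∞ (fun y => (ContinuousLinearMap.compL ℝ E E E).bilinearComp
      (christoffel G y) (christoffel G y)) x := by
    have a1 : ContDiffAt ℝ ∞ (fun y => (ContinuousLinearMap.compL ℝ E E E) ∘L
      (christoffel G y)) x := contDiffAt_const.clm_comp h
    have hf' : ContDiff ℝ ∞ (fun A : E →L[ℝ] (E →L[ℝ] E) →L[ℝ] E →L[ℝ] E => A.flip) :=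
      (ContinuousLinearMap.flipₗᵢ ℝ E (E →L[ℝ] E) (E →L[ℝ] E)).toContinuousLinearEquiv.contDiff
    exact hf.contDiffAt.comp x ((hf'.contDiffAt.comp x a1).clm_comp h)
  exact ((h1.sub (hf.contDiffAt.comp x h1)).add h2).sub (hf.contDiffAt.comp x h2)

section Pull

variable {Φ : E → E'} {x : E} {G : E' → E' →L[ℝ] E' →L[ℝ] ℝ} {G' : E → E →L[ℝ] E →L[ℝ] ℝ}

theorem IsLocalDiffeoNear.hasFDerivAt (h : IsLocalDiffeoNear Φ x) :
    HasFDerivAt Φ (fderiv ℝ Φ x) x :=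
  (h.contDiffAt.differentiableAt (by simp)).hasFDerivAt

theorem IsLocalDiffeoNear.contDiffAt_fderiv (h : IsLocalDiffeoNear Φ x) :
    ContDiffAt ℝ ∞ (fderiv ℝ Φ) x := h.contDiffAt.fderiv_right (m := ∞) (by simp)

theorem IsLocalDiffeoNear.hasFDerivAt_apply (h : IsLocalDiffeoNear Φ x) (b : E) :
    HasFDerivAt (fun y => fderiv ℝ Φ y b) ((fderiv ℝ (fderiv ℝ Φ) x).flip b) x := by
  have h1 := (h.contDiffAt_fderiv.differentiableAt (by simp)).hasFDerivAt
  convert h1.clm_apply (hasFDerivAt_const b x) using 1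
  ext; simp

theorem IsLocalDiffeoNear.snd_symm (h : IsLocalDiffeoNear Φ x) (a b : E) :
    fderiv ℝ (fderiv ℝ Φ) x a b = fderiv ℝ (fderiv ℝ Φ) x b a :=
  (h.contDiffAt.isSymmSndFDerivAt (by
    rw [minSmoothness_of_isRCLikeNormedField]; exact WithTop.coe_le_coe.2 le_top)).eq a b

theorem contDiffAt_pull (hΦ : IsLocalDiffeoNear Φ x) (hG : ContDiffAt ℝ ∞ G (Φ x)) :
    ContDiffAt ℝ ∞ (pull Φ G) x := by
  have h1 : ContDiffAt ℝ ∞ (fun y => G (Φ y)) x := hG.comp x hΦ.contDiffAt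
  have h2 := hΦ.contDiffAt_fderiv
  have hf : ContDiff ℝ ∞ (fun A : E →L[ℝ] E' →L[ℝ] ℝ => A.flip) :=
    (ContinuousLinearMap.flipₗᵢ ℝ E E' ℝ).toContinuousLinearEquiv.contDiff
  have hf' : ContDiff ℝ ∞ (fun A : E' →L[ℝ] E →L[ℝ] ℝ => A.flip) :=
    (ContinuousLinearMap.flipₗᵢ ℝ E' E ℝ).toContinuousLinearEquiv.contDiff
  have hf'' : ContDiff ℝ ∞ (fun A : E →L[ℝ] E →L[ℝ] ℝ => A.flip) :=
    (ContinuousLinearMap.flipₗᵢ ℝ E E ℝ).toContinuousLinearEquiv.contDiff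
  exact hf''.contDiffAt.comp x ((hf.contDiffAt.comp x (h1.clm_comp h2)).clm_comp h2)

theorem isMetricNear_pull (hΦ : IsLocalDiffeoNear Φ x) (hG : IsMetricNear G (Φ x)) :
    IsMetricNear (pull Φ G) x := by
  have hc := hΦ.contDiffAt.continuousAt.eventually hG.eventually
  filter_upwards [hΦ.eventually, hc] with y hy hGy
  refine ⟨contDiffAt_pull hy hGy.contDiffAt, fun v w => hGy.symm _ _, ?_⟩
  obtain ⟨e, he⟩ := hGy.isInvertible
  obtain ⟨d, hd⟩ := hy.self_of_nhds.2
  refine ⟨(d.trans e).trans (d.arrowCongr (ContinuousLinearEquiv.refl ℝ ℝ)).symm, ?_⟩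
  ext v w
  simp [pull_apply, ← hd, ← he, ContinuousLinearEquiv.arrowCongr]

theorem IsMetricNear.congr {G₁ G₂ : E → E →L[ℝ] E →L[ℝ] ℝ} (h : IsMetricNear G₁ x)
    (he : G₂ =ᶠ[𝓝 x] G₁) : IsMetricNear G₂ x := by
  filter_upwards [h, he.eventuallyEq_nhds] with y hy hey
  exact ⟨hy.1.congr_of_eventuallyEq hey, by rw [hey.self_of_nhds]; exact hy.2⟩

theorem fderiv_pull_apply (hΦ : IsLocalDiffeoNear Φ x) (hG : IsMetricNear G (Φ x))
    (hG' : G' =ᶠ[𝓝 x] pull Φ G) (a b c : E) :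
    fderiv ℝ G' x a b c =
      fderiv ℝ G (Φ x) (fderiv ℝ Φ x a) (fderiv ℝ Φ x b) (fderiv ℝ Φ x c) +
      G (Φ x) (fderiv ℝ (fderiv ℝ Φ) x a b) (fderiv ℝ Φ x c) +
      G (Φ x) (fderiv ℝ Φ x b) (fderiv ℝ (fderiv ℝ Φ) x a c) := by
  rw [hG'.fderiv_eq, fderiv_apply₂ ((contDiffAt_pull hΦ hG.contDiffAt).differentiableAt (by simp))]
  have h1 : HasFDerivAt (fun y => G (Φ y)) ((fderiv ℝ G (Φ x)).comp (fderiv ℝ Φ x)) x :=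
    (hG.contDiffAt.differentiableAt (by simp)).hasFDerivAt.comp x hΦ.hasFDerivAt
  have h2 := (h1.clm_apply (hΦ.hasFDerivAt_apply b)).clm_apply (hΦ.hasFDerivAt_apply c)
  have h3 : fderiv ℝ (fun y => pull Φ G y b c) x = _ := h2.fderiv
  rw [h3]
  simp
  ring

/-- Nondegeneracy allows testing against vectors dΦ(z). Both sides are then Koszul expressions, and
symmetry of the second derivative of Φ leaves exactly one inhomogeneous term. -/
theorem fderiv_christoffel_pull (hΦ : IsLocalDiffeoNear Φ x) (hG : IsMetricNear G (Φ x))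
    (hG' : G' =ᶠ[𝓝 x] pull Φ G) (v w : E) :
    fderiv ℝ Φ x (christoffel G' x v w) =
      fderiv ℝ (fderiv ℝ Φ) x v w +
        christoffel G (Φ x) (fderiv ℝ Φ x v) (fderiv ℝ Φ x w) := by
  apply hG.ext
  intro z
  obtain ⟨z, rfl⟩ := hΦ.surjective z
  have h1 : G (Φ x) (fderiv ℝ Φ x (christoffel G' x v w)) (fderiv ℝ Φ x z) =
      G' x (christoffel G' x v w) z := by rw [hG'.self_of_nhds, pull_apply]
  rw [h1, ((isMetricNear_pull hΦ hG).congr hG').apply_christoffel, koszul_apply, map_add,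
    _root_.add_apply, hG.apply_christoffel, koszul_apply]
  simp only [fderiv_pull_apply hΦ hG hG']
  rw [hΦ.snd_symm w v, hΦ.snd_symm z v, hΦ.snd_symm z w,
    hG.symm _ (fderiv ℝ Φ x w), hG.symm (fderiv ℝ Φ x v) (fderiv ℝ (fderiv ℝ Φ) x w z)]
  ring

section Curvature

variable [FiniteDimensional ℝ E] [FiniteDimensional ℝ E']

/-- This is the derivative of the transformation law of Γ. Its third-order term is symmetric in `v`
and `w`, so it disappears from the antisymmetric combination that defines the curvature. -/
theorem fderiv_fderiv_christoffel_pull (hΦ : IsLocalDiffeoNear Φ x)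
    (hG : IsMetricNear G (Φ x)) (hG' : G' =ᶠ[𝓝 x] pull Φ G) (v w z : E) :
    fderiv ℝ (fderiv ℝ Φ) x v (christoffel G' x w z) +
        fderiv ℝ Φ x (fderiv ℝ (christoffel G') x v w z) =
      fderiv ℝ (fderiv ℝ (fderiv ℝ Φ)) x v w z +
        fderiv ℝ (christoffel G) (Φ x) (fderiv ℝ Φ x v) (fderiv ℝ Φ x w) (fderiv ℝ Φ x z) +
        christoffel G (Φ x) (fderiv ℝ (fderiv ℝ Φ) x v w) (fderiv ℝ Φ x z) +
        christoffel G (Φ x) (fderiv ℝ Φ x w) (fderiv ℝ (fderiv ℝ Φ) x v z) := by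
  have := FiniteDimensional.complete ℝ E
  have := FiniteDimensional.complete ℝ E'
  have hev : (fun y => fderiv ℝ Φ y (christoffel G' y w z)) =ᶠ[𝓝 x] fun y =>
      fderiv ℝ (fderiv ℝ Φ) y w z +
        christoffel G (Φ y) (fderiv ℝ Φ y w) (fderiv ℝ Φ y z) := by
    filter_upwards [hΦ.eventually, hΦ.contDiffAt.continuousAt.eventually hG.eventually,
      hG'.eventuallyEq_nhds] with y h1 h2 h3
    exact fderiv_christoffel_pull h1 h2 h3 w z
  have hΓ' := ((((isMetricNear_pull hΦ hG).congr hG').contDiffAt_christoffel).differentiableAt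
    (by simp)).hasFDerivAt
  have hΓ := (hG.contDiffAt_christoffel.differentiableAt (by simp)).hasFDerivAt.comp x
    hΦ.hasFDerivAt
  have hD := (hΦ.contDiffAt_fderiv.differentiableAt (by simp)).hasFDerivAt
  have hD2 := ((hΦ.contDiffAt_fderiv.fderiv_right (m := ∞) (by simp)).differentiableAt
    (by simp)).hasFDerivAt
  have e1 := hD.clm_apply ((hΓ'.clm_apply (hasFDerivAt_const w x)).clm_apply
    (hasFDerivAt_const z x))
  have e2 := ((hD2.clm_apply (hasFDerivAt_const w x)).clm_apply (hasFDerivAt_const z x)).add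
    ((hΓ.clm_apply (hΦ.hasFDerivAt_apply w)).clm_apply (hΦ.hasFDerivAt_apply z))
  have e3 := congrArg (fun A => A v) ((e1.congr_of_eventuallyEq hev.symm).unique e2)
  simp only [_root_.add_apply, ContinuousLinearMap.comp_apply, ContinuousLinearMap.flip_apply,
    Function.comp_apply, _root_.zero_apply, map_zero, zero_add] at e3
  rw [add_comm, e3]
  abel

theorem fderiv_riemann_pull (hΦ : IsLocalDiffeoNear Φ x) (hG : IsMetricNear G (Φ x))
    (hG' : G' =ᶠ[𝓝 x] pull Φ G) (v w z : E) :
    fderiv ℝ Φ x (riemann G' x v w z) =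
      riemann G (Φ x) (fderiv ℝ Φ x v) (fderiv ℝ Φ x w) (fderiv ℝ Φ x z) := by
  have h1 := fderiv_fderiv_christoffel_pull hΦ hG hG' v w z
  have h2 := fderiv_fderiv_christoffel_pull hΦ hG hG' w v z
  have h3 : fderiv ℝ (fderiv ℝ (fderiv ℝ Φ)) x v w = fderiv ℝ (fderiv ℝ (fderiv ℝ Φ)) x w v :=
    (hΦ.contDiffAt_fderiv.isSymmSndFDerivAt (by
      rw [minSmoothness_of_isRCLikeNormedField]; exact WithTop.coe_le_coe.2 le_top)).eq v w
  rw [riemann_apply, riemann_apply]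
  simp only [map_sub, map_add, fderiv_christoffel_pull hΦ hG hG']
  rw [hΦ.snd_symm w v, ← h3] at h2
  rw [← sub_eq_zero] at h1 h2 ⊢
  rw [← sub_eq_zero.2 (h1.trans h2.symm)]
  abel

theorem fderiv_covRiemann_pull (hΦ : IsLocalDiffeoNear Φ x) (hG : IsMetricNear G (Φ x))
    (hG' : G' =ᶠ[𝓝 x] pull Φ G) (a v w z : E) :
    fderiv ℝ Φ x (covRiemann G' x v w z a) =
      covRiemann G (Φ x) (fderiv ℝ Φ x v) (fderiv ℝ Φ x w) (fderiv ℝ Φ x z)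
        (fderiv ℝ Φ x a) := by
  have := FiniteDimensional.complete ℝ E
  have := FiniteDimensional.complete ℝ E'
  have hev : (fun y => fderiv ℝ Φ y (riemann G' y v w z)) =ᶠ[𝓝 x] fun y =>
      riemann G (Φ y) (fderiv ℝ Φ y v) (fderiv ℝ Φ y w) (fderiv ℝ Φ y z) := by
    filter_upwards [hΦ.eventually, hΦ.contDiffAt.continuousAt.eventually hG.eventually,
      hG'.eventuallyEq_nhds] with y h1 h2 h3
    exact fderiv_riemann_pull h1 h2 h3 v w z
  have hR' := ((contDiffAt_riemann
    ((isMetricNear_pull hΦ hG).congr hG').contDiffAt_christoffel).differentiableAt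
    (by simp)).hasFDerivAt
  have hR := ((contDiffAt_riemann hG.contDiffAt_christoffel).differentiableAt
    (by simp)).hasFDerivAt.comp x hΦ.hasFDerivAt
  have hD := (hΦ.contDiffAt_fderiv.differentiableAt (by simp)).hasFDerivAt
  have e1 := hD.clm_apply (((hR'.clm_apply (hasFDerivAt_const v x)).clm_apply
    (hasFDerivAt_const w x)).clm_apply (hasFDerivAt_const z x))
  have e2 := (((hR.clm_apply (hΦ.hasFDerivAt_apply v)).clm_apply
    (hΦ.hasFDerivAt_apply w)).clm_apply (hΦ.hasFDerivAt_apply z))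
  have e3 := congrArg (fun A => A a) ((e1.congr_of_eventuallyEq hev.symm).unique e2)
  simp only [_root_.add_apply, ContinuousLinearMap.comp_apply, ContinuousLinearMap.flip_apply,
    Function.comp_apply, _root_.zero_apply, map_zero, zero_add] at e3
  simp only [covRiemann, LinearMap.coe_mk, AddHom.coe_mk, map_sub, map_add,
    fderiv_riemann_pull hΦ hG hG', fderiv_christoffel_pull hΦ hG hG', _root_.add_apply]
  rw [← sub_eq_zero] at e3 ⊢
  rw [← e3]
  abel

/-- The endomorphisms a ↦ (∇_a R)(v,w)z on the two sides are conjugate by dΦ, hence have the same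
trace. The same argument serves for the Ricci and scalar curvatures. -/
theorem divRiemann_pull (hΦ : IsLocalDiffeoNear Φ x) (hG : IsMetricNear G (Φ x))
    (hG' : G' =ᶠ[𝓝 x] pull Φ G) (v w z : E) :
    divRiemann G' x v w z =
      divRiemann G (Φ x) (fderiv ℝ Φ x v) (fderiv ℝ Φ x w) (fderiv ℝ Φ x z) := by
  obtain ⟨e, he⟩ := hΦ.self_of_nhds.2
  rw [divRiemann, divRiemann, ← LinearMap.trace_conj' _ e.toLinearEquiv]
  congr 1
  ext b
  obtain ⟨a, rfl⟩ := e.surjective b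
  have h := fderiv_covRiemann_pull hΦ hG hG' a v w z
  have h' : ∀ y, fderiv ℝ Φ x y = e y := fun y => by rw [← he]; rfl
  simp only [h'] at h ⊢
  rw [← h, LinearEquiv.conj_apply_apply]
  simp

theorem ricci_pull (hΦ : IsLocalDiffeoNear Φ x) (hG : IsMetricNear G (Φ x))
    (hG' : G' =ᶠ[𝓝 x] pull Φ G) (w z : E) :
    ricci G' x w z = ricci G (Φ x) (fderiv ℝ Φ x w) (fderiv ℝ Φ x z) := by
  obtain ⟨e, he⟩ := hΦ.self_of_nhds.2
  rw [ricci_apply, ricci_apply, ← LinearMap.trace_conj' _ e.toLinearEquiv]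
  congr 1
  ext b
  obtain ⟨a, rfl⟩ := e.surjective b
  have h := fderiv_riemann_pull hΦ hG hG' a w z
  have h' : ∀ y, fderiv ℝ Φ x y = e y := fun y => by rw [← he]; rfl
  simp only [h'] at h ⊢
  rw [LinearEquiv.conj_apply_apply]
  simpa using h

theorem contDiffAt_ricci {G : E → E →L[ℝ] E →L[ℝ] ℝ} {x : E}
    (h : IsMetricNear G x) : ContDiffAt ℝ ∞ (ricci G) x := by
  have := FiniteDimensional.complete ℝ E
  have hf : ContDiff ℝ ∞ (fun A : E →L[ℝ] E →L[ℝ] E →L[ℝ] E => A.flip) :=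
    (ContinuousLinearMap.flipₗᵢ ℝ E E (E →L[ℝ] E)).toContinuousLinearEquiv.contDiff
  exact contDiffAt_const.clm_comp (contDiffAt_const.clm_comp
    (hf.contDiffAt.comp x (contDiffAt_riemann h.contDiffAt_christoffel)))

theorem covRicci_pull (hΦ : IsLocalDiffeoNear Φ x) (hG : IsMetricNear G (Φ x))
    (hG' : G' =ᶠ[𝓝 x] pull Φ G) (a v w : E) :
    covRicci G' x a v w =
      covRicci G (Φ x) (fderiv ℝ Φ x a) (fderiv ℝ Φ x v) (fderiv ℝ Φ x w) := by
  have hev : (fun y => ricci G' y v w) =ᶠ[𝓝 x] fun y =>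
      ricci G (Φ y) (fderiv ℝ Φ y v) (fderiv ℝ Φ y w) := by
    filter_upwards [hΦ.eventually, hΦ.contDiffAt.continuousAt.eventually hG.eventually,
      hG'.eventuallyEq_nhds] with y h1 h2 h3
    exact ricci_pull h1 h2 h3 v w
  have hR' := ((contDiffAt_ricci ((isMetricNear_pull hΦ hG).congr hG')).differentiableAt
    (by simp)).hasFDerivAt
  have hR := ((contDiffAt_ricci hG).differentiableAt (by simp)).hasFDerivAt.comp x hΦ.hasFDerivAt
  have e1 := (hR'.clm_apply (hasFDerivAt_const v x)).clm_apply (hasFDerivAt_const w x)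
  have e2 := (hR.clm_apply (hΦ.hasFDerivAt_apply v)).clm_apply (hΦ.hasFDerivAt_apply w)
  have e3 := congrArg (fun A => A a) ((e1.congr_of_eventuallyEq hev.symm).unique e2)
  simp only [_root_.add_apply, ContinuousLinearMap.comp_apply, ContinuousLinearMap.flip_apply,
    Function.comp_apply, _root_.zero_apply, map_zero, zero_add] at e3
  simp only [covRicci, ricci_pull hΦ hG hG', fderiv_christoffel_pull hΦ hG hG', map_add,
    _root_.add_apply]
  linarith

theorem scalar_pull (hΦ : IsLocalDiffeoNear Φ x) (hG : IsMetricNear G (Φ x))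
    (hG' : G' =ᶠ[𝓝 x] pull Φ G) : scalar G' x = scalar G (Φ x) := by
  obtain ⟨e, he⟩ := hΦ.self_of_nhds.2
  have h' : ∀ y, fderiv ℝ Φ x y = e y := fun y => by rw [← he]; rfl
  change LinearMap.trace ℝ E ((G' x).inverse ∘L ricci G' x : E →L[ℝ] E) =
    LinearMap.trace ℝ E' ((G (Φ x)).inverse ∘L ricci G (Φ x) : E' →L[ℝ] E')
  rw [← LinearMap.trace_conj' _ e.toLinearEquiv]
  congr 1
  ext b
  obtain ⟨a, rfl⟩ := e.surjective b
  rw [LinearEquiv.conj_apply_apply]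
  apply hG.ext
  intro z
  obtain ⟨z, rfl⟩ := e.surjective z
  have h1 : ∀ y, G (Φ x) (e y) (e z) = G' x y z := by
    intro y
    rw [hG'.self_of_nhds, pull_apply, h', h']
  simp only [ContinuousLinearMap.coe_comp, ContinuousLinearMap.coe_coe,
    Function.comp_apply, ContinuousLinearEquiv.coe_toLinearEquiv, hG.apply_inverse]
  rw [h1, ((isMetricNear_pull hΦ hG).congr hG').apply_inverse, ricci_pull hΦ hG hG', h', h']
  congr 3
  exact (e.symm_apply_apply a)

end Curvature

end Pull

end Coord

end

/-! ### Curvature of conformally flat metrics. -/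

noncomputable section

open Filter Topology

local notation "⟪" x ", " y "⟫" => inner ℝ x y

namespace Coord

variable {F : Type*} [NormedAddCommGroup F] [InnerProductSpace ℝ F]

theorem trace_smulRight_eq {V : Type*} [AddCommGroup V] [Module ℝ V] [FiniteDimensional ℝ V]
    (l : V →ₗ[ℝ] ℝ) (w : V) :
    LinearMap.trace ℝ V (l.smulRight w) = l w := by
  simp [LinearMap.trace_smulRight]

/-- The conformally flat metric `e^{2f} ⟪·,·⟫`. -/
def conf (f : F → ℝ) : F → F →L[ℝ] F →L[ℝ] ℝ :=
  fun y => Real.exp (2 * f y) • (innerSL ℝ : F →L[ℝ] F →L[ℝ] ℝ)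

theorem conf_apply (f : F → ℝ) (x v w : F) : conf f x v w = Real.exp (2 * f x) * ⟪v, w⟫ := rfl

/-- Smoothness in a neighbourhood of a point. -/
def IsSmoothNear (f : F → ℝ) (x : F) : Prop := ∀ᶠ y in 𝓝 x, ContDiffAt ℝ ∞ f y

variable {f : F → ℝ} {x : F}

theorem IsSmoothNear.eventually (h : IsSmoothNear f x) : ∀ᶠ y in 𝓝 x, IsSmoothNear f y :=
  eventually_eventually_nhds.2 h

theorem isSmoothNear_of_isOpen {s : Set F} (hs : IsOpen s) (h : ContDiffOn ℝ ∞ f s) (hx : x ∈ s) :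
    IsSmoothNear f x := by
  filter_upwards [hs.mem_nhds hx] with y hy
  exact h.contDiffAt (hs.mem_nhds hy)

variable [FiniteDimensional ℝ F]

theorem contDiffAt_gradient {f : F → ℝ} {x : F} (h : ContDiffAt ℝ ∞ f x) :
    ContDiffAt ℝ ∞ (gradient f) x := by
  have := FiniteDimensional.complete ℝ F
  exact ((InnerProductSpace.toDual ℝ F).symm.toContinuousLinearEquiv.contDiff (n := ∞)).contDiffAt.comp
    x (h.fderiv_right (m := ∞) (by simp))

theorem IsSmoothNear.hasFDerivAt_gradient (h : IsSmoothNear f x) :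
    HasFDerivAt (gradient f) (fderiv ℝ (gradient f) x) x :=
  ((contDiffAt_gradient h.self_of_nhds).differentiableAt (by simp)).hasFDerivAt

theorem isInvertible_innerSL : ((innerSL ℝ : F →L[ℝ] F →L[ℝ] ℝ)).IsInvertible := by
  have := FiniteDimensional.complete ℝ F
  exact ⟨(InnerProductSpace.toDual ℝ F).toContinuousLinearEquiv, rfl⟩

theorem IsSmoothNear.isMetricNear (h : IsSmoothNear f x) : IsMetricNear (conf f) x := by
  filter_upwards [h] with y hy
  refine ⟨?_, fun v w => by rw [conf_apply, conf_apply, real_inner_comm], ?_⟩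
  · exact (Real.contDiff_exp.contDiffAt.comp y (contDiffAt_const.mul hy)).smul contDiffAt_const
  · obtain ⟨e, he⟩ := isInvertible_innerSL (F := F)
    refine ⟨e.trans (ContinuousLinearEquiv.smulLeft
      (Units.mk0 (Real.exp (2 * f y)) (Real.exp_ne_zero _))), ?_⟩
    ext v w
    have : e v = innerSL ℝ v := by rw [← he]; rfl
    simp [conf_apply, this, ContinuousLinearEquiv.smulLeft, Units.smul_def]

theorem fderiv_eq_inner_gradient (v : F) (y : F) : fderiv ℝ f y v = ⟪gradient f y, v⟫ := by
  have := FiniteDimensional.complete ℝ F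
  exact inner_gradient_left.symm

theorem fderiv_conf_apply (h : IsSmoothNear f x) (a b c : F) :
    fderiv ℝ (conf f) x a b c = Real.exp (2 * f x) * (2 * ⟪gradient f x, a⟫ * ⟪b, c⟫) := by
  rw [fderiv_apply₂ (h.isMetricNear.contDiffAt.differentiableAt (by simp))]
  have h1 : HasFDerivAt f (fderiv ℝ f x) x :=
    (h.self_of_nhds.differentiableAt (by simp)).hasFDerivAt
  have h2 := ((h1.const_mul 2).exp.mul_const ⟪b, c⟫).fderiv
  simp only [conf_apply]
  rw [h2]
  simp only [← fderiv_eq_inner_gradient, _root_.smul_apply, smul_eq_mul]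
  ring

theorem christoffel_conf (h : IsSmoothNear f x) (v w : F) :
    christoffel (conf f) x v w =
      ⟪gradient f x, v⟫ • w + ⟪gradient f x, w⟫ • v - ⟪v, w⟫ • gradient f x := by
  apply h.isMetricNear.ext
  intro z
  rw [h.isMetricNear.apply_christoffel, koszul_apply]
  simp only [fderiv_conf_apply h, conf_apply, inner_sub_left, inner_add_left,
    real_inner_smul_left]
  ring

theorem fderiv_gradient_symm (h : IsSmoothNear f x) (v w : F) :
    ⟪fderiv ℝ (gradient f) x v, w⟫ = ⟪fderiv ℝ (gradient f) x w, v⟫ := by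
  have key : ∀ v w, ⟪fderiv ℝ (gradient f) x v, w⟫ = fderiv ℝ (fderiv ℝ f) x v w := by
    intro v w
    have h1 : HasFDerivAt (fderiv ℝ f) (fderiv ℝ (fderiv ℝ f) x) x :=
      ((h.self_of_nhds.fderiv_right (m := ∞) (by simp)).differentiableAt (by simp)).hasFDerivAt
    have h2 := h1.clm_apply (hasFDerivAt_const w x)
    have h3 := h.hasFDerivAt_gradient.inner ℝ (hasFDerivAt_const w x)
    have h4 : (fun y => fderiv ℝ f y w) = fun y => ⟪gradient f y, w⟫ :=
      funext fun y => fderiv_eq_inner_gradient w y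
    rw [h4] at h2
    simpa using congrArg (fun A => A v) (h3.unique h2)
  rw [key, key]
  exact (h.self_of_nhds.isSymmSndFDerivAt (by
    rw [minSmoothness_of_isRCLikeNormedField]; exact WithTop.coe_le_coe.2 le_top)).eq v w

/-- Minus the Schouten endomorphism of `e^{2f} ⟪·,·⟫`, with respect to `⟪·,·⟫`. -/
def schouten (f : F → ℝ) (x : F) : F →L[ℝ] F :=
  fderiv ℝ (gradient f) x - (innerSL ℝ (gradient f x)).smulRight (gradient f x) +
    (2⁻¹ * ⟪gradient f x, gradient f x⟫) • ContinuousLinearMap.id ℝ F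

theorem schouten_apply (f : F → ℝ) (x v : F) :
    schouten f x v = fderiv ℝ (gradient f) x v - ⟪gradient f x, v⟫ • gradient f x +
      (2⁻¹ * ⟪gradient f x, gradient f x⟫) • v := by
  simp [schouten]

theorem schouten_symm (h : IsSmoothNear f x) (v w : F) :
    ⟪schouten f x v, w⟫ = ⟪schouten f x w, v⟫ := by
  simp only [schouten_apply, inner_add_left, inner_sub_left, real_inner_smul_left,
    fderiv_gradient_symm h v w, real_inner_comm v w]
  ring

theorem IsSmoothNear.contDiffAt_schouten (h : IsSmoothNear f x) :
    ContDiffAt ℝ ∞ (schouten f) x := by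
  have h1 := contDiffAt_gradient h.self_of_nhds
  have h2 : ContDiffAt ℝ ∞ (fun y => (innerSL ℝ : F →L[ℝ] F →L[ℝ] ℝ) (gradient f y)) x :=
    (innerSL ℝ : F →L[ℝ] F →L[ℝ] ℝ).contDiff.contDiffAt.comp x h1
  exact ((h1.fderiv_right (m := ∞) (by simp)).sub (h2.smulRight h1)).add
    ((contDiffAt_const.mul (h1.inner ℝ h1)).smul contDiffAt_const)

/-- The Kulkarni–Nomizu type product of the Euclidean metric with the endomorphism `S`. -/
def kulkarni (S : F →L[ℝ] F) (v w z : F) : F :=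
  ⟪S v, z⟫ • w - ⟪S w, z⟫ • v + ⟪v, z⟫ • S w - ⟪w, z⟫ • S v

theorem fderiv_christoffel_conf (h : IsSmoothNear f x) (v w z : F) :
    fderiv ℝ (christoffel (conf f)) x v w z =
      ⟪fderiv ℝ (gradient f) x v, w⟫ • z + ⟪fderiv ℝ (gradient f) x v, z⟫ • w -
        ⟪w, z⟫ • fderiv ℝ (gradient f) x v := by
  have := FiniteDimensional.complete ℝ F
  rw [fderiv_apply₂ (h.isMetricNear.contDiffAt_christoffel.differentiableAt (by simp))]
  have hev : (fun y => christoffel (conf f) y w z) =ᶠ[𝓝 x] fun y =>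
      ⟪gradient f y, w⟫ • z + ⟪gradient f y, z⟫ • w - ⟪w, z⟫ • gradient f y := by
    filter_upwards [h.eventually] with y hy
    exact christoffel_conf hy w z
  rw [hev.fderiv_eq]
  have hP := h.hasFDerivAt_gradient
  have e := (((hP.inner ℝ (hasFDerivAt_const w x)).smul_const z).add
    ((hP.inner ℝ (hasFDerivAt_const z x)).smul_const w)).sub (hP.const_smul ⟪w, z⟫)
  have e' : fderiv ℝ (fun y => ⟪gradient f y, w⟫ • z + ⟪gradient f y, z⟫ • w -
      ⟪w, z⟫ • gradient f y) x = _ := e.fderiv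
  rw [e']
  simp

/-- The Weyl part is absent: all curvature of e^{2f}⟪·,·⟫ is carried by the Schouten endomorphism,
and the later contractions are linear algebra in it. -/
theorem riemann_conf (h : IsSmoothNear f x) (v w z : F) :
    riemann (conf f) x v w z = kulkarni (schouten f x) v w z := by
  rw [riemann_apply]
  simp only [fderiv_christoffel_conf h, christoffel_conf h, kulkarni, schouten_apply,
    inner_add_right, inner_sub_right, inner_add_left, inner_sub_left, real_inner_smul_left,
    real_inner_smul_right, fderiv_gradient_symm h w v, real_inner_comm (gradient f x),
    real_inner_comm v w]
  module

theorem ricci_conf (h : IsSmoothNear f x) (w z : F) :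
    ricci (conf f) x w z = -((Module.finrank ℝ F : ℝ) - 2) * ⟪schouten f x w, z⟫ -
      LinearMap.trace ℝ F (schouten f x) * ⟪w, z⟫ := by
  rw [ricci_apply]
  have : ((((riemann (conf f) x).flip w).flip z : F →L[ℝ] F) : F →ₗ[ℝ] F) =
      ((innerSL ℝ z : F →L[ℝ] ℝ) ∘L schouten f x : F →ₗ[ℝ] ℝ).smulRight w -
        ⟪schouten f x w, z⟫ • LinearMap.id +
        ((innerSL ℝ z : F →L[ℝ] ℝ) : F →ₗ[ℝ] ℝ).smulRight (schouten f x w) -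
        ⟪w, z⟫ • (schouten f x : F →ₗ[ℝ] F) := by
    ext v
    simp [riemann_conf h, kulkarni, real_inner_comm z]
  rw [this]
  simp only [map_sub, map_add, trace_smulRight_eq, map_smul, LinearMap.trace_id]
  simp [real_inner_comm z]
  ring

theorem scalar_conf (h : IsSmoothNear f x) :
    scalar (conf f) x = -2 * ((Module.finrank ℝ F : ℝ) - 1) * Real.exp (-2 * f x) *
      LinearMap.trace ℝ F (schouten f x) := by
  change LinearMap.trace ℝ F ((conf f x).inverse ∘L ricci (conf f) x : F →L[ℝ] F) = _
  have : (((conf f x).inverse ∘L ricci (conf f) x : F →L[ℝ] F) : F →ₗ[ℝ] F) =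
      Real.exp (-2 * f x) • (-((Module.finrank ℝ F : ℝ) - 2) • (schouten f x : F →ₗ[ℝ] F) -
        LinearMap.trace ℝ F (schouten f x) • LinearMap.id) := by
    ext w
    apply h.isMetricNear.ext
    intro z
    have e1 : Real.exp (2 * f x) * Real.exp (-2 * f x) = 1 := by
      rw [← Real.exp_add]; simp
    simp only [ContinuousLinearMap.coe_comp, ContinuousLinearMap.coe_coe, Function.comp_apply,
      h.isMetricNear.apply_inverse, ricci_conf h, conf_apply, LinearMap.smul_apply,
      LinearMap.sub_apply, LinearMap.id_apply, real_inner_smul_left, inner_sub_left]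
    rw [← mul_assoc, e1, one_mul]
  rw [this]
  simp only [map_sub, map_smul, LinearMap.trace_id, smul_eq_mul]
  ring

/-- The covariant derivative of the Schouten endomorphism, up to the conformal factor. -/
def covSchouten (f : F → ℝ) (x a : F) : F →L[ℝ] F :=
  fderiv ℝ (schouten f) x a +
    ((innerSL ℝ (gradient f x)).smulRight a - (innerSL ℝ a).smulRight (gradient f x)) ∘L
      schouten f x -
    schouten f x ∘L
      ((innerSL ℝ (gradient f x)).smulRight a - (innerSL ℝ a).smulRight (gradient f x)) -
    (2 * ⟪gradient f x, a⟫) • schouten f x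

theorem covSchouten_apply (f : F → ℝ) (x a v : F) :
    covSchouten f x a v = fderiv ℝ (schouten f) x a v +
      ⟪gradient f x, schouten f x v⟫ • a - ⟪a, schouten f x v⟫ • gradient f x -
      (⟪gradient f x, v⟫ • schouten f x a - ⟪a, v⟫ • schouten f x (gradient f x)) -
      (2 * ⟪gradient f x, a⟫) • schouten f x v := by
  simp [covSchouten]
  abel

theorem fderiv_schouten_apply (h : IsSmoothNear f x) (a v : F) :
    fderiv ℝ (schouten f) x a v = fderiv ℝ (fderiv ℝ (gradient f)) x a v -
      (⟪fderiv ℝ (gradient f) x a, v⟫ • gradient f x +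
        ⟪gradient f x, v⟫ • fderiv ℝ (gradient f) x a) +
      ⟪gradient f x, fderiv ℝ (gradient f) x a⟫ • v := by
  have hS : HasFDerivAt (schouten f) (fderiv ℝ (schouten f) x) x :=
    (h.contDiffAt_schouten.differentiableAt (by simp)).hasFDerivAt
  have h1 := hS.clm_apply (hasFDerivAt_const v x)
  have hP := h.hasFDerivAt_gradient
  have hH : HasFDerivAt (fderiv ℝ (gradient f)) (fderiv ℝ (fderiv ℝ (gradient f)) x) x :=
    (((contDiffAt_gradient h.self_of_nhds).fderiv_right (m := ∞) (by simp)).differentiableAt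
      (by simp)).hasFDerivAt
  have h2 := ((hH.clm_apply (hasFDerivAt_const v x)).sub
    ((hP.inner ℝ (hasFDerivAt_const v x)).smul hP)).add
    (((hP.inner ℝ hP).const_mul 2⁻¹).smul_const v)
  have h3 : (fun y => schouten f y v) = fun y => fderiv ℝ (gradient f) y v -
      ⟪gradient f y, v⟫ • gradient f y + (2⁻¹ * ⟪gradient f y, gradient f y⟫) • v :=
    funext fun y => schouten_apply f y v
  rw [h3] at h1
  have h4 := congrArg (fun A => A a) (h1.unique h2)
  simp only [_root_.add_apply, ContinuousLinearMap.comp_apply, ContinuousLinearMap.flip_apply,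
    _root_.zero_apply, map_zero, zero_add] at h4
  rw [h4]
  simp [real_inner_comm (gradient f x)]
  module

/-- The leading term is the third derivative of `f`, which is symmetric because the background is
flat; the remaining terms match by symmetry of the Hessian. -/
theorem covSchouten_codazzi (h : IsSmoothNear f x) (a v : F) :
    covSchouten f x a v = covSchouten f x v a := by
  have h2 : fderiv ℝ (fderiv ℝ (gradient f)) x a v = fderiv ℝ (fderiv ℝ (gradient f)) x v a :=
    ((contDiffAt_gradient h.self_of_nhds).isSymmSndFDerivAt (by
      rw [minSmoothness_of_isRCLikeNormedField]; exact WithTop.coe_le_coe.2 le_top)).eq a v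
  simp only [covSchouten_apply, fderiv_schouten_apply h, h2]
  rw [real_inner_comm _ a, real_inner_comm _ v, schouten_symm h v a]
  simp only [schouten_apply, inner_add_right, inner_sub_right, real_inner_smul_right,
    fderiv_gradient_symm h v a, real_inner_comm a v]
  module

theorem fderiv_riemann_conf (h : IsSmoothNear f x) (a v w z : F) :
    fderiv ℝ (riemann (conf f)) x a v w z = kulkarni (fderiv ℝ (schouten f) x a) v w z := by
  have := FiniteDimensional.complete ℝ F
  have hR : HasFDerivAt (riemann (conf f)) (fderiv ℝ (riemann (conf f)) x) x :=
    ((contDiffAt_riemann h.isMetricNear.contDiffAt_christoffel).differentiableAt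
      (by simp)).hasFDerivAt
  have h1 := ((hR.clm_apply (hasFDerivAt_const v x)).clm_apply (hasFDerivAt_const w x)).clm_apply
    (hasFDerivAt_const z x)
  have hS : HasFDerivAt (schouten f) (fderiv ℝ (schouten f) x) x :=
    (h.contDiffAt_schouten.differentiableAt (by simp)).hasFDerivAt
  have hSv := fun v => hS.clm_apply (hasFDerivAt_const v x)
  have h2 := (((((hSv v).inner ℝ (hasFDerivAt_const z x)).smul_const w).sub
    (((hSv w).inner ℝ (hasFDerivAt_const z x)).smul_const v)).add
    ((hSv w).const_smul ⟪v, z⟫)).sub ((hSv v).const_smul ⟪w, z⟫)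
  have hev : (fun y => riemann (conf f) y v w z) =ᶠ[𝓝 x] fun y =>
      kulkarni (schouten f y) v w z := by
    filter_upwards [h.eventually] with y hy
    exact riemann_conf hy v w z
  have h4 := congrArg (fun A => A a) ((h1.congr_of_eventuallyEq hev.symm).unique h2)
  simp only [_root_.add_apply, ContinuousLinearMap.comp_apply, ContinuousLinearMap.flip_apply,
    _root_.zero_apply, map_zero, zero_add] at h4
  rw [h4]
  simp [kulkarni]

/-- The metric is parallel, so the covariant derivative falls on the Schouten factor only. The term
-2⟪∇f, a⟫ S in `covSchouten` accounts for raising the index with the Euclidean metric instead of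
e^{2f}⟪·,·⟫. -/
theorem covRiemann_conf (h : IsSmoothNear f x) (a v w z : F) :
    covRiemann (conf f) x v w z a = kulkarni (covSchouten f x a) v w z := by
  simp only [covRiemann, LinearMap.coe_mk, AddHom.coe_mk, riemann_conf h, christoffel_conf h,
    fderiv_riemann_conf h]
  simp only [kulkarni, covSchouten_apply, map_add, map_sub, map_smul, inner_add_right,
    inner_sub_right, inner_add_left, inner_sub_left, real_inner_smul_left, real_inner_smul_right]
  have hS : ∀ p q, ⟪p, schouten f x q⟫ = ⟪schouten f x q, p⟫ := fun p q => real_inner_comm _ _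
  simp only [hS, schouten_symm h (gradient f x) z, schouten_symm h a z,
    real_inner_comm (gradient f x) v, real_inner_comm (gradient f x) w, real_inner_comm a v,
    real_inner_comm a w]
  module

theorem divRiemann_conf_eq_zero (hm : 2 ≤ Module.finrank ℝ F) (h : IsSmoothNear f x) {c : ℝ}
    (hc : ∀ᶠ y in 𝓝 x, scalar (conf f) y = c) (v w z : F) :
    divRiemann (conf f) x v w z = 0 := by
  -- Constant scalar curvature means that e^{-2f} tr S is constant. Its derivative gives tr(dS(a)) =
  -- 2⟪∇f, a⟫ tr S, and the commutator in `covSchouten` is traceless.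
  have htr : ∀ a, LinearMap.trace ℝ F (covSchouten f x a) = 0 := by
    intro a
    have hm' : (2 : ℝ) ≤ Module.finrank ℝ F := by exact_mod_cast hm
    have hS : HasFDerivAt (schouten f) (fderiv ℝ (schouten f) x) x :=
      (h.contDiffAt_schouten.differentiableAt (by simp)).hasFDerivAt
    have hf : HasFDerivAt f (fderiv ℝ f x) x :=
      (h.self_of_nhds.differentiableAt (by simp)).hasFDerivAt
    have h1 := ((hf.const_mul (-2)).exp).mul
      ((traceL F).hasFDerivAt.comp x hS)
    have hev : (fun y => Real.exp (-2 * f y) * traceL F (schouten f y)) =ᶠ[𝓝 x]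
        fun _ => c / (-2 * ((Module.finrank ℝ F : ℝ) - 1)) := by
      filter_upwards [h.eventually, hc] with y hy hcy
      rw [← hcy, scalar_conf hy, eq_div_iff (by nlinarith)]
      change _ * LinearMap.trace ℝ F (schouten f y) * _ = _
      ring
    have h2 := congrArg (fun A => A a)
      ((h1.congr_of_eventuallyEq hev.symm).unique (hasFDerivAt_const _ x))
    simp only [_root_.add_apply, _root_.smul_apply, ContinuousLinearMap.comp_apply, smul_eq_mul,
      Function.comp_apply, _root_.zero_apply, fderiv_eq_inner_gradient] at h2
    have h3 : traceL F (fderiv ℝ (schouten f) x a) =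
        2 * ⟪gradient f x, a⟫ * traceL F (schouten f x) := by
      have := Real.exp_pos (-2 * f x)
      apply mul_left_cancel₀ this.ne'
      linarith
    set B := (innerSL ℝ (gradient f x)).smulRight a - (innerSL ℝ a).smulRight (gradient f x)
      with hB
    change traceL F (fderiv ℝ (schouten f) x a + B ∘L schouten f x - schouten f x ∘L B -
      (2 * ⟪gradient f x, a⟫) • schouten f x) = 0
    have h4 : traceL F (B ∘L schouten f x) = traceL F (schouten f x ∘L B) :=
      LinearMap.trace_mul_comm ℝ (B : F →ₗ[ℝ] F) (schouten f x : F →ₗ[ℝ] F)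
    rw [map_sub, map_sub, map_add, h4, h3, map_smul, smul_eq_mul]
    ring
  -- The Codazzi equation moves `a` out of the index slot, so that each term is linear in `a` with a
  -- computable trace. The two rank-one traces cancel by Codazzi again, and the other two vanish by
  -- `htr`.
  have : covRiemann (conf f) x v w z =
      ((innerSL ℝ z : F →L[ℝ] ℝ) ∘L covSchouten f x v : F →ₗ[ℝ] ℝ).smulRight w -
        ((innerSL ℝ z : F →L[ℝ] ℝ) ∘L covSchouten f x w : F →ₗ[ℝ] ℝ).smulRight v +
        ⟪v, z⟫ • (covSchouten f x w : F →ₗ[ℝ] F) - ⟪w, z⟫ • (covSchouten f x v : F →ₗ[ℝ] F) := by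
    ext a
    rw [covRiemann_conf h]
    simp [kulkarni, covSchouten_codazzi h a, real_inner_comm z]
  rw [divRiemann, this]
  simp only [map_sub, map_add, trace_smulRight_eq, map_smul, htr]
  simp [covSchouten_codazzi h v w]

end Coord

end

/-! ### The Laplacian, the Yamabe equation and the minimum principle. -/

noncomputable section

open Filter Topology

local notation "⟪" x ", " y "⟫" => inner ℝ x y

namespace Coord

variable {F : Type*} [NormedAddCommGroup F] [InnerProductSpace ℝ F]
  {u v : F → ℝ} {x : F}

theorem IsSmoothNear.comp {g : ℝ → ℝ} (hv : IsSmoothNear v x)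
    (hg : ∀ᶠ s in 𝓝 (v x), ContDiffAt ℝ ∞ g s) : IsSmoothNear (fun y => g (v y)) x := by
  filter_upwards [hv, hv.self_of_nhds.continuousAt.eventually hg] with y h1 h2
  exact h2.comp y h1

theorem IsSmoothNear.sub (hu : IsSmoothNear u x) (hv : IsSmoothNear v x) :
    IsSmoothNear (fun y => u y - v y) x := by
  filter_upwards [hu, hv] with y h1 h2 using h1.sub h2

theorem IsSmoothNear.const_mul (hu : IsSmoothNear u x) (c : ℝ) :
    IsSmoothNear (fun y => c * u y) x := by
  filter_upwards [hu] with y h1 using contDiffAt_const.mul h1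

theorem isSmoothNear_of_contDiff (h : ContDiff ℝ ∞ v) : IsSmoothNear v x :=
  Eventually.of_forall fun _ => h.contDiffAt

theorem isSmoothNear_log_norm {c : F} (hx : x ≠ c) : IsSmoothNear (fun y => Real.log ‖y - c‖) x := by
  filter_upwards [isOpen_ne.mem_nhds hx] with y hy
  have h0 : y - c ≠ 0 := sub_ne_zero.2 hy
  exact (((contDiffAt_norm ℝ h0).comp y (contDiffAt_id.sub contDiffAt_const))).log
    (norm_ne_zero_iff.2 h0)

theorem isSmoothNear_norm_rpow {c : F} (hx : x ≠ c) (β : ℝ) :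
    IsSmoothNear (fun y => ‖y - c‖ ^ β) x := by
  filter_upwards [isOpen_ne.mem_nhds hx] with y hy
  have h0 : y - c ≠ 0 := sub_ne_zero.2 hy
  exact (((contDiffAt_norm ℝ h0).comp y (contDiffAt_id.sub contDiffAt_const))).rpow_const_of_ne
    (norm_ne_zero_iff.2 h0)

variable [FiniteDimensional ℝ F]

theorem gradient_eq_of_hasFDerivAt {w : F} {A : F →L[ℝ] ℝ} (h : HasFDerivAt v A x)
    (hw : ∀ z, A z = ⟪w, z⟫) : gradient v x = w := by
  have := FiniteDimensional.complete ℝ F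
  refine ext_inner_right ℝ fun z => ?_
  rw [← fderiv_eq_inner_gradient, h.fderiv, hw]

/-- The Laplacian, as the trace of the derivative of the gradient. -/
def lap (v : F → ℝ) (x : F) : ℝ := LinearMap.trace ℝ F (fderiv ℝ (gradient v) x)

theorem gradient_comp {g : ℝ → ℝ} (hv : DifferentiableAt ℝ v x)
    (hg : DifferentiableAt ℝ g (v x)) :
    gradient (fun y => g (v y)) x = deriv g (v x) • gradient v x := by
  apply gradient_eq_of_hasFDerivAt (hg.hasDerivAt.comp_hasFDerivAt x hv.hasFDerivAt)
  intro z
  rw [real_inner_smul_left, _root_.smul_apply, smul_eq_mul, fderiv_eq_inner_gradient]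

theorem fderiv_gradient_comp {g : ℝ → ℝ} (hv : IsSmoothNear v x)
    (hg : ∀ᶠ s in 𝓝 (v x), ContDiffAt ℝ ∞ g s) :
    fderiv ℝ (gradient fun y => g (v y)) x =
      deriv g (v x) • fderiv ℝ (gradient v) x +
        (deriv (deriv g) (v x) • innerSL ℝ (gradient v x)).smulRight (gradient v x) := by
  have hev : (gradient fun y => g (v y)) =ᶠ[𝓝 x] fun y => deriv g (v y) • gradient v y := by
    filter_upwards [hv, hv.self_of_nhds.continuousAt.eventually hg] with y h1 h2
    exact gradient_comp (h1.differentiableAt (by simp)) (h2.differentiableAt (by simp))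
  rw [hev.fderiv_eq]
  have h1 : DifferentiableAt ℝ (deriv g) (v x) :=
    ((hg.self_of_nhds.fderiv_right (m := ∞) (by simp)).clm_apply
      (contDiffAt_const (c := (1 : ℝ)))).differentiableAt (by simp)
  have h2 := h1.hasDerivAt.comp_hasFDerivAt x
    (hv.self_of_nhds.differentiableAt (by simp)).hasFDerivAt
  have h3 : fderiv ℝ (fun y => deriv g (v y) • gradient v y) x = _ :=
    (h2.smul hv.hasFDerivAt_gradient).fderiv
  rw [h3]
  ext z
  simp only [_root_.add_apply, _root_.smul_apply, ContinuousLinearMap.smulRight_apply,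
    fderiv_eq_inner_gradient, Function.comp_apply, innerSL_apply_apply]

theorem lap_comp {g : ℝ → ℝ} (hv : IsSmoothNear v x)
    (hg : ∀ᶠ s in 𝓝 (v x), ContDiffAt ℝ ∞ g s) :
    lap (fun y => g (v y)) x =
      deriv g (v x) * lap v x + deriv (deriv g) (v x) * ⟪gradient v x, gradient v x⟫ := by
  rw [lap, fderiv_gradient_comp hv hg]
  have : ((deriv g (v x) • fderiv ℝ (gradient v) x +
        (deriv (deriv g) (v x) • innerSL ℝ (gradient v x)).smulRight (gradient v x) : F →L[ℝ] F)
        : F →ₗ[ℝ] F) = deriv g (v x) • (fderiv ℝ (gradient v) x : F →ₗ[ℝ] F) +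
        ((deriv (deriv g) (v x) • innerSL ℝ (gradient v x) : F →L[ℝ] ℝ) : F →ₗ[ℝ] ℝ).smulRight
          (gradient v x) := by
    ext; simp
  rw [this, map_add, map_smul, trace_smulRight_eq]
  simp [lap]

theorem trace_schouten (f : F → ℝ) (x : F) :
    LinearMap.trace ℝ F (schouten f x) = lap f x +
      ((Module.finrank ℝ F : ℝ) - 2) / 2 * ⟪gradient f x, gradient f x⟫ := by
  have : (schouten f x : F →ₗ[ℝ] F) = (fderiv ℝ (gradient f) x : F →ₗ[ℝ] F) -
      ((innerSL ℝ (gradient f x) : F →L[ℝ] ℝ) : F →ₗ[ℝ] ℝ).smulRight (gradient f x) +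
      (2⁻¹ * ⟪gradient f x, gradient f x⟫) • LinearMap.id := by
    ext; simp [schouten]
  rw [this]
  simp only [map_sub, map_add, trace_smulRight_eq, map_smul, LinearMap.trace_id, lap]
  simp
  ring

/-- The exponent f = (2/(m-2)) log v, that is, the metric v^{4/(m-2)}⟪·,·⟫, is the one for which the
|∇v|² terms cancel and only the Laplacian remains. -/
theorem scalar_conf_log (hm : 3 ≤ Module.finrank ℝ F) (hv : IsSmoothNear v x) (hpos : 0 < v x) :
    scalar (conf fun y => 2 / ((Module.finrank ℝ F : ℝ) - 2) * Real.log (v y)) x =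
      -(4 * ((Module.finrank ℝ F : ℝ) - 1) / ((Module.finrank ℝ F : ℝ) - 2)) *
        (lap v x * v x ^ (-(((Module.finrank ℝ F : ℝ) + 2) / ((Module.finrank ℝ F : ℝ) - 2)))) := by
  have hm' : (3 : ℝ) ≤ Module.finrank ℝ F := by exact_mod_cast hm
  have hl : ∀ᶠ s in 𝓝 (v x), ContDiffAt ℝ ∞
      (fun s => 2 / ((Module.finrank ℝ F : ℝ) - 2) * Real.log s) s := by
    filter_upwards [isOpen_ne.mem_nhds hpos.ne'] with s hs
    exact contDiffAt_const.mul (contDiffAt_id.log hs)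
  rw [scalar_conf (hv.comp hl), trace_schouten, lap_comp hv hl,
    gradient_comp (hv.self_of_nhds.differentiableAt (by simp))
      (hl.self_of_nhds.differentiableAt (by simp))]
  generalize (Module.finrank ℝ F : ℝ) = m at hm'
  have hm2 : m - 2 ≠ 0 := by linarith
  have d1 : deriv (fun s => 2 / (m - 2) * Real.log s) = fun s => 2 / (m - 2) * s⁻¹ := by
    funext s
    simp
  have d2 : deriv (deriv fun s => 2 / (m - 2) * Real.log s) (v x) =
      -(2 / (m - 2) * (v x ^ 2)⁻¹) := by
    rw [d1]
    simp
  have hexp : Real.exp (-2 * (2 / (m - 2) * Real.log (v x))) = v x ^ (-(4 / (m - 2))) := by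
    rw [Real.rpow_def_of_pos hpos]
    congr 1
    ring
  have hpow : v x ^ (-((m + 2) / (m - 2))) = v x ^ (-(4 / (m - 2))) * (v x)⁻¹ := by
    rw [← Real.rpow_neg_one, ← Real.rpow_add hpos]
    congr 1
    field_simp
    ring
  rw [d2, d1, hexp, hpow]
  simp only [real_inner_smul_left, real_inner_smul_right]
  field_simp
  ring

/-- The trace is a sum of second derivatives along lines. A negative one would make the point also a
strict-type maximum along its line by the second derivative test, so `v` would be locally constant
on that line and the derivative zero. -/
theorem nonneg_lap_of_isLocalMin (hv : IsSmoothNear v x) (h : IsLocalMin v x) : 0 ≤ lap v x := by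
  rw [lap, LinearMap.trace_eq_sum_inner _ (stdOrthonormalBasis ℝ F)]
  refine Finset.sum_nonneg fun i _ => ?_
  generalize stdOrthonormalBasis ℝ F i = e
  by_contra! hneg
  have hline : Continuous fun t : ℝ => x + t • e := by fun_prop
  have hl0 : Tendsto (fun t : ℝ => x + t • e) (𝓝 0) (𝓝 x) := by
    simpa using hline.tendsto 0
  have hd : ∀ t : ℝ, HasDerivAt (fun t : ℝ => x + t • e) e t := fun t => by
    simpa using ((hasDerivAt_id t).smul_const e).const_add x
  have hder : deriv (fun t : ℝ => v (x + t • e)) =ᶠ[𝓝 0] fun t => ⟪gradient v (x + t • e), e⟫ := by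
    filter_upwards [hl0.eventually hv] with t ht
    have := (ht.differentiableAt (by simp)).hasFDerivAt.comp_hasDerivAt t (hd t)
    rw [← fderiv_eq_inner_gradient]
    exact this.deriv
  have hg : HasFDerivAt (gradient v) (fderiv ℝ (gradient v) x) (x + (0 : ℝ) • e) := by
    simpa using hv.hasFDerivAt_gradient
  have hder2 : deriv (deriv fun t : ℝ => v (x + t • e)) 0 = ⟪e, fderiv ℝ (gradient v) x e⟫ := by
    rw [hder.deriv_eq]
    have := (hg.comp_hasDerivAt (0 : ℝ) (hd 0)).inner ℝ (hasDerivAt_const (0 : ℝ) e)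
    have e1 : deriv (fun t : ℝ => ⟪gradient v (x + t • e), e⟫) 0 = _ := this.deriv
    rw [e1, inner_zero_right, zero_add, real_inner_comm]
  have hmin : IsLocalMin (fun t : ℝ => v (x + t • e)) 0 := by
    have : ∀ᶠ t : ℝ in 𝓝 0, v x ≤ v (x + t • e) := hl0.eventually h
    simpa [IsLocalMin, IsMinFilter] using this
  have hv0 : ContDiffAt ℝ ∞ v (x + (0 : ℝ) • e) := by simpa using hv.self_of_nhds
  have hcont : ContinuousAt (fun t : ℝ => v (x + t • e)) 0 :=
    ContinuousAt.comp (f := fun t : ℝ => x + t • e) hv0.continuousAt hline.continuousAt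
  have hmax := isLocalMax_of_deriv_deriv_neg (f := fun t : ℝ => v (x + t • e)) (x₀ := 0)
    (by rw [hder2]; exact hneg) hmin.deriv_eq_zero hcont
  have hconst : (fun t : ℝ => v (x + t • e)) =ᶠ[𝓝 0] fun _ => v (x + (0 : ℝ) • e) := by
    filter_upwards [hmin, hmax] with t h1 h2
    exact le_antisymm h2 h1
  have : deriv (deriv fun t : ℝ => v (x + t • e)) 0 = 0 := by
    have h1 : deriv (fun t : ℝ => v (x + t • e)) =ᶠ[𝓝 0] fun _ => 0 := by
      filter_upwards [hconst.eventuallyEq_nhds] with t ht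
      rw [ht.deriv_eq, deriv_const]
    rw [h1.deriv_eq, deriv_const]
  rw [hder2] at this
  exact hneg.ne this

theorem lap_sub (hu : IsSmoothNear u x) (hv : IsSmoothNear v x) :
    lap (fun y => u y - v y) x = lap u x - lap v x := by
  have hev : (gradient fun y => u y - v y) =ᶠ[𝓝 x] fun y => gradient u y - gradient v y := by
    filter_upwards [hu, hv] with y h1 h2
    apply gradient_eq_of_hasFDerivAt
      ((h1.differentiableAt (by simp)).hasFDerivAt.sub (h2.differentiableAt (by simp)).hasFDerivAt)
    intro z
    rw [_root_.sub_apply, fderiv_eq_inner_gradient, fderiv_eq_inner_gradient, inner_sub_left]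
  have h3 : fderiv ℝ (fun y => gradient u y - gradient v y) x = _ :=
    (hu.hasFDerivAt_gradient.sub hv.hasFDerivAt_gradient).fderiv
  rw [lap, hev.fderiv_eq, h3]
  simp [lap]

theorem lap_const_mul (hu : IsSmoothNear u x) (c : ℝ) :
    lap (fun y => c * u y) x = c * lap u x := by
  have hev : (gradient fun y => c * u y) =ᶠ[𝓝 x] fun y => c • gradient u y := by
    filter_upwards [hu] with y h1
    apply gradient_eq_of_hasFDerivAt ((h1.differentiableAt (by simp)).hasFDerivAt.const_mul c)
    intro z
    rw [_root_.smul_apply, fderiv_eq_inner_gradient, real_inner_smul_left, smul_eq_mul]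
  have h3 : fderiv ℝ (fun y => c • gradient u y) x = _ :=
    (hu.hasFDerivAt_gradient.const_smul c).fderiv
  rw [lap, hev.fderiv_eq, h3]
  simp [lap]

theorem lap_congr (h : u =ᶠ[𝓝 x] v) : lap u x = lap v x := by
  have : gradient u =ᶠ[𝓝 x] gradient v := by
    filter_upwards [h.eventuallyEq_nhds] with y hy
    rw [gradient, gradient, hy.fderiv_eq]
  rw [lap, lap, this.fderiv_eq]

theorem lap_norm_sq : lap (fun y : F => ‖y‖ ^ 2) x = 2 * Module.finrank ℝ F := by
  have hev : (gradient fun y : F => ‖y‖ ^ 2) = fun y => (2 : ℝ) • y := by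
    funext y
    apply gradient_eq_of_hasFDerivAt (hasStrictFDerivAt_norm_sq y).hasFDerivAt
    intro z
    simp [real_inner_smul_left]
  have h3 : fderiv ℝ (fun y : F => (2 : ℝ) • y) x = (2 : ℝ) • ContinuousLinearMap.id ℝ F :=
    ((hasFDerivAt_id x).const_smul (2 : ℝ)).fderiv
  rw [lap, hev, h3]
  simp only [ContinuousLinearMap.toLinearMap_smul, map_smul, ContinuousLinearMap.coe_id,
    LinearMap.trace_id, smul_eq_mul]

/-- The weak minimum principle. -/
theorem nonneg_of_lap_nonpos [Nontrivial F] {K : Set F} (hK : IsCompact K) {w : F → ℝ}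
    (hc : ContinuousOn w K)
    (h : ∀ y ∈ K, 0 ≤ w y ∨ (K ∈ 𝓝 y ∧ IsSmoothNear w y ∧ lap w y ≤ 0)) {y : F} (hy : y ∈ K) :
    0 ≤ w y := by
  by_contra! hneg
  obtain ⟨R, hR⟩ := hK.isBounded.exists_norm_le
  -- Subtracting η‖y‖² makes the Laplacian strictly negative wherever `lap w ≤ 0`. Since η R² <
  -- -w(y), a minimum point of the perturbed function still has `w` negative, so it must be an
  -- interior point.
  set η := -(w y) / (2 * (R ^ 2 + 1)) with hη
  have hη0 : 0 < η := by rw [hη]; exact div_pos (by linarith) (by positivity)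
  have hη1 : η * R ^ 2 < -(w y) := by
    have : η * (2 * (R ^ 2 + 1)) = -(w y) := by rw [hη]; field_simp
    nlinarith [sq_nonneg R]
  obtain ⟨z, hz, hmin⟩ := hK.exists_isMinOn ⟨y, hy⟩
    (f := fun y => w y - η * ‖y‖ ^ 2) (hc.sub (by fun_prop))
  have h1 : w z - η * ‖z‖ ^ 2 ≤ w y - η * ‖y‖ ^ 2 := hmin hy
  have h2 : ‖z‖ ^ 2 ≤ R ^ 2 := by
    have := hR z hz
    gcongr
  have h3 : w z < 0 := by nlinarith [sq_nonneg ‖y‖]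
  rcases h z hz with h4 | ⟨hn, hs, hl⟩
  · linarith
  · have hsq : IsSmoothNear (fun y : F => ‖y‖ ^ 2) z := isSmoothNear_of_contDiff (contDiff_norm_sq ℝ)
    have hsm : IsSmoothNear (fun y => w y - η * ‖y‖ ^ 2) z := hs.sub (hsq.const_mul η)
    have h5 := nonneg_lap_of_isLocalMin hsm (hmin.isLocalMin hn)
    rw [lap_sub hs (hsq.const_mul η), lap_const_mul hsq, lap_norm_sq] at h5
    have h6 : (0 : ℝ) < Module.finrank ℝ F := by exact_mod_cast Module.finrank_pos
    nlinarith [mul_pos hη0 h6]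

section Radial

variable {c : F}

theorem gradient_log_norm (hx : x ≠ c) :
    gradient (fun y => Real.log ‖y - c‖) x = (‖x - c‖ ^ 2)⁻¹ • (x - c) := by
  have h0 : x - c ≠ 0 := sub_ne_zero.2 hx
  have h1 : (‖x - c‖ ^ 2) ≠ 0 := by positivity
  have h2 : (fun y => Real.log ‖y - c‖) = fun y => 2⁻¹ * Real.log (‖y - c‖ ^ 2) := by
    funext y
    rw [Real.log_pow]; push_cast; ring
  have h3 : HasFDerivAt (fun y : F => ‖y - c‖ ^ 2) _ x := ((hasFDerivAt_id x).sub_const c).norm_sq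
  rw [h2]
  apply gradient_eq_of_hasFDerivAt ((h3.log h1).const_mul 2⁻¹)
  intro z
  simp [real_inner_smul_left, inner_sub_left]
  ring

theorem fderiv_gradient_log_norm (hx : x ≠ c) (z : F) :
    fderiv ℝ (gradient fun y => Real.log ‖y - c‖) x z =
      (‖x - c‖ ^ 2)⁻¹ • z - (2 * ((‖x - c‖ ^ 2)⁻¹) ^ 2 * ⟪x - c, z⟫) • (x - c) := by
  have h0 : x - c ≠ 0 := sub_ne_zero.2 hx
  have h1 : (‖x - c‖ ^ 2) ≠ 0 := by positivity
  have hev : (gradient fun y => Real.log ‖y - c‖) =ᶠ[𝓝 x]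
      fun y => (‖y - c‖ ^ 2)⁻¹ • (y - c) := by
    filter_upwards [isOpen_ne.mem_nhds hx] with y hy using gradient_log_norm hy
  have h3 : HasFDerivAt (fun y : F => ‖y - c‖ ^ 2) _ x := ((hasFDerivAt_id x).sub_const c).norm_sq
  have h4 : fderiv ℝ (fun y => (‖y - c‖ ^ 2)⁻¹ • (y - c)) x = _ :=
    (((hasDerivAt_inv h1).comp_hasFDerivAt x h3).smul ((hasFDerivAt_id x).sub_const c)).fderiv
  rw [hev.fderiv_eq, h4]
  simp [inner_sub_left]
  module

theorem lap_log_norm (hx : x ≠ c) :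
    lap (fun y => Real.log ‖y - c‖) x = ((Module.finrank ℝ F : ℝ) - 2) / ‖x - c‖ ^ 2 := by
  have h0 : x - c ≠ 0 := sub_ne_zero.2 hx
  have h1 : (‖x - c‖ ^ 2) ≠ 0 := by positivity
  have : (fderiv ℝ (gradient fun y => Real.log ‖y - c‖) x : F →ₗ[ℝ] F) =
      (‖x - c‖ ^ 2)⁻¹ • LinearMap.id - (2 * ((‖x - c‖ ^ 2)⁻¹) ^ 2) •
        ((innerSL ℝ (x - c) : F →L[ℝ] ℝ) : F →ₗ[ℝ] ℝ).smulRight (x - c) := by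
    ext z
    simp [fderiv_gradient_log_norm hx, smul_smul, inner_sub_left]
  rw [lap, this, map_sub, map_smul, map_smul, LinearMap.trace_id, trace_smulRight_eq,
    ContinuousLinearMap.coe_coe, innerSL_apply_apply, real_inner_self_eq_norm_sq, smul_eq_mul,
    smul_eq_mul]
  field_simp

theorem lap_comp_log_norm (hx : x ≠ c) {g : ℝ → ℝ} (hg : ContDiff ℝ ∞ g) :
    lap (fun y => g (Real.log ‖y - c‖)) x =
      (deriv (deriv g) (Real.log ‖x - c‖) +
        ((Module.finrank ℝ F : ℝ) - 2) * deriv g (Real.log ‖x - c‖)) / ‖x - c‖ ^ 2 := by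
  have h0 : x - c ≠ 0 := sub_ne_zero.2 hx
  rw [lap_comp (isSmoothNear_log_norm hx) (Eventually.of_forall fun _ => hg.contDiffAt),
    lap_log_norm hx, gradient_log_norm hx, real_inner_smul_left, real_inner_smul_right,
    real_inner_self_eq_norm_sq]
  field_simp
  ring

/-- Two exponents matter below: β = 2 - m gives the harmonic function in the barrier, and β =
-(m-2)/2 the function that corresponds to a constant on the cylinder. -/
theorem lap_norm_rpow (hx : x ≠ c) (β : ℝ) :
    lap (fun y => ‖y - c‖ ^ β) x =
      β * (β + (Module.finrank ℝ F : ℝ) - 2) * ‖x - c‖ ^ β / ‖x - c‖ ^ 2 := by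
  have h1 : (fun y => ‖y - c‖ ^ β) =ᶠ[𝓝 x] fun y => Real.exp (β * Real.log ‖y - c‖) := by
    filter_upwards [isOpen_ne.mem_nhds hx] with y hy
    rw [Real.rpow_def_of_pos (norm_pos_iff.2 (sub_ne_zero.2 hy)), mul_comm]
  have d1 : deriv (fun s : ℝ => Real.exp (β * s)) = fun s => β * Real.exp (β * s) := by
    funext s
    have := (((hasDerivAt_id s).const_mul β).exp).deriv
    simp only [id_eq, mul_one] at this
    rw [this, mul_comm]
  have d2 : deriv (fun s : ℝ => β * Real.exp (β * s)) = fun s => β * (β * Real.exp (β * s)) := by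
    funext s
    rw [deriv_const_mul _ (by fun_prop), d1]
  rw [lap_congr h1, lap_comp_log_norm hx (g := fun s => Real.exp (β * s)) (by fun_prop), d1, d2]
  have h2 : ‖x - c‖ ^ β = Real.exp (β * Real.log ‖x - c‖) := h1.self_of_nhds
  rw [h2]
  ring

end Radial

end Coord

end

/-! ### Kelvin transforms and barriers for singular solutions. -/

noncomputable section

open Filter Topology EuclideanGeometry

local notation "⟪" x ", " y "⟫" => inner ℝ x y

namespace Coord

variable {F : Type*} [NormedAddCommGroup F] [InnerProductSpace ℝ F]

/-- The Kelvin transform of `v` in the sphere of centre `x` and radius `l`, with weight `2a`. -/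
def kelvin (v : F → ℝ) (a : ℝ) (x : F) (l : ℝ) (y : F) : ℝ :=
  (l / ‖y - x‖) ^ (2 * a) * v (inversion x l y)

variable {v : F → ℝ} {a K c l : ℝ} {x y : F}

theorem kelvin_of_mem_sphere (hl : 0 < l) (hy : ‖y - x‖ = l) : kelvin v a x l y = v y := by
  rw [kelvin, hy, div_self hl.ne', Real.one_rpow, one_mul,
    inversion_of_mem_sphere (by rwa [Metric.mem_sphere, dist_eq_norm])]

theorem norm_inversion_sub (x y : F) (l : ℝ) : ‖inversion x l y - x‖ = l ^ 2 / ‖y - x‖ := by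
  rw [← dist_eq_norm, ← dist_eq_norm, dist_inversion_center]

theorem norm_inversion_sub_le (hl : 0 < l) (hy : l ≤ ‖y - x‖) : ‖inversion x l y - x‖ ≤ l := by
  rw [norm_inversion_sub, div_le_iff₀ (hl.trans_le hy), pow_two]
  gcongr

theorem inversion_ne_zero (hl : 0 < l) (hlx : l < ‖x‖) (hy : l ≤ ‖y - x‖) :
    inversion x l y ≠ 0 := by
  intro h
  have := norm_inversion_sub_le hl hy
  rw [h, zero_sub, norm_neg] at this
  linarith

theorem isInvertible_fderiv_inversion (hl : 0 < l) (hy : y ≠ x) :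
    (fderiv ℝ (inversion x l) y).IsInvertible := by
  rw [(hasFDerivAt_inversion hy).fderiv]
  have h0 : (l / dist y x) ^ 2 ≠ 0 := by
    have := dist_pos.2 hy
    positivity
  refine ⟨((ℝ ∙ (y - x))ᗮ.reflection.toContinuousLinearEquiv).trans
    (ContinuousLinearEquiv.smulLeft (Units.mk0 _ h0)), ?_⟩
  ext z
  simp [ContinuousLinearEquiv.smulLeft, Units.smul_def]

theorem isLocalDiffeoNear_inversion (hl : 0 < l) (hy : y ≠ x) :
    IsLocalDiffeoNear (inversion x l) y := by
  filter_upwards [isOpen_ne.mem_nhds hy] with z hz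
  exact ⟨contDiffAt_const.inversion contDiffAt_const contDiffAt_id hz,
    isInvertible_fderiv_inversion hl hz⟩

theorem isSmoothNear_kelvin (hl : 0 < l) (hy : y ≠ x) (hv : IsSmoothNear v (inversion x l y)) :
    IsSmoothNear (kelvin v a x l) y := by
  have hd := isLocalDiffeoNear_inversion hl hy
  filter_upwards [isOpen_ne.mem_nhds hy, hd, hd.contDiffAt.continuousAt.eventually hv]
    with z hz h1 h2
  have h0 : z - x ≠ 0 := sub_ne_zero.2 hz
  have h3 : ContDiffAt ℝ ∞ (fun z => l / ‖z - x‖) z :=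
    contDiffAt_const.div ((contDiffAt_norm ℝ h0).comp z (contDiffAt_id.sub contDiffAt_const))
      (norm_ne_zero_iff.2 h0)
  exact (h3.rpow_const_of_ne (div_ne_zero hl.ne' (norm_ne_zero_iff.2 h0))).mul (h2.comp z h1.1)

theorem ne_zero_of_norm_sub_le {V : Type*} [SeminormedAddCommGroup V] {x y : V} {r : ℝ}
    (hr : r < ‖x‖) (hy : ‖y - x‖ ≤ r) : y ≠ 0 := by
  rintro rfl
  rw [zero_sub, norm_neg] at hy
  linarith

theorem kelvin_le {r M : ℝ} (hM : ∀ y, ‖y - x‖ ≤ r → v y ≤ M) (hl : 0 < l)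
    (hlr : l ≤ r) (hy : l ≤ ‖y - x‖) : kelvin v a x l y ≤ (l / ‖y - x‖) ^ (2 * a) * M := by
  rw [kelvin]
  have := hl.trans_le hy
  gcongr
  exact hM _ ((norm_inversion_sub_le hl hy).trans hlr)

theorem continuous_inversion_uncurry (x : F) {l : ℝ} {y : F} (hy : y ≠ x) :
    ContinuousAt (fun q : ℝ × F => inversion x q.1 q.2) (l, y) :=
  ContinuousAt.inversion continuousAt_const continuousAt_fst continuousAt_snd hy

/-- The bound that is propagated in the method of moving spheres. -/
def Below (v : F → ℝ) (a : ℝ) (x : F) (l : ℝ) : Prop :=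
  ∀ y, y ≠ 0 → l ≤ ‖y - x‖ → kelvin v a x l y ≤ v y

variable [FiniteDimensional ℝ F]

/-- Conformal covariance of the Yamabe operator under inversions. -/
theorem lap_kelvin (hm : 3 ≤ Module.finrank ℝ F) (ha : (Module.finrank ℝ F : ℝ) = 2 * a + 2)
    (hl : 0 < l) (hy : y ≠ x) (hv : IsSmoothNear v (inversion x l y))
    (hpos : 0 < v (inversion x l y)) :
    lap (kelvin v a x l) y * kelvin v a x l y ^ (-((a + 2) / a)) =
      lap v (inversion x l y) * v (inversion x l y) ^ (-((a + 2) / a)) := by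
  have hm' : (3 : ℝ) ≤ Module.finrank ℝ F := by exact_mod_cast hm
  have ha0 : 0 < a := by linarith
  have hma : (Module.finrank ℝ F : ℝ) - 2 = 2 * a := by linarith
  have hd := isLocalDiffeoNear_inversion hl hy
  have hl0 : ∀ z, z ≠ x → 0 < l / ‖z - x‖ := fun z hz =>
    div_pos hl (norm_pos_iff.2 (sub_ne_zero.2 hz))
  have hkpos : 0 < kelvin v a x l y := mul_pos (Real.rpow_pos_of_pos (hl0 y hy) _) hpos
  have hlog : ∀ᶠ s in 𝓝 (v (inversion x l y)), ContDiffAt ℝ ∞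
      (fun s => 2 / ((Module.finrank ℝ F : ℝ) - 2) * Real.log s) s := by
    filter_upwards [isOpen_ne.mem_nhds hpos.ne'] with s hs
    exact contDiffAt_const.mul (contDiffAt_id.log hs)
  -- The inversion pulls the conformal metric of `v` back to that of its Kelvin transform, so
  -- naturality of the scalar curvature replaces a direct computation of the Laplacian.
  have key := scalar_pull (Φ := inversion x l) (x := y)
    (G := conf fun y => 2 / ((Module.finrank ℝ F : ℝ) - 2) * Real.log (v y))
    (G' := conf fun y => 2 / ((Module.finrank ℝ F : ℝ) - 2) * Real.log (kelvin v a x l y))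
    hd (hv.comp hlog).isMetricNear ?_
  · rw [scalar_conf_log hm hv hpos, scalar_conf_log hm (isSmoothNear_kelvin hl hy hv) hkpos] at key
    have h1 : -(4 * ((Module.finrank ℝ F : ℝ) - 1) / ((Module.finrank ℝ F : ℝ) - 2)) ≠ 0 := by
      refine neg_ne_zero.2 (div_ne_zero ?_ ?_) <;> nlinarith
    have h2 : ((Module.finrank ℝ F : ℝ) + 2) / ((Module.finrank ℝ F : ℝ) - 2) = (a + 2) / a := by
      rw [hma, ha]
      field_simp
      ring
    rw [h2] at key
    exact mul_left_cancel₀ h1 key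
  · filter_upwards [isOpen_ne.mem_nhds hy, hd.contDiffAt.continuousAt.eventually
      (hv.self_of_nhds.continuousAt.eventually (lt_mem_nhds hpos))] with z hz hvz
    ext b d
    have h3 : ⟪(ℝ ∙ (z - x))ᗮ.reflection b, (ℝ ∙ (z - x))ᗮ.reflection d⟫ = ⟪b, d⟫ :=
      LinearIsometryEquiv.inner_map_map _ _ _
    rw [pull_apply, conf_apply, conf_apply, (hasFDerivAt_inversion hz).fderiv]
    simp only [_root_.smul_apply, real_inner_smul_left, real_inner_smul_right]
    have h4 : ⟪((ℝ ∙ (z - x))ᗮ.reflection : F →L[ℝ] F) b,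
      ((ℝ ∙ (z - x))ᗮ.reflection : F →L[ℝ] F) d⟫ = ⟪b, d⟫ := h3
    rw [h4, kelvin, Real.log_mul (Real.rpow_pos_of_pos (hl0 z hz) _).ne' hvz.ne',
      Real.log_rpow (hl0 z hz), dist_eq_norm]
    -- The differential of the inversion is a reflection times (l/‖z-x‖)², so the pulled-back metric
    -- gains the fourth power of l/‖z-x‖. The weight 2a is exactly the one that produces it.
    have h5 : 2 * (2 / ((Module.finrank ℝ F : ℝ) - 2) *
        (2 * a * Real.log (l / ‖z - x‖) + Real.log (v (inversion x l z)))) =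
        (2 * (2 / ((Module.finrank ℝ F : ℝ) - 2) * Real.log (v (inversion x l z)))) +
          (4 : ℕ) * Real.log (l / ‖z - x‖) := by
      rw [hma]
      push_cast
      field_simp
      ring
    rw [h5, Real.exp_add, Real.exp_nat_mul, Real.exp_log (hl0 z hz)]
    ring

/-- A positive solution of the Yamabe equation on a punctured Euclidean space, with a lower bound
at both ends. -/
structure IsSingularSolution (v : F → ℝ) (a K c : ℝ) : Prop where
  three_le : 3 ≤ Module.finrank ℝ F
  finrank_eq : (Module.finrank ℝ F : ℝ) = 2 * a + 2
  contDiffOn : ContDiffOn ℝ ∞ v {0}ᶜ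
  pos : ∀ x, x ≠ 0 → 0 < v x
  lap_eq : ∀ x, x ≠ 0 → lap v x = -K * v x ^ ((a + 2) / a)
  nonneg : 0 ≤ K
  c_pos : 0 < c
  lower : ∀ x, x ≠ 0 → c * ‖x‖ ^ (-a) ≤ v x

namespace IsSingularSolution

variable (h : IsSingularSolution v a K c)

include h

theorem a_pos : 0 < a := by
  have h1 := h.finrank_eq
  have h2 : (3 : ℝ) ≤ Module.finrank ℝ F := by exact_mod_cast h.three_le
  linarith

theorem isSmoothNear (hy : y ≠ 0) : IsSmoothNear v y :=
  isSmoothNear_of_isOpen isOpen_compl_singleton h.contDiffOn hy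

theorem continuousAt (hy : y ≠ 0) : ContinuousAt v y :=
  (h.isSmoothNear hy).self_of_nhds.continuousAt

theorem kelvin_pos (hl : 0 < l) (hlx : l < ‖x‖) (hy : l ≤ ‖y - x‖) : 0 < kelvin v a x l y :=
  mul_pos (Real.rpow_pos_of_pos (div_pos hl (hl.trans_le hy)) _)
    (h.pos _ (inversion_ne_zero hl hlx hy))

theorem lap_kelvin_eq (hl : 0 < l) (hlx : l < ‖x‖) (hy : l ≤ ‖y - x‖) :
    lap (kelvin v a x l) y = -K * kelvin v a x l y ^ ((a + 2) / a) := by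
  have h0 := inversion_ne_zero hl hlx hy
  have hyx : y ≠ x := by
    rintro rfl
    rw [sub_self, norm_zero] at hy
    linarith
  have h1 := lap_kelvin h.three_le h.finrank_eq hl hyx (h.isSmoothNear h0) (h.pos _ h0)
  have h2 := Real.rpow_pos_of_pos (h.pos _ h0) ((a + 2) / a)
  have h3 := Real.rpow_pos_of_pos (h.kelvin_pos hl hlx hy) ((a + 2) / a)
  rw [h.lap_eq _ h0, Real.rpow_neg (h.pos _ h0).le, Real.rpow_neg (h.kelvin_pos hl hlx hy).le,
    mul_assoc, mul_inv_cancel₀ h2.ne', mul_one] at h1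
  field_simp at h1
  linarith

theorem exists_bound {r : ℝ} (hr : r < ‖x‖) : ∃ M, 0 < M ∧ ∀ y, ‖y - x‖ ≤ r → v y ≤ M := by
  have hc : ContinuousOn v (closedBall x r) := fun y hy =>
    (h.continuousAt (ne_zero_of_norm_sub_le hr (by simpa [dist_eq_norm] using hy))).continuousWithinAt
  obtain ⟨M, hM⟩ := (isCompact_closedBall x r).exists_bound_of_continuousOn hc
  refine ⟨max M 1, by positivity, fun y hy => ?_⟩
  exact (le_abs_self _).trans ((hM y (by simpa [dist_eq_norm] using hy)).trans (le_max_left _ _))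

/-- Uniformly in `l ≤ r`, no violation of `Below` can occur near 0 or near infinity. Near 0, `v` is
at least a multiple of ‖y‖^{-a} while the transform stays bounded; far away the transform is
O(‖y‖^{-2a}). This confines the argument to a compact annulus, with a gap δ on both boundary
spheres. -/
theorem exists_ends {r : ℝ} (hr : r < ‖x‖) : ∃ ε R δ : ℝ, 0 < ε ∧ 0 < δ ∧
    ∀ l, 0 < l → l ≤ r → ∀ y, y ≠ 0 → l ≤ ‖y - x‖ →
      (‖y‖ ≤ ε → kelvin v a x l y + δ ≤ v y) ∧ (‖y‖ = R → kelvin v a x l y + δ ≤ v y) ∧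
        (R ≤ ‖y‖ → kelvin v a x l y < v y) := by
  have ha := h.a_pos
  have hc := h.c_pos
  obtain ⟨M, hM0, hM⟩ := h.exists_bound hr
  rcases le_or_gt r 0 with hr0 | hr0
  · exact ⟨1, 1, 1, one_pos, one_pos, fun l h1 h2 => absurd (h1.trans_le h2) hr0.not_gt⟩
  have hx0 : 0 < ‖x‖ := hr0.trans hr
  have hQ : 0 < (M + 1) / c := by positivity
  -- For ‖y‖ ≥ 2‖x‖ one has ‖y-x‖ ≥ ‖y‖/2, so the transform is at most (2r)^{2a} M ‖y‖^{-2a}. For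
  -- ‖y‖^a ≥ Q the lower bound c‖y‖^{-a} exceeds this by ‖y‖^{-2a}.
  set Q := ((2 * r) ^ (2 * a) * M + 1) / c with hQ'
  have hQ0 : 0 < Q := by positivity
  set R := max (2 * ‖x‖) (Q ^ (a⁻¹)) with hR
  have hR0 : 0 < R := lt_of_lt_of_le (by positivity) (le_max_left _ _)
  have hinf : ∀ l, 0 < l → l ≤ r → ∀ y, y ≠ 0 → l ≤ ‖y - x‖ → R ≤ ‖y‖ →
      kelvin v a x l y + ‖y‖ ^ (-(2 * a)) ≤ v y := by
    intro l hl hlr y hy0 hy hRy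
    have hy0' : 0 < ‖y‖ := norm_pos_iff.2 hy0
    have h1 : ‖y‖ / 2 ≤ ‖y - x‖ := by
      have := norm_sub_norm_le y x
      have := (le_max_left (2 * ‖x‖) (Q ^ a⁻¹)).trans hRy
      linarith
    have h2 : kelvin v a x l y ≤ (2 * r) ^ (2 * a) * ‖y‖ ^ (-(2 * a)) * M := by
      refine (kelvin_le hM hl hlr hy).trans ?_
      rw [Real.rpow_neg hy0'.le, ← Real.inv_rpow hy0'.le, ← Real.mul_rpow (by positivity)
        (by positivity)]
      gcongr
      rw [div_le_iff₀ (hl.trans_le hy)]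
      have : 2 * r * ‖y‖⁻¹ * (‖y‖ / 2) = r := by field_simp
      calc l ≤ r := hlr
        _ = 2 * r * ‖y‖⁻¹ * (‖y‖ / 2) := this.symm
        _ ≤ _ := by gcongr
    have h3 : Q ≤ ‖y‖ ^ a := by
      have := (le_max_right (2 * ‖x‖) (Q ^ a⁻¹)).trans hRy
      calc Q = (Q ^ a⁻¹) ^ a := by rw [← Real.rpow_mul hQ0.le, inv_mul_cancel₀ ha.ne', Real.rpow_one]
        _ ≤ _ := by gcongr
    have h4 : ‖y‖ ^ (-a) = ‖y‖ ^ (-(2 * a)) * ‖y‖ ^ a := by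
      rw [← Real.rpow_add hy0']; congr 1; ring
    have h5 : (2 * r) ^ (2 * a) * M + 1 ≤ c * ‖y‖ ^ a := by
      rw [hQ', div_le_iff₀ hc] at h3; linarith
    have h6 := h.lower y hy0
    have h7 : 0 < ‖y‖ ^ (-(2 * a)) := Real.rpow_pos_of_pos hy0' _
    rw [h4] at h6
    nlinarith
  -- This inner radius is the solution of c ε^{-a} = M + 1, which leaves a gap of at least 1 over
  -- the bound `M` of the transform.
  refine ⟨((M + 1) / c) ^ (-a)⁻¹, R, min 1 (R ^ (-(2 * a))), by positivity, by positivity,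
    fun l hl hlr y hy0 hy => ⟨fun hε => ?_, fun hRy => ?_, fun hRy => ?_⟩⟩
  · have hy0' : 0 < ‖y‖ := norm_pos_iff.2 hy0
    have h1 : (M + 1) / c ≤ ‖y‖ ^ (-a) := by
      calc (M + 1) / c = (((M + 1) / c) ^ (-a)⁻¹) ^ (-a) := by
            rw [← Real.rpow_mul hQ.le, inv_mul_cancel₀ (neg_ne_zero.2 ha.ne'), Real.rpow_one]
        _ ≤ _ := Real.rpow_le_rpow_of_nonpos hy0' hε (by linarith)
    have h2 := h.lower y hy0
    rw [div_le_iff₀ hc] at h1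
    have h3 : kelvin v a x l y ≤ M := by
      refine (kelvin_le hM hl hlr hy).trans ?_
      have : (l / ‖y - x‖) ^ (2 * a) ≤ 1 :=
        Real.rpow_le_one (by positivity) ((div_le_one (hl.trans_le hy)).2 hy) (by positivity)
      nlinarith
    have := min_le_left 1 (R ^ (-(2 * a)))
    linarith
  · have h1 := hinf l hl hlr y hy0 hy hRy.ge
    have := min_le_right 1 (R ^ (-(2 * a)))
    rw [hRy] at h1
    linarith
  · have h1 := hinf l hl hlr y hy0 hy hRy
    have : 0 < ‖y‖ ^ (-(2 * a)) := Real.rpow_pos_of_pos (norm_pos_iff.2 hy0) _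
    linarith

theorem continuousAt_kelvin (hl : 0 < l) (hlx : l < ‖x‖) (hy : l ≤ ‖y - x‖) :
    ContinuousAt (fun q : ℝ × F => kelvin v a x q.1 q.2) (l, y) := by
  have h0 : 0 < ‖y - x‖ := hl.trans_le hy
  have hyx : y ≠ x := sub_ne_zero.1 (norm_pos_iff.1 h0)
  refine ContinuousAt.mul ?_ ?_
  · refine ContinuousAt.rpow_const ?_ (Or.inr (by have := h.a_pos; positivity))
    exact continuousAt_fst.div (by fun_prop) h0.ne'
  · exact ContinuousAt.comp (f := fun q : ℝ × F => inversion x q.1 q.2) (g := v)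
      (h.continuousAt (inversion_ne_zero hl hlx hy)) (continuous_inversion_uncurry x hyx)

/-- Since K ≥ 0 and `v` dominates its transform, the difference is superharmonic. The function δ(1 -
l^{2a}‖y-x‖^{-2a}) is harmonic, vanishes on the sphere ‖y-x‖ = l and is below δ on the other
boundary spheres, so the minimum principle applies. This explicit bound plays the role of both the
strong maximum principle and the Hopf lemma. -/
theorem barrier {ε R δ : ℝ} (hε : 0 < ε) (hδ : 0 < δ) (hl : 0 < l) (hlx : l < ‖x‖)
    (hB : Below v a x l)
    (hends : ∀ y, y ≠ 0 → l ≤ ‖y - x‖ → (‖y‖ = ε ∨ ‖y‖ = R) → kelvin v a x l y + δ ≤ v y)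
    (hεy : ε ≤ ‖y‖) (hyR : ‖y‖ ≤ R) (hy : l ≤ ‖y - x‖) :
    kelvin v a x l y + δ * (1 - l ^ (2 * a) * ‖y - x‖ ^ (-(2 * a))) ≤ v y := by
  have ha := h.a_pos
  have hnt : Nontrivial F := Module.nontrivial_of_finrank_pos (R := ℝ)
    (by have := h.three_le; omega)
  set S : Set F := {y | ε ≤ ‖y‖ ∧ ‖y‖ ≤ R ∧ l ≤ ‖y - x‖} with hS
  have hne0 : ∀ y : F, ε ≤ ‖y‖ → y ≠ 0 := by
    rintro y hy rfl
    rw [norm_zero] at hy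
    linarith
  have hnex : ∀ y, l ≤ ‖y - x‖ → y ≠ x := by
    rintro y hy rfl
    rw [sub_self, norm_zero] at hy
    linarith
  have hScompact : IsCompact S := by
    refine (isCompact_closedBall (0 : F) R).of_isClosed_subset ?_ ?_
    · exact (isClosed_le continuous_const continuous_norm).inter
        ((isClosed_le continuous_norm continuous_const).inter
          (isClosed_le continuous_const (continuous_id.sub continuous_const).norm))
    · intro y hy
      simpa using hy.2.1
  have hsm : ∀ y ∈ S, IsSmoothNear (kelvin v a x l) y := fun y hy =>
    isSmoothNear_kelvin hl (hnex y hy.2.2) (h.isSmoothNear (inversion_ne_zero hl hlx hy.2.2))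
  set D := δ * l ^ (2 * a) with hD
  have hbs : ∀ y ∈ S, IsSmoothNear (fun y => D * ‖y - x‖ ^ (-(2 * a))) y := fun y hy =>
    (isSmoothNear_norm_rpow (hnex y hy.2.2) _).const_mul _
  have hcs : ∀ y, IsSmoothNear (fun _ : F => δ) y := fun y =>
    isSmoothNear_of_contDiff contDiff_const
  have key := nonneg_of_lap_nonpos hScompact
    (w := fun y => v y - kelvin v a x l y - (δ - D * ‖y - x‖ ^ (-(2 * a)))) ?_ ?_
    (y := y) ⟨hεy, hyR, hy⟩
  · simp only [hD] at key
    linarith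
  · intro y hy
    have := (((h.isSmoothNear (hne0 y hy.1)).sub (hsm y hy)).sub
      ((hcs y).sub (hbs y hy))).self_of_nhds.continuousAt
    exact this.continuousWithinAt
  · intro y hy
    have hb0 : 0 < l ^ (2 * a) * ‖y - x‖ ^ (-(2 * a)) :=
      mul_pos (Real.rpow_pos_of_pos hl _) (Real.rpow_pos_of_pos (hl.trans_le hy.2.2) _)
    by_cases hedge : ‖y‖ = ε ∨ ‖y‖ = R
    · left
      have := hends y (hne0 y hy.1) hy.2.2 hedge
      simp only [hD]
      nlinarith
    by_cases hsph : ‖y - x‖ = l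
    · left
      have h1 : l ^ (2 * a) * ‖y - x‖ ^ (-(2 * a)) = 1 := by
        rw [hsph, ← Real.rpow_add hl]
        simp
      rw [kelvin_of_mem_sphere hl hsph]
      simp only [hD]
      nlinarith
    right
    push Not at hedge
    have hint : S ∈ 𝓝 y := by
      have o1 : ∀ᶠ z : F in 𝓝 y, ε < ‖z‖ :=
        continuous_norm.continuousAt.eventually (lt_mem_nhds (lt_of_le_of_ne hy.1 hedge.1.symm))
      have o2 : ∀ᶠ z : F in 𝓝 y, ‖z‖ < R :=
        continuous_norm.continuousAt.eventually (gt_mem_nhds (lt_of_le_of_ne hy.2.1 hedge.2))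
      have o3 : ∀ᶠ z : F in 𝓝 y, l < ‖z - x‖ :=
        (show Continuous fun z : F => ‖z - x‖ by fun_prop).continuousAt.eventually
          (lt_mem_nhds (lt_of_le_of_ne hy.2.2 (Ne.symm hsph)))
      filter_upwards [o1, o2, o3] with z h1 h2 h3 using ⟨h1.le, h2.le, h3.le⟩
    have hv := h.isSmoothNear (hne0 y hy.1)
    refine ⟨hint, (hv.sub (hsm y hy)).sub ((hcs y).sub (hbs y hy)), ?_⟩
    have hconst : lap (fun _ : F => δ) y = 0 := by
      have : gradient (fun _ : F => δ) = fun _ => 0 := by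
        funext z
        exact gradient_eq_of_hasFDerivAt (hasFDerivAt_const δ z) (by simp)
      simp [lap, this]
    rw [lap_sub (hv.sub (hsm y hy)) ((hcs y).sub (hbs y hy)), lap_sub hv (hsm y hy),
      lap_sub (hcs y) (hbs y hy), lap_const_mul (isSmoothNear_norm_rpow (hnex y hy.2.2) _),
      lap_norm_rpow (hnex y hy.2.2), h.lap_eq y (hne0 y hy.1), h.lap_kelvin_eq hl hlx hy.2.2, hconst,
      h.finrank_eq]
    -- The nonlinearity is increasing, so the Laplacians of `v` and of its transform are ordered;
    -- the barrier contributes nothing because -2a = 2 - m is the harmonic exponent.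
    have hp : 0 ≤ (a + 2) / a := by positivity
    have h1 := Real.rpow_le_rpow (h.kelvin_pos hl hlx hy.2.2).le (hB y (hne0 y hy.1) hy.2.2) hp
    have h2 := mul_le_mul_of_nonneg_left h1 h.nonneg
    have h3 : -(2 * a) * (-(2 * a) + (2 * a + 2) - 2) = 0 := by ring
    rw [h3]
    simp only [zero_mul, zero_div, mul_zero]
    linarith

end IsSingularSolution

end Coord

end

/-! ### The method of moving spheres and radial symmetry. -/

noncomputable section

open Filter Topology EuclideanGeometry

local notation "⟪" x ", " y "⟫" => inner ℝ x y

namespace Coord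

variable {F : Type*} [NormedAddCommGroup F] [InnerProductSpace ℝ F]
variable {v : F → ℝ} {a K c l : ℝ} {x y : F}

theorem inversion_add_smul (hl : 0 < l) (hy : ‖y - x‖ = l) {t : ℝ} (ht : 0 < t) :
    inversion x l (x + t • (y - x)) = x + t⁻¹ • (y - x) := by
  have h1 : dist (x + t • (y - x)) x = t * l := by
    rw [dist_eq_norm, add_sub_cancel_left, norm_smul, Real.norm_of_nonneg ht.le, hy]
  rw [inversion, h1, vsub_eq_sub, vadd_eq_add, add_sub_cancel_left, smul_smul, add_comm]
  congr 2
  field_simp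

theorem inversion_eq_add_smul (x y : F) (l : ℝ) :
    inversion x l y = x + (l ^ 2 / ‖y - x‖ ^ 2) • (y - x) := by
  rw [inversion, dist_eq_norm, vsub_eq_sub, vadd_eq_add, add_comm, div_pow]

theorem nonneg_of_hasDerivAt_of_right {j : ℝ → ℝ} {J t : ℝ} (hj : HasDerivAt j J t) (h0 : j t = 0)
    (h : ∀ᶠ s in 𝓝[>] t, 0 ≤ j s) : 0 ≤ J := by
  have h1 := hj.tendsto_slope.mono_left (nhdsGT_le_nhdsNE t)
  refine ge_of_tendsto h1 ?_
  filter_upwards [h, self_mem_nhdsWithin] with s hs hts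
  rw [slope_def_field, h0, sub_zero]
  exact div_nonneg hs (sub_nonneg.2 (le_of_lt hts))

/-- The radial derivative (weighted by `a`) with respect to the centre `x`. -/
def radial (v : F → ℝ) (a : ℝ) (x y : F) : ℝ := a * v y + fderiv ℝ v y (y - x)

theorem hasDerivAt_line (hv : DifferentiableAt ℝ v y) {f : ℝ → ℝ} {f' t : ℝ} {x w : F}
    (hf : HasDerivAt f f' t) (hft : x + f t • w = y) :
    HasDerivAt (fun s => v (x + f s • w)) (f' * fderiv ℝ v y w) t := by
  have h1 : HasDerivAt (fun s => x + f s • w) (f' • w) t := (hf.smul_const w).const_add x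
  have h2 : HasFDerivAt v (fderiv ℝ v y) (x + f t • w) := hft ▸ hv.hasFDerivAt
  have h3 := h2.comp_hasDerivAt t h1
  rw [map_smul, smul_eq_mul] at h3
  exact h3

/-- Hopf-type step: on the sphere the barrier inequality is an equality, so its derivative along the
outward ray has a sign. The inversion reverses the ray, which doubles the radial derivative. -/
theorem radial_pos_of_barrier {δ : ℝ} (ha : 0 < a) (hδ : 0 < δ) (hl : 0 < l) (hy : ‖y - x‖ = l)
    (hv : DifferentiableAt ℝ v y)
    (hb : ∀ᶠ z in 𝓝 y, l ≤ ‖z - x‖ →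
      kelvin v a x l z + δ * (1 - l ^ (2 * a) * ‖z - x‖ ^ (-(2 * a))) ≤ v z) :
    0 < radial v a x y := by
  set j : ℝ → ℝ := fun t => v (x + t • (y - x)) - (t ^ (-(2 * a)) * v (x + t⁻¹ • (y - x)) +
    δ * (1 - t ^ (-(2 * a)))) with hj
  have hp : HasDerivAt (fun t : ℝ => t ^ (-(2 * a))) (-(2 * a)) 1 := by
    simpa using Real.hasDerivAt_rpow_const (x := 1) (p := -(2 * a)) (Or.inl one_ne_zero)
  have hi : HasDerivAt (fun t : ℝ => t⁻¹) (-1) 1 := by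
    simpa using hasDerivAt_inv (one_ne_zero (α := ℝ))
  have h1 := hasDerivAt_line (x := x) (w := y - x) hv (hasDerivAt_id (1 : ℝ)) (by simp)
  have h2 := hasDerivAt_line (x := x) (w := y - x) hv hi (by simp)
  have h3 : HasDerivAt j _ 1 := h1.sub ((hp.mul h2).add ((hp.const_sub 1).const_mul δ))
  -- The derivative of `j` at 1 is 2 `radial` - 2aδ, whence `radial` ≥ aδ > 0.
  have h4 := nonneg_of_hasDerivAt_of_right h3 (by simp [hj]) ?_
  · simp only [inv_one, one_smul, add_sub_cancel, Real.one_rpow] at h4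
    have := mul_pos ha hδ
    rw [radial]
    linarith
  · have hlim : Tendsto (fun t : ℝ => x + t • (y - x)) (𝓝[>] 1) (𝓝 y) := by
      have : Continuous fun t : ℝ => x + t • (y - x) := by fun_prop
      have h := this.tendsto 1
      simp only [one_smul, add_sub_cancel] at h
      exact h.mono_left nhdsWithin_le_nhds
    filter_upwards [hlim.eventually hb, self_mem_nhdsWithin] with t ht h1t
    have ht0 : (0 : ℝ) < t := one_pos.trans h1t
    have hn : ‖x + t • (y - x) - x‖ = t * l := by
      rw [add_sub_cancel_left, norm_smul, Real.norm_of_nonneg ht0.le, hy]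
    have h1t' : 1 < t := h1t
    have h5 := ht (by rw [hn]; nlinarith)
    rw [kelvin, hn, inversion_add_smul hl hy ht0] at h5
    have h6 : (l / (t * l)) ^ (2 * a) = t ^ (-(2 * a)) := by
      rw [Real.rpow_neg ht0.le, ← Real.inv_rpow ht0.le]
      congr 1
      field_simp
    have h7 : l ^ (2 * a) * (t * l) ^ (-(2 * a)) = t ^ (-(2 * a)) := by
      rw [Real.mul_rpow ht0.le hl.le, mul_left_comm, ← Real.rpow_add hl]
      simp
    rw [h6, h7] at h5
    simp only [hj]
    linarith

/-- Along the ray from `x`, s ↦ s^a v(x + s(y-x)) has derivative s^{a-1} times `radial`, so it is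
monotone. Its values at s = l²/‖y-x‖² and s = 1 are the Kelvin transform and v(y). Convexity of the
ball keeps the segment between `y` and its inversion inside. -/
theorem kelvin_le_of_radial_pos {c₀ : F} {ρ : ℝ} (hl : 0 < l) (hly : l ≤ ‖y - x‖)
    (hv : ∀ z ∈ ball c₀ ρ, DifferentiableAt ℝ v z)
    (hr : ∀ z ∈ ball c₀ ρ, 0 < radial v a x z) (hy : y ∈ ball c₀ ρ)
    (hi : inversion x l y ∈ ball c₀ ρ) : kelvin v a x l y ≤ v y := by
  have hr0 : 0 < ‖y - x‖ := hl.trans_le hly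
  set s₀ := l ^ 2 / ‖y - x‖ ^ 2 with hs₀
  have hs0 : 0 < s₀ := by positivity
  have hs1 : s₀ ≤ 1 := by
    rw [hs₀, div_le_one (by positivity)]
    gcongr
  have hseg : ∀ s ∈ Icc s₀ 1, x + s • (y - x) ∈ ball c₀ ρ := by
    intro s hs
    have hc := (convex_ball c₀ ρ).segment_subset hi hy
    apply hc
    rw [segment_eq_image']
    rw [inversion_eq_add_smul, ← hs₀]
    rcases hs1.eq_or_lt with h1 | h1
    · refine ⟨0, by simp, ?_⟩
      have : s = s₀ := le_antisymm (hs.2.trans h1.ge) hs.1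
      simp [this]
    · refine ⟨(s - s₀) / (1 - s₀), ⟨div_nonneg (sub_nonneg.2 hs.1) (by linarith),
        (div_le_one (by linarith)).2 (by linarith [hs.2])⟩, ?_⟩
      have h2 : y - (x + s₀ • (y - x)) = (1 - s₀) • (y - x) := by module
      have h3 : (1 - s₀) ≠ 0 := by linarith
      simp only [h2, smul_smul, div_mul_cancel₀ _ h3]
      module
  have hder : ∀ s ∈ Icc s₀ 1, HasDerivAt (fun s : ℝ => s ^ a * v (x + s • (y - x)))
      (s ^ (a - 1) * radial v a x (x + s • (y - x))) s := by
    intro s hs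
    have hs0' : 0 < s := hs0.trans_le hs.1
    have h1 := (Real.hasDerivAt_rpow_const (x := s) (p := a) (Or.inl hs0'.ne')).mul
      (hasDerivAt_line (x := x) (w := y - x) (hv _ (hseg s hs)) (hasDerivAt_id s) rfl)
    refine HasDerivAt.congr_deriv (f := fun s : ℝ => s ^ a * v (x + s • (y - x))) h1 ?_
    rw [radial, add_sub_cancel_left, map_smul, smul_eq_mul]
    have : s ^ a = s ^ (a - 1) * s := by
      rw [← Real.rpow_add_one hs0'.ne', sub_add_cancel]
    rw [this]
    simp only [id]
    ring
  have hmono : MonotoneOn (fun s : ℝ => s ^ a * v (x + s • (y - x))) (Icc s₀ 1) := by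
    apply monotoneOn_of_deriv_nonneg (convex_Icc _ _)
    · exact fun s hs => (hder s hs).continuousAt.continuousWithinAt
    · rw [interior_Icc]
      exact fun s hs => (hder s (Ioo_subset_Icc_self hs)).differentiableAt.differentiableWithinAt
    · rw [interior_Icc]
      intro s hs
      rw [(hder s (Ioo_subset_Icc_self hs)).deriv]
      have hs0' : 0 < s := hs0.trans hs.1
      exact mul_nonneg (Real.rpow_nonneg hs0'.le _) (hr _ (hseg s (Ioo_subset_Icc_self hs))).le
  have h := hmono (left_mem_Icc.2 hs1) (right_mem_Icc.2 hs1) hs1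
  simp only [Real.one_rpow, one_smul, add_sub_cancel, one_mul] at h
  rw [kelvin, inversion_eq_add_smul, ← hs₀]
  have h6 : (l / ‖y - x‖) ^ (2 * a) = s₀ ^ a := by
    rw [hs₀, ← div_pow, Real.rpow_mul (by positivity), Real.rpow_two]
  rw [h6]
  exact h

variable [FiniteDimensional ℝ F]

namespace IsSingularSolution

variable (h : IsSingularSolution v a K c)

include h

theorem differentiableAt (hy : y ≠ 0) : DifferentiableAt ℝ v y :=
  (h.isSmoothNear hy).self_of_nhds.differentiableAt (by simp)

theorem continuousAt_radial (hy : y ≠ 0) : ContinuousAt (radial v a x) y := by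
  have h1 : ContinuousAt (fderiv ℝ v) y :=
    ((h.isSmoothNear hy).self_of_nhds.fderiv_right (m := ∞) (by simp)).continuousAt
  exact (continuousAt_const.mul (h.continuousAt hy)).add
    (h1.clm_apply (continuousAt_id.sub continuousAt_const))

theorem exists_ball_radial_pos (hy : y ≠ 0) (hr : 0 < radial v a x y) :
    ∃ ρ > 0, (∀ z ∈ ball y ρ, z ≠ 0) ∧ ∀ z ∈ ball y ρ, 0 < radial v a x z := by
  have h1 := (isOpen_ne.mem_nhds hy : {z : F | z ≠ 0} ∈ 𝓝 y)
  obtain ⟨ρ, hρ, h2⟩ := Metric.mem_nhds_iff.1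
    (inter_mem h1 ((h.continuousAt_radial hy).eventually (lt_mem_nhds hr)))
  exact ⟨ρ, hρ, fun z hz => (h2 hz).1, fun z hz => (h2 hz).2⟩

/-- Near `x` the radial derivative is positive, since it equals a v(x) at `x` itself. Away from `x`
the transform tends to 0 uniformly with `l`, while `v` is bounded below on the annulus left over by
`exists_ends`. -/
theorem exists_below_start {r : ℝ} (hr0 : 0 < r) (hr : r < ‖x‖) :
    ∃ l, 0 < l ∧ l ≤ r ∧ Below v a x l := by
  have ha := h.a_pos
  have hx : x ≠ 0 := by
    rintro rfl
    rw [norm_zero] at hr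
    linarith
  obtain ⟨ρ, hρ, hb0, hbr⟩ := h.exists_ball_radial_pos (x := x) hx (by
    rw [radial, sub_self, map_zero, add_zero]
    exact mul_pos ha (h.pos x hx))
  obtain ⟨ε, R, δ, hε, hδ, hends⟩ := h.exists_ends hr
  obtain ⟨M, hM0, hM⟩ := h.exists_bound hr
  obtain ⟨μ, hμ, hμv⟩ : ∃ μ > 0, ∀ y : F, ε ≤ ‖y‖ → ‖y‖ ≤ R → μ ≤ v y := by
    refine ⟨c * (max R 1) ^ (-a), mul_pos h.c_pos (by positivity), fun y h1 h2 => ?_⟩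
    have hy0 : 0 < ‖y‖ := hε.trans_le h1
    refine le_trans ?_ (h.lower y (norm_pos_iff.1 hy0))
    have := h.c_pos
    gcongr ?_ * ?_
    exact Real.rpow_le_rpow_of_nonpos hy0 (h2.trans (le_max_left _ _)) (by linarith)
  have hlim : Tendsto (fun l : ℝ => (l / ρ) ^ (2 * a) * M) (𝓝[>] 0) (𝓝 0) := by
    have hc : ContinuousAt (fun l : ℝ => (l / ρ) ^ (2 * a) * M) 0 :=
      (ContinuousAt.rpow_const (by fun_prop) (Or.inr (by positivity))).mul continuousAt_const
    have := hc.tendsto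
    rw [zero_div, Real.zero_rpow (by positivity), zero_mul] at this
    exact this.mono_left nhdsWithin_le_nhds
  obtain ⟨l, hl1, hl2, hl0⟩ := ((hlim.eventually (gt_mem_nhds hμ)).and
    ((show ∀ᶠ l in 𝓝[>] (0 : ℝ), l ≤ r from mem_nhdsWithin_of_mem_nhds (Iic_mem_nhds hr0)).and
      (show ∀ᶠ l in 𝓝[>] (0 : ℝ), 0 < l from self_mem_nhdsWithin))).exists
  refine ⟨l, hl0, hl2, fun y hy0 hy => ?_⟩
  by_cases hyρ : ‖y - x‖ < ρ
  · refine kelvin_le_of_radial_pos hl0 hy (fun z hz => h.differentiableAt (hb0 z hz)) hbr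
      (by rwa [mem_ball, dist_eq_norm]) ?_
    rw [mem_ball, dist_eq_norm]
    exact (norm_inversion_sub_le hl0 hy).trans_lt (hy.trans_lt hyρ)
  push Not at hyρ
  obtain ⟨e1, -, e3⟩ := hends l hl0 hl2 y hy0 hy
  by_cases hyε : ‖y‖ ≤ ε
  · linarith [e1 hyε]
  by_cases hyR : R ≤ ‖y‖
  · exact (e3 hyR).le
  push Not at hyε hyR
  refine (kelvin_le hM hl0 hl2 hy).trans (le_trans ?_ (hμv y hyε.le hyR.le))
  refine le_trans ?_ hl1.le
  gcongr

theorem exists_below_gt {r : ℝ} (hl : 0 < l) (hlr : l < r) (hr : r < ‖x‖) (hB : Below v a x l) :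
    ∃ l', l < l' ∧ l' ≤ r ∧ Below v a x l' := by
  have ha := h.a_pos
  obtain ⟨ε, R, δ, hε, hδ, hends⟩ := h.exists_ends hr
  by_contra! hcon
  have hseq : ∀ k : ℕ, l < l + (r - l) / (k + 1) ∧ l + (r - l) / (k + 1) ≤ r := by
    intro k
    have hk : (0 : ℝ) < k + 1 := by positivity
    refine ⟨by linarith [div_pos (sub_pos.2 hlr) hk], ?_⟩
    have : (r - l) / (k + 1) ≤ r - l := div_le_self (by linarith) (by linarith [hk, k.cast_nonneg (α := ℝ)])
    linarith
  set s : ℕ → ℝ := fun k => l + (r - l) / (k + 1) with hs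
  have hslim : Tendsto s atTop (𝓝 l) := by
    have := (tendsto_one_div_add_atTop_nhds_zero_nat (𝕜 := ℝ)).const_mul (r - l)
    have := this.const_add l
    simp only [mul_zero, add_zero, mul_one_div] at this
    exact this
  have hex : ∀ k, ∃ y, y ≠ 0 ∧ s k ≤ ‖y - x‖ ∧ v y < kelvin v a x (s k) y := by
    intro k
    have := hcon (s k) (hseq k).1 (hseq k).2
    rw [Below] at this
    push Not at this
    exact this
  choose y hy0 hyk hyv using hex
  have hyS : ∀ k, y k ∈ closedBall (0 : F) R ∩ {z | ε ≤ ‖z‖} := by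
    intro k
    obtain ⟨e1, -, e3⟩ := hends (s k) (hl.trans (hseq k).1) (hseq k).2 (y k) (hy0 k) (hyk k)
    have := hyv k
    refine ⟨?_, ?_⟩
    · rw [mem_closedBall_zero_iff]
      by_contra! hR
      linarith [e3 hR.le]
    · by_contra hR
      have hR : ‖y k‖ < ε := not_le.1 hR
      linarith [e1 hR.le]
  have hcomp : IsCompact (closedBall (0 : F) R ∩ {z | ε ≤ ‖z‖}) :=
    (isCompact_closedBall _ _).inter_right (isClosed_le continuous_const continuous_norm)
  obtain ⟨z, hz, φ, hφ, hlim⟩ := hcomp.tendsto_subseq hyS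
  have hz0 : z ≠ 0 := norm_pos_iff.1 (hε.trans_le hz.2)
  have hsφ : Tendsto (s ∘ φ) atTop (𝓝 l) := hslim.comp hφ.tendsto_atTop
  have hzl : l ≤ ‖z - x‖ := by
    refine le_of_tendsto_of_tendsto hsφ (hlim.sub_const x).norm (Eventually.of_forall fun k => ?_)
    exact hyk (φ k)
  have hlx : l < ‖x‖ := hlr.trans hr
  have hpair : Tendsto (fun k => (s (φ k), y (φ k))) atTop (𝓝 (l, z)) := hsφ.prodMk_nhds hlim
  have hvz : v z ≤ kelvin v a x l z :=
    le_of_tendsto_of_tendsto ((h.continuousAt hz0).tendsto.comp hlim)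
      ((h.continuousAt_kelvin hl hlx hzl).tendsto.comp hpair)
      (Eventually.of_forall fun k => (hyv (φ k)).le)
  have hbar : ∀ w : F, ε ≤ ‖w‖ → ‖w‖ ≤ R → l ≤ ‖w - x‖ →
      kelvin v a x l w + δ * (1 - l ^ (2 * a) * ‖w - x‖ ^ (-(2 * a))) ≤ v w := by
    intro w h1 h2 h3
    refine h.barrier hε hδ hl hlx hB (fun w hw hwl hor => ?_) h1 h2 h3
    obtain ⟨e1, e2, -⟩ := hends l hl hlr.le w hw hwl
    rcases hor with h4 | h4
    · exact e1 h4.le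
    · exact e2 h4
  -- Strictly outside the sphere the barrier term is positive, contradicting the limit inequality
  -- `hvz`.
  have hzsph : ‖z - x‖ = l := by
    by_contra hne
    have hlt : l < ‖z - x‖ := lt_of_le_of_ne hzl (Ne.symm hne)
    have h1 := hbar z hz.2 (mem_closedBall_zero_iff.1 hz.1) hzl
    have h3 : 0 < ‖z - x‖ := hl.trans hlt
    have h2 : l ^ (2 * a) * ‖z - x‖ ^ (-(2 * a)) < 1 := by
      rw [Real.rpow_neg (norm_nonneg _), ← div_eq_mul_inv, div_lt_one (by positivity)]
      gcongr
    nlinarith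
  obtain ⟨e1, e2, e3⟩ := hends l hl hlr.le z hz0 hzl
  have heq := kelvin_of_mem_sphere (v := v) (a := a) hl hzsph
  have hzε : ε < ‖z‖ := by
    by_contra! hh
    linarith [e1 hh]
  have hzR : ‖z‖ < R := by
    by_contra! hh
    linarith [e3 hh]
  have hrad : 0 < radial v a x z := by
    refine radial_pos_of_barrier ha hδ hl hzsph (h.differentiableAt hz0) ?_
    filter_upwards [continuous_norm.continuousAt.eventually (lt_mem_nhds hzε),
      continuous_norm.continuousAt.eventually (gt_mem_nhds hzR)] with w h1 h2
    exact hbar w h1.le h2.le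
  obtain ⟨ρ, hρ, hb0, hbr⟩ := h.exists_ball_radial_pos hz0 hrad
  have hzx : z ≠ x := by
    rintro rfl
    rw [sub_self, norm_zero] at hzl
    linarith
  have hinv : Tendsto (fun k => inversion x (s (φ k)) (y (φ k))) atTop (𝓝 z) := by
    have := (continuous_inversion_uncurry x (l := l) hzx).tendsto.comp hpair
    simp only [inversion_of_mem_sphere (show z ∈ sphere x l by
      rw [Metric.mem_sphere, dist_eq_norm, hzsph])] at this
    exact this
  obtain ⟨k, h1, h2⟩ := ((hlim.eventually (ball_mem_nhds z hρ)).and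
    (hinv.eventually (ball_mem_nhds z hρ))).exists
  exact (hyv (φ k)).not_ge (kelvin_le_of_radial_pos (hl.trans (hseq (φ k)).1) (hyk (φ k))
    (fun z hz => h.differentiableAt (hb0 z hz)) hbr h1 h2)

/-- The method of moving spheres: `v` dominates its Kelvin transforms in all spheres which do not
enclose the origin. -/
theorem below {r : ℝ} (hr0 : 0 < r) (hr : r < ‖x‖) : Below v a x r := by
  obtain ⟨l₀, hl0, hlr, hB⟩ := h.exists_below_start hr0 hr
  have hcl : IsClosed ({l | Below v a x l} ∩ Icc l₀ r) := by
    -- The condition at a fixed `y` only concerns l ≤ ‖y-x‖. At l = ‖y-x‖ it is an equality, so the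
    -- vacuous range may be taken closed, and each set in the intersection is closed.
    have : {l | Below v a x l} ∩ Icc l₀ r =
        ⋂ y ∈ ({0}ᶜ : Set F), (Icc l₀ r ∩ Ici ‖y - x‖) ∪
          (Icc l₀ (min r ‖y - x‖) ∩ (fun l => kelvin v a x l y) ⁻¹' (Iic (v y))) := by
      ext l
      simp only [mem_inter_iff, mem_iInter, mem_union, mem_ofPred_eq, mem_Icc, mem_Ici, mem_preimage,
        mem_Iic, le_min_iff, mem_compl_iff, mem_singleton_iff]
      constructor
      · rintro ⟨h1, h2, h3⟩ y hy
        rcases le_total ‖y - x‖ l with h4 | h4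
        · exact Or.inl ⟨⟨h2, h3⟩, h4⟩
        · exact Or.inr ⟨⟨h2, h3, h4⟩, h1 y hy h4⟩
      · intro h1
        -- Any nonzero point serves here: one member of the intersection is enough to recover l ∈
        -- [l₀, r].
        have hx : -x ≠ 0 := by
          rw [neg_ne_zero]
          rintro rfl
          rw [norm_zero] at hr
          linarith
        have h2 : l₀ ≤ l ∧ l ≤ r := by
          rcases h1 _ hx with h3 | h3
          · exact h3.1
          · exact ⟨h3.1.1, h3.1.2.1⟩
        refine ⟨fun y hy hly => ?_, h2⟩
        rcases h1 y hy with h3 | h3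
        · exact (kelvin_of_mem_sphere (hl0.trans_le h2.1) (le_antisymm h3.2 hly)).le
        · exact h3.2
    rw [this]
    refine isClosed_biInter fun y _ => (isClosed_Icc.inter isClosed_Ici).union ?_
    refine ContinuousOn.preimage_isClosed_of_isClosed ?_ isClosed_Icc isClosed_Iic
    intro l hl
    have h1 := h.continuousAt_kelvin (x := x) (hl0.trans_le hl.1)
      ((hl.2.trans (min_le_left _ _)).trans_lt hr) (hl.2.trans (min_le_right _ _))
    exact (ContinuousAt.comp (f := fun l : ℝ => (l, y)) h1
      (by fun_prop)).continuousWithinAt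
  -- A closed subset of [l₀, r] that contains l₀ and can always be continued to the right is the
  -- whole interval.
  refine hcl.Icc_subset_of_forall_exists_gt hB ?_ (right_mem_Icc.2 hlr)
  rintro l ⟨hBl, hl1, hl2⟩ t ht
  obtain ⟨l', h1, h2, h3⟩ := h.exists_below_gt (hl0.trans_le hl1) (r := min r t)
    (lt_min hl2 ht) ((min_le_left _ _).trans_lt hr) hBl
  exact ⟨l', h3, h1, h2.trans (min_le_right _ _)⟩

/-- The spheres with centre e/s and radius √(1-s²)/s do not enclose the origin and converge to the
hyperplane e^⊥ as s → 0⁺. Their inversions converge to the reflection in it and the Kelvin factors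
to 1, so the moving sphere inequality passes to the limit. -/
theorem le_reflection {e : F} (he : ‖e‖ = 1) (hye : ⟪y, e⟫ < 0) :
    v (y - (2 * ⟪y, e⟫) • e) ≤ v y := by
  have ha := h.a_pos
  have hy0 : y ≠ 0 := by
    rintro rfl
    simp at hye
  have hσ0 : y - (2 * ⟪y, e⟫) • e ≠ 0 := by
    intro h0
    have := congrArg (fun z => ⟪z, e⟫) h0
    simp only [inner_sub_left, real_inner_smul_left, inner_zero_left, real_inner_self_eq_norm_sq,
      he] at this
    linarith
  -- The centre escapes to infinity at s = 0. Rescaling by `s` gives expressions continuous there: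
  -- `q s` is l²/‖y-x‖² and `z s` is the inverted point, for x = e/s.
  set N : ℝ → ℝ := fun s => ‖s • y - e‖ ^ 2 with hN
  have hNc : Continuous N := by fun_prop
  have hN0 : N 0 = 1 := by simp [hN, he]
  set q : ℝ → ℝ := fun s => (1 - s ^ 2) / N s with hq
  have hqc : ContinuousAt q 0 :=
    (by fun_prop : Continuous fun s : ℝ => 1 - s ^ 2).continuousAt.div hNc.continuousAt
      (by rw [hN0]; exact one_ne_zero)
  set b : ℝ → ℝ := fun s => (s * ‖y‖ ^ 2 - 2 * ⟪y, e⟫ + s) / N s with hb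
  have hbc : ContinuousAt b 0 :=
    (by fun_prop : Continuous fun s : ℝ => s * ‖y‖ ^ 2 - 2 * ⟪y, e⟫ + s).continuousAt.div
      hNc.continuousAt (by rw [hN0]; exact one_ne_zero)
  have hq0 : q 0 = 1 := by simp [hq, hN0]
  have hb0 : b 0 = -(2 * ⟪y, e⟫) := by simp [hb, hN0]
  set z : ℝ → F := fun s => q s • y + b s • e with hz
  have hz0 : z 0 = y - (2 * ⟪y, e⟫) • e := by
    simp only [hz, hq0, hb0]
    module
  have hzc : ContinuousAt z 0 := (hqc.smul continuousAt_const).add (hbc.smul continuousAt_const)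
  have hlim : Tendsto (fun s => q s ^ a * v (z s)) (𝓝[>] 0) (𝓝 (v (y - (2 * ⟪y, e⟫) • e))) := by
    have h1 : ContinuousAt (fun s => q s ^ a * v (z s)) 0 :=
      (hqc.rpow_const (Or.inr ha.le)).mul
        (ContinuousAt.comp (f := z) (g := v) (h.continuousAt (by rw [hz0]; exact hσ0)) hzc)
    have h2 := h1.tendsto
    rw [hq0, hz0, Real.one_rpow, one_mul] at h2
    exact h2.mono_left nhdsWithin_le_nhds
  refine le_of_tendsto hlim ?_
  filter_upwards [Ioo_mem_nhdsGT (one_pos (α := ℝ))] with s hs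
  have hs0 : 0 < s := hs.1
  have hs2 : 0 < 1 - s ^ 2 := by nlinarith [hs.1, hs.2]
  set l := √(1 - s ^ 2) / s with hl
  have hl0 : 0 < l := div_pos (Real.sqrt_pos.2 hs2) hs0
  have hl2 : l ^ 2 = (1 - s ^ 2) / s ^ 2 := by rw [hl, div_pow, Real.sq_sqrt hs2.le]
  have hnx : ‖s⁻¹ • e‖ = s⁻¹ := by rw [norm_smul, he, mul_one, Real.norm_of_nonneg (by positivity)]
  have hlx : l < ‖s⁻¹ • e‖ := by
    rw [hnx, hl, div_eq_mul_inv]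
    have : √(1 - s ^ 2) < 1 := by
      rw [Real.sqrt_lt' one_pos]
      nlinarith
    nlinarith [inv_pos.2 hs0]
  have hdiff : y - s⁻¹ • e = s⁻¹ • (s • y - e) := by
    rw [smul_sub, smul_smul, inv_mul_cancel₀ hs0.ne', one_smul]
  have hNs : ‖y - s⁻¹ • e‖ ^ 2 = N s / s ^ 2 := by
    rw [hdiff, norm_smul, mul_pow, Real.norm_of_nonneg (by positivity), inv_pow, hN]
    field_simp
  have hNexp : N s = s ^ 2 * ‖y‖ ^ 2 - 2 * s * ⟪y, e⟫ + 1 := by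
    rw [hN]
    simp only
    rw [norm_sub_sq_real, norm_smul, real_inner_smul_left, he, Real.norm_of_nonneg hs0.le]
    ring
  -- The sign of ⟪y, e⟫ enters here: it puts `y` outside all these spheres.
  have hN1 : 1 < N s := by
    rw [hNexp]
    nlinarith [mul_pos hs0 (neg_pos.2 hye), mul_nonneg (sq_nonneg s) (sq_nonneg ‖y‖)]
  have hly : l ≤ ‖y - s⁻¹ • e‖ := by
    refine le_of_sq_le_sq ?_ (norm_nonneg _)
    rw [hl2, hNs]
    gcongr
    nlinarith
  have hqs : l ^ 2 / ‖y - s⁻¹ • e‖ ^ 2 = q s := by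
    rw [hl2, hNs, hq]
    field_simp
  have hB := h.below hl0 hlx y hy0 hly
  rw [kelvin, inversion_eq_add_smul, hqs] at hB
  have h6 : (l / ‖y - s⁻¹ • e‖) ^ (2 * a) = q s ^ a := by
    rw [← hqs, ← div_pow, Real.rpow_mul (by positivity), Real.rpow_two]
  have h7 : s⁻¹ • e + q s • (y - s⁻¹ • e) = z s := by
    have : b s = s⁻¹ * (1 - q s) := by
      have hN' : N s ≠ 0 := by linarith
      simp only [hb, hq]
      field_simp
      rw [hNexp]
      ring
    simp only [hz, this]
    module
  rw [h6, h7] at hB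
  exact hB

/-- Positive singular solutions of the Yamabe equation are radially symmetric. -/
theorem eq_of_norm_eq {z : F} (hy : y ≠ 0) (hyz : ‖y‖ = ‖z‖) : v y = v z := by
  have key : ∀ y z : F, y ≠ 0 → ‖y‖ = ‖z‖ → v z ≤ v y := by
    intro y z hy hyz
    rcases eq_or_ne y z with rfl | hne
    · exact le_rfl
    have hd : 0 < ‖z - y‖ := norm_pos_iff.2 (sub_ne_zero.2 hne.symm)
    -- Because ‖y‖ = ‖z‖, the hyperplane that exchanges `y` and `z` passes through the origin, and
    -- its normal can be oriented so that ⟪y, e⟫ < 0.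
    set e := ‖z - y‖⁻¹ • (z - y) with he
    have he1 : ‖e‖ = 1 := by
      rw [he, norm_smul, norm_inv, norm_norm, inv_mul_cancel₀ hd.ne']
    have h1 : ⟪y, z - y⟫ = -(‖z - y‖ ^ 2 / 2) := by
      have h2 := norm_sub_sq_real z y
      rw [inner_sub_right, real_inner_self_eq_norm_sq, real_inner_comm]
      rw [← hyz] at h2
      linarith
    have h2 : ⟪y, e⟫ = -(‖z - y‖ / 2) := by
      rw [he, real_inner_smul_right, h1]
      field_simp
    have h3 : y - (2 * ⟪y, e⟫) • e = z := by
      rw [h2, he, smul_smul]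
      have : 2 * -(‖z - y‖ / 2) * ‖z - y‖⁻¹ = -1 := by field_simp
      rw [this]
      module
    have := h.le_reflection he1 (y := y) (by rw [h2]; linarith)
    rwa [h3] at this
  have hz : z ≠ 0 := norm_pos_iff.1 (hyz ▸ norm_pos_iff.2 hy)
  exact le_antisymm (key z y hz hyz.symm) (key y z hy hyz)

end IsSingularSolution

end Coord

end

noncomputable section

open Filter Topology Coord

local notation "⟪" x ", " y "⟫" => inner ℝ x y

/-! ### Parametrisations of the circle, the sphere and the cylinder -/

section CircleCharts

variable {T : ℝ} [hT : Fact (0 < T)]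

theorem AddCircle.hasMFDerivAt_coe (t : ℝ) :
    HasMFDerivAt 𝓘(ℝ, ℝ) 𝓘(ℝ, ℝ) (fun s : ℝ => (s : AddCircle T)) t
      (ContinuousLinearMap.id ℝ ℝ) := by
  refine ⟨(AddCircle.continuous_mk' T).continuousAt, ?_⟩
  have hsrc := mem_chart_source ℝ (t : AddCircle T)
  obtain ⟨c, hc⟩ := AddCircle.equivIco_coe_eventuallyEq T _ t hsrc
  have : HasFDerivAt (fun s : ℝ => s + c) (ContinuousLinearMap.id ℝ ℝ) t :=
    (hasFDerivAt_id t).add_const c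
  simp only [mfld_simps]
  exact ((this.congr_of_eventuallyEq hc)).hasFDerivWithinAt

theorem AddCircle.contMDiff_coe :
    ContMDiff 𝓘(ℝ, ℝ) 𝓘(ℝ, ℝ) ∞ (fun s : ℝ => (s : AddCircle T)) := by
  intro t
  rw [contMDiffAt_iff]
  refine ⟨(AddCircle.continuous_mk' T).continuousAt, ?_⟩
  have hsrc := mem_chart_source ℝ (t : AddCircle T)
  obtain ⟨c, hc⟩ := AddCircle.equivIco_coe_eventuallyEq T _ t hsrc
  have : ContDiffAt ℝ ∞ (fun s : ℝ => s + c) t := contDiffAt_id.add contDiffAt_const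
  simp only [mfld_simps]
  exact ((this.congr_of_eventuallyEq hc)).contDiffWithinAt

theorem AddCircle.extChartAt_symm_apply (x : AddCircle T) (t : ℝ) :
    (extChartAt 𝓘(ℝ, ℝ) x).symm t = (t : AddCircle T) := rfl

theorem AddCircle.coe_extChartAt (x : AddCircle T) :
    ((extChartAt 𝓘(ℝ, ℝ) x x : ℝ) : AddCircle T) = x := by
  rw [← AddCircle.extChartAt_symm_apply x]
  exact extChartAt_to_inv x

end CircleCharts

section SphereCharts

variable {k : ℕ}

/-- The inverse of the preferred chart of the unit sphere at `ξ`, with values in the ambient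
space. -/
def sphereParam (ξ : UnitSphere k) (w : EuclideanSpace ℝ (Fin k)) :
    EuclideanSpace ℝ (Fin (k + 1)) := ((extChartAt (𝓡 k) ξ).symm w : UnitSphere k)

/-- The preferred chart at ξ is stereographic projection from the pole e = -ξ. Separating the
constant vector leaves a single denominator, convenient for differentiation. -/
theorem exists_sphereParam_eq (ξ : UnitSphere k) :
    ∃ (U : EuclideanSpace ℝ (Fin k) →ₗᵢ[ℝ] EuclideanSpace ℝ (Fin (k + 1)))
      (e : EuclideanSpace ℝ (Fin (k + 1))), ‖e‖ = 1 ∧ (∀ w, ⟪U w, e⟫ = 0) ∧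
      sphereParam ξ = fun w => e + (‖w‖ ^ 2 + 4)⁻¹ • ((4 : ℝ) • U w - (8 : ℝ) • e) := by
  have := Fact.mk (@finrank_euclideanSpace_fin ℝ _ (k + 1))
  set W : (ℝ ∙ ((-ξ : UnitSphere k) : EuclideanSpace ℝ (Fin (k + 1))))ᗮ ≃ₗᵢ[ℝ]
      EuclideanSpace ℝ (Fin k) :=
    (OrthonormalBasis.fromOrthogonalSpanSingleton k (ne_zero_of_mem_unit_sphere (-ξ))).repr with hW
  have he : ‖((-ξ : UnitSphere k) : EuclideanSpace ℝ (Fin (k + 1)))‖ = 1 :=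
    norm_eq_of_mem_sphere (-ξ)
  refine ⟨(Submodule.subtypeₗᵢ _).comp W.symm.toLinearIsometry, (-ξ : UnitSphere k), he, ?_, ?_⟩
  · intro w
    exact Submodule.mem_orthogonal_singleton_iff_inner_left.1 (W.symm w).2
  · funext w
    have h1 := stereographic'_symm_apply (n := k) (-ξ) w
    have h2 : ‖((W.symm w : (ℝ ∙ ((-ξ : UnitSphere k) : EuclideanSpace ℝ (Fin (k + 1))))ᗮ) :
        EuclideanSpace ℝ (Fin (k + 1)))‖ = ‖w‖ := W.symm.norm_map w
    have h3 : sphereParam ξ w = ((stereographic' k (-ξ)).symm w : EuclideanSpace ℝ (Fin (k + 1))) :=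
      rfl
    rw [h3, h1]
    simp only [← hW, h2]
    have h4 : (‖w‖ ^ 2 + 4)⁻¹ * (‖w‖ ^ 2 - 4) = 1 - (‖w‖ ^ 2 + 4)⁻¹ * 8 := by
      have : ‖w‖ ^ 2 + 4 ≠ 0 := by positivity
      field_simp
      ring
    change _ = ((-ξ : UnitSphere k) : EuclideanSpace ℝ (Fin (k + 1))) + (‖w‖ ^ 2 + 4)⁻¹ •
      ((4 : ℝ) • ((W.symm w : (ℝ ∙ ((-ξ : UnitSphere k) : EuclideanSpace ℝ (Fin (k + 1))))ᗮ) :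
        EuclideanSpace ℝ (Fin (k + 1))) -
        (8 : ℝ) • ((-ξ : UnitSphere k) : EuclideanSpace ℝ (Fin (k + 1))))
    rw [smul_smul _ (‖w‖ ^ 2 - 4), h4]
    module

theorem norm_sphereParam (ξ : UnitSphere k) (w : EuclideanSpace ℝ (Fin k)) :
    ‖sphereParam ξ w‖ = 1 := norm_eq_of_mem_sphere _

theorem contDiff_sphereParam (ξ : UnitSphere k) : ContDiff ℝ ∞ (sphereParam ξ) := by
  obtain ⟨U, e, -, -, h⟩ := exists_sphereParam_eq ξ
  rw [h]
  have h0 : ∀ w : EuclideanSpace ℝ (Fin k), ‖w‖ ^ 2 + 4 ≠ 0 := fun w => by positivity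
  have h1 : ContDiff ℝ ∞ fun w : EuclideanSpace ℝ (Fin k) => ‖w‖ ^ 2 + 4 :=
    (contDiff_norm_sq ℝ).add contDiff_const
  exact contDiff_const.add ((h1.inv h0).smul ((U.contDiff.const_smul (4 : ℝ)).sub contDiff_const))

theorem inner_fderiv_sphereParam (ξ : UnitSphere k) (w a b : EuclideanSpace ℝ (Fin k)) :
    ⟪fderiv ℝ (sphereParam ξ) w a, fderiv ℝ (sphereParam ξ) w b⟫ =
      16 / (‖w‖ ^ 2 + 4) ^ 2 * ⟪a, b⟫ := by
  obtain ⟨U, e, he, hU, h⟩ := exists_sphereParam_eq ξ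
  have h0 : ‖w‖ ^ 2 + 4 ≠ 0 := by positivity
  have hd : ∀ a, fderiv ℝ (sphereParam ξ) w a = (‖w‖ ^ 2 + 4)⁻¹ • ((4 : ℝ) • U a) -
      (2 * ⟪w, a⟫ / (‖w‖ ^ 2 + 4) ^ 2) • ((4 : ℝ) • U w - (8 : ℝ) • e) := by
    intro a
    have h1 : HasFDerivAt (fun w : EuclideanSpace ℝ (Fin k) => ‖w‖ ^ 2 + 4) _ w :=
      ((hasStrictFDerivAt_norm_sq w).hasFDerivAt).add_const 4
    have h2 : HasFDerivAt (fun w : EuclideanSpace ℝ (Fin k) => (‖w‖ ^ 2 + 4)⁻¹) _ w :=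
      (hasDerivAt_inv h0).comp_hasFDerivAt w h1
    have h3 : HasFDerivAt (fun w : EuclideanSpace ℝ (Fin k) => (4 : ℝ) • U w - (8 : ℝ) • e) _ w :=
      ((U.toContinuousLinearMap.hasFDerivAt (x := w)).const_smul (4 : ℝ)).sub_const ((8 : ℝ) • e)
    have h4 : HasFDerivAt (fun w => e + (‖w‖ ^ 2 + 4)⁻¹ • ((4 : ℝ) • U w - (8 : ℝ) • e)) _ w :=
      (h2.smul h3).const_add e
    rw [h, h4.fderiv]
    simp
    module
  have h1 : ∀ a, ⟪e, U a⟫ = 0 := fun a => by rw [real_inner_comm, hU]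
  rw [hd, hd]
  simp only [inner_sub_left, inner_sub_right, real_inner_smul_left, real_inner_smul_right,
    LinearIsometry.inner_map_map, hU, h1, real_inner_self_eq_norm_sq, he, real_inner_comm w]
  field_simp
  ring

theorem mdifferentiableAt_extChartAt_symm_of_mem {E : Type*} [NormedAddCommGroup E] [NormedSpace ℝ E]
    {H : Type*} [TopologicalSpace H] {I : ModelWithCorners ℝ E H} [I.Boundaryless]
    {M : Type*} [TopologicalSpace M] [ChartedSpace H M] [IsManifold I ∞ M]
    (p : M) {q : E} (hq : q ∈ (extChartAt I p).target) :
    MDifferentiableAt 𝓘(ℝ, E) I (extChartAt I p).symm q :=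
  ((contMDiffOn_extChartAt_symm (n := ∞) p).contMDiffAt
    ((isOpen_extChartAt_target p).mem_nhds hq)).mdifferentiableAt (by simp)

theorem mem_target_sphere (ξ : UnitSphere k) (w : EuclideanSpace ℝ (Fin k)) :
    w ∈ (extChartAt (𝓡 k) ξ).target := by
  have := Fact.mk (@finrank_euclideanSpace_fin ℝ _ (k + 1))
  have h : (extChartAt (𝓡 k) ξ).target = univ := by
    rw [extChartAt_target]
    simp only [modelWithCornersSelf_coe_symm, preimage_id, modelWithCornersSelf_coe, range_id,
      inter_univ]
    exact stereographic'_target (-ξ)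
  rw [h]
  trivial

theorem contMDiff_coe_unitSphere :
    ContMDiff (𝓡 k) 𝓘(ℝ, EuclideanSpace ℝ (Fin (k + 1))) ∞
      (fun ξ : UnitSphere k => (ξ : EuclideanSpace ℝ (Fin (k + 1)))) := by
  have := Fact.mk (@finrank_euclideanSpace_fin ℝ _ (k + 1))
  exact contMDiff_coe_sphere

/-- Stereographic projection is conformal, with factor 16/(‖w‖²+4)². The formulas for conformally
flat metrics thus give the curvature of the sphere. -/
theorem roundMetric_inChart (ξ : UnitSphere k) :
    (roundMetric k).inChart ξ = conf fun w => Real.log 4 - Real.log (‖w‖ ^ 2 + 4) := by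
  have : IsManifold (𝓡 k) ∞ (UnitSphere k) := IsManifold.of_le (n := ω) le_top
  funext w
  ext a b
  have h1 := mdifferentiableAt_extChartAt_symm_of_mem ξ (mem_target_sphere ξ w)
  have h2 : MDifferentiableAt (𝓡 k) 𝓘(ℝ, EuclideanSpace ℝ (Fin (k + 1)))
      (fun ξ : UnitSphere k => (ξ : EuclideanSpace ℝ (Fin (k + 1))))
      ((extChartAt (𝓡 k) ξ).symm w) := contMDiff_coe_unitSphere.mdifferentiable (by simp) _
  have h3 := mfderiv_comp w h2 h1
  have h4 : ∀ a, mfderiv (𝓡 k) 𝓘(ℝ, EuclideanSpace ℝ (Fin (k + 1)))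
      (fun ξ : UnitSphere k => (ξ : EuclideanSpace ℝ (Fin (k + 1))))
      ((extChartAt (𝓡 k) ξ).symm w)
      (mfderiv 𝓘(ℝ, EuclideanSpace ℝ (Fin k)) (𝓡 k) (extChartAt (𝓡 k) ξ).symm w a) =
      fderiv ℝ (sphereParam ξ) w a := by
    intro a
    rw [← mfderiv_eq_fderiv]
    exact (congrArg (fun A => A a) h3).symm
  have h5 : (roundMetric k).inChart ξ w a b =
      ⟪fderiv ℝ (sphereParam ξ) w a, fderiv ℝ (sphereParam ξ) w b⟫ :=
    congrArg₂ (fun p q : EuclideanSpace ℝ (Fin (k + 1)) => inner ℝ p q) (h4 a) (h4 b)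
  rw [h5, inner_fderiv_sphereParam, conf_apply]
  congr 1
  have h0 : (0 : ℝ) < ‖w‖ ^ 2 + 4 := by positivity
  rw [← Real.log_div (by norm_num) h0.ne', two_mul, Real.exp_add,
    Real.exp_log (by positivity)]
  field_simp
  norm_num

/-- The unit sphere is an Einstein manifold of scalar curvature `k (k - 1)`. -/
theorem isEinstein_roundMetric (hk : 1 ≤ k) :
    IsEinstein (roundMetric k) ((k : ℝ) * (k - 1)) := by
  intro p w z
  rw [roundMetric_inChart]
  generalize (extChartAt (𝓡 k) p) p = x
  set f : EuclideanSpace ℝ (Fin k) → ℝ := fun w => Real.log 4 - Real.log (‖w‖ ^ 2 + 4) with hf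
  have h0 : ∀ y : EuclideanSpace ℝ (Fin k), ‖y‖ ^ 2 + 4 ≠ 0 := fun y => by positivity
  have hsm : IsSmoothNear f x := by
    apply isSmoothNear_of_contDiff
    exact contDiff_const.sub (((contDiff_norm_sq ℝ).add contDiff_const).log h0)
  have hd : ∀ y : EuclideanSpace ℝ (Fin k), HasFDerivAt (fun y => ‖y‖ ^ 2 + 4) _ y := fun y =>
    ((hasStrictFDerivAt_norm_sq y).hasFDerivAt).add_const (4 : ℝ)
  have hg : gradient f = fun y => -((2 * (‖y‖ ^ 2 + 4)⁻¹) • y) := by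
    funext y
    apply gradient_eq_of_hasFDerivAt (((hd y).log (h0 y)).const_sub (Real.log 4))
    intro z
    simp [real_inner_smul_left, inner_neg_left]
    ring
  have hH : ∀ z, fderiv ℝ (gradient f) x z = -((2 * (‖x‖ ^ 2 + 4)⁻¹) • z) +
      (4 * ⟪x, z⟫ * (((‖x‖ ^ 2 + 4)⁻¹) ^ 2)) • x := by
    intro z
    have h1 : HasFDerivAt (fun y : EuclideanSpace ℝ (Fin k) => 2 * (‖y‖ ^ 2 + 4)⁻¹) _ x :=
      ((hasDerivAt_inv (h0 x)).comp_hasFDerivAt x (hd x)).const_mul 2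
    have h2 : HasFDerivAt (fun y : EuclideanSpace ℝ (Fin k) => -((2 * (‖y‖ ^ 2 + 4)⁻¹) • y)) _ x :=
      (h1.smul (hasFDerivAt_id x)).neg
    rw [hg, h2.fderiv]
    simp
    module
  -- Constant curvature 1: the Schouten endomorphism is -½ e^{2f} times the identity, with e^{2f} =
  -- 16/(‖x‖²+4)².
  have hS : schouten f x = (-(8 * ((‖x‖ ^ 2 + 4)⁻¹) ^ 2)) • ContinuousLinearMap.id ℝ _ := by
    ext1 z
    rw [schouten_apply, hH, hg]
    simp only [inner_neg_left, inner_neg_right, real_inner_smul_left, real_inner_smul_right,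
      _root_.smul_apply, ContinuousLinearMap.id_apply]
    simp only [real_inner_self_eq_norm_sq]
    have h1 := h0 x
    have h2 : -(8 * ((‖x‖ ^ 2 + 4)⁻¹) ^ 2) = -(2 * (‖x‖ ^ 2 + 4)⁻¹) +
        2⁻¹ * (4 * ‖x‖ ^ 2 * ((‖x‖ ^ 2 + 4)⁻¹) ^ 2) := by
      field_simp
      ring
    rw [h2]
    module
  have hconf : Real.exp (2 * f x) = 16 * ((‖x‖ ^ 2 + 4)⁻¹) ^ 2 := by
    have h0 : (0 : ℝ) < ‖x‖ ^ 2 + 4 := by positivity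
    rw [hf]
    simp only
    rw [← Real.log_div (by norm_num) h0.ne', two_mul, Real.exp_add,
      Real.exp_log (by positivity)]
    field_simp
    norm_num
  have hk' : (1 : ℝ) ≤ k := by exact_mod_cast hk
  rw [ricci_conf hsm, hS, conf_apply, hconf]
  simp only [finrank_euclideanSpace, Fintype.card_fin, ContinuousLinearMap.toLinearMap_smul,
    map_smul, ContinuousLinearMap.coe_id, LinearMap.trace_id, _root_.smul_apply,
    ContinuousLinearMap.id_apply, real_inner_smul_left, smul_eq_mul]
  field_simp
  ring

end SphereCharts

end

/-! ### Logarithmic polar coordinates and charts of the cylinder. -/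

noncomputable section

open Filter Topology Coord

local notation "⟪" x ", " y "⟫" => inner ℝ x y

section Polar

variable {k : ℕ}

theorem inner_sphereParam_fderiv (ξ : UnitSphere k) (w a : EuclideanSpace ℝ (Fin k)) :
    ⟪sphereParam ξ w, fderiv ℝ (sphereParam ξ) w a⟫ = 0 := by
  have h1 : HasFDerivAt (sphereParam ξ) (fderiv ℝ (sphereParam ξ) w) w :=
    ((contDiff_sphereParam ξ).differentiable (by simp) w).hasFDerivAt
  have h2 := h1.norm_sq
  have h3 : (fun w => ‖sphereParam ξ w‖ ^ 2) = fun _ => 1 := by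
    funext w
    rw [norm_sphereParam, one_pow]
  rw [h3] at h2
  have h4 := congrArg (fun A => A a) (h2.unique (hasFDerivAt_const (1 : ℝ) w))
  simpa using h4

/-- Polar coordinates around the origin, with logarithmic radius. -/
def polar (ξ : UnitSphere k) (q : ℝ × EuclideanSpace ℝ (Fin k)) : EuclideanSpace ℝ (Fin (k + 1)) :=
  Real.exp q.1 • sphereParam ξ q.2

theorem norm_polar (ξ : UnitSphere k) (q : ℝ × EuclideanSpace ℝ (Fin k)) :
    ‖polar ξ q‖ = Real.exp q.1 := by
  rw [polar, norm_smul, norm_sphereParam, mul_one, Real.norm_of_nonneg (Real.exp_pos _).le]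

theorem polar_ne_zero (ξ : UnitSphere k) (q : ℝ × EuclideanSpace ℝ (Fin k)) : polar ξ q ≠ 0 :=
  norm_pos_iff.1 (norm_polar ξ q ▸ Real.exp_pos _)

theorem contDiff_polar (ξ : UnitSphere k) : ContDiff ℝ ∞ (polar ξ) :=
  (Real.contDiff_exp.comp contDiff_fst).smul ((contDiff_sphereParam ξ).comp contDiff_snd)

theorem fderiv_polar (ξ : UnitSphere k) (q a : ℝ × EuclideanSpace ℝ (Fin k)) :
    fderiv ℝ (polar ξ) q a =
      Real.exp q.1 • (a.1 • sphereParam ξ q.2 + fderiv ℝ (sphereParam ξ) q.2 a.2) := by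
  have h1 : HasFDerivAt (sphereParam ξ) (fderiv ℝ (sphereParam ξ) q.2) q.2 :=
    ((contDiff_sphereParam ξ).differentiable (by simp) q.2).hasFDerivAt
  have h2 : HasFDerivAt (fun q : ℝ × EuclideanSpace ℝ (Fin k) => Real.exp q.1) _ q :=
    (hasFDerivAt_fst (𝕜 := ℝ) (p := q)).exp
  have h3 : HasFDerivAt (polar ξ) _ q := h2.smul (h1.comp q hasFDerivAt_snd)
  rw [h3.fderiv]
  simp
  module

theorem inner_fderiv_polar (ξ : UnitSphere k) (q a b : ℝ × EuclideanSpace ℝ (Fin k)) :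
    ⟪fderiv ℝ (polar ξ) q a, fderiv ℝ (polar ξ) q b⟫ = Real.exp q.1 ^ 2 *
      (a.1 * b.1 + ⟪fderiv ℝ (sphereParam ξ) q.2 a.2, fderiv ℝ (sphereParam ξ) q.2 b.2⟫) := by
  have h1 : ∀ a, ⟪fderiv ℝ (sphereParam ξ) q.2 a, sphereParam ξ q.2⟫ = 0 := fun a => by
    rw [real_inner_comm, inner_sphereParam_fderiv]
  rw [fderiv_polar, fderiv_polar]
  simp only [inner_add_left, inner_add_right, real_inner_smul_left, real_inner_smul_right,
    inner_sphereParam_fderiv, h1]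
  rw [real_inner_self_eq_norm_sq, norm_sphereParam]
  ring

/-- The pulled-back Euclidean metric is e^{2t} times a positive definite form, so the differential
is injective between spaces of equal dimension. -/
theorem isLocalDiffeoNear_polar (ξ : UnitSphere k) (q : ℝ × EuclideanSpace ℝ (Fin k)) :
    IsLocalDiffeoNear (polar ξ) q := by
  refine Eventually.of_forall fun q => ⟨(contDiff_polar ξ).contDiffAt, ?_⟩
  have hinj : Function.Injective ((fderiv ℝ (polar ξ) q :
      ℝ × EuclideanSpace ℝ (Fin k) →L[ℝ] EuclideanSpace ℝ (Fin (k + 1))) :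
        ℝ × EuclideanSpace ℝ (Fin k) →ₗ[ℝ] EuclideanSpace ℝ (Fin (k + 1))) := by
    rw [← LinearMap.ker_eq_bot, LinearMap.ker_eq_bot']
    intro a ha
    have h1 := inner_fderiv_polar ξ q a a
    rw [show fderiv ℝ (polar ξ) q a = 0 from ha, inner_zero_left, inner_fderiv_sphereParam,
      real_inner_self_eq_norm_sq] at h1
    have h2 : a.1 * a.1 + 16 / (‖q.2‖ ^ 2 + 4) ^ 2 * ‖a.2‖ ^ 2 = 0 := by
      rcases mul_eq_zero.1 h1.symm with h | h
      · exact absurd h (by positivity)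
      · exact h
    have h3 : 0 < 16 / (‖q.2‖ ^ 2 + 4) ^ 2 := by positivity
    have h4 : a.1 = 0 := by nlinarith [mul_self_nonneg a.1, mul_nonneg h3.le (sq_nonneg ‖a.2‖)]
    have h5 : ‖a.2‖ ^ 2 = 0 := by
      rw [h4] at h2
      simpa [h3.ne'] using h2
    exact Prod.ext h4 (by simpa using h5)
  have hdim : Module.finrank ℝ (ℝ × EuclideanSpace ℝ (Fin k)) =
      Module.finrank ℝ (EuclideanSpace ℝ (Fin (k + 1))) := by
    simp [add_comm]
  exact ⟨(LinearEquiv.ofInjectiveOfFinrankEq _ hinj hdim).toContinuousLinearEquiv, rfl⟩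

theorem isLocalDiffeoNear_polar_add (ξ : UnitSphere k) (q b : ℝ × EuclideanSpace ℝ (Fin k)) :
    IsLocalDiffeoNear (fun q => polar ξ (q + b)) q := by
  refine Eventually.of_forall fun q => ⟨?_, ?_⟩
  · exact ((contDiff_polar ξ).comp (contDiff_id.add contDiff_const)).contDiffAt
  · rw [fderiv_comp_add_right]
    exact (isLocalDiffeoNear_polar ξ (q + b)).self_of_nhds.2

end Polar

section CylinderCharts

variable {k : ℕ} {T : ℝ} [hT : Fact (0 < T)]

instance : IsManifold (𝓡 k) ∞ (UnitSphere k) := IsManifold.of_le (n := ω) le_top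

theorem cylinder_extChartAt_symm (p : AddCircle T × UnitSphere k)
    (q : ℝ × EuclideanSpace ℝ (Fin k)) :
    (extChartAt (cylinderModel k) p).symm q =
      ((q.1 : AddCircle T), (extChartAt (𝓡 k) p.2).symm q.2) := by
  rw [extChartAt_prod]
  rfl

theorem mfderiv_fst_chart (p : AddCircle T × UnitSphere k)
    {q : ℝ × EuclideanSpace ℝ (Fin k)} (hq : q ∈ (extChartAt (cylinderModel k) p).target)
    (a : ℝ × EuclideanSpace ℝ (Fin k)) :
    mfderiv (cylinderModel k) 𝓘(ℝ, ℝ) (Prod.fst : AddCircle T × UnitSphere k → AddCircle T)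
      ((extChartAt (cylinderModel k) p).symm q)
      (mfderiv 𝓘(ℝ, ℝ × EuclideanSpace ℝ (Fin k)) (cylinderModel k)
        (extChartAt (cylinderModel k) p).symm q a) = a.1 := by
  have h1 := mdifferentiableAt_extChartAt_symm_of_mem p hq
  have h2 := mfderiv_comp q (mdifferentiableAt_fst (I := 𝓘(ℝ, ℝ)) (I' := 𝓡 k)
    (x := (extChartAt (cylinderModel k) p).symm q)) h1
  have h3 : (Prod.fst : AddCircle T × UnitSphere k → AddCircle T) ∘
      (extChartAt (cylinderModel k) p).symm = (fun s : ℝ => (s : AddCircle T)) ∘ Prod.fst := by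
    funext q
    rw [Function.comp_apply, cylinder_extChartAt_symm]
    rfl
  have h4 : HasMFDerivAt 𝓘(ℝ, ℝ × EuclideanSpace ℝ (Fin k)) 𝓘(ℝ, ℝ)
      ((fun s : ℝ => (s : AddCircle T)) ∘ Prod.fst) q
      ((ContinuousLinearMap.id ℝ ℝ).comp (ContinuousLinearMap.fst ℝ ℝ _)) :=
    (AddCircle.hasMFDerivAt_coe q.1).comp q hasFDerivAt_fst.hasMFDerivAt
  rw [h3, h4.mfderiv] at h2
  exact (congrArg (fun A => A a) h2).symm

theorem mfderiv_snd_chart (p : AddCircle T × UnitSphere k)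
    {q : ℝ × EuclideanSpace ℝ (Fin k)} (hq : q ∈ (extChartAt (cylinderModel k) p).target)
    (a : ℝ × EuclideanSpace ℝ (Fin k)) :
    mfderiv (𝓡 k) 𝓘(ℝ, EuclideanSpace ℝ (Fin (k + 1)))
      (fun ξ : UnitSphere k => (ξ : EuclideanSpace ℝ (Fin (k + 1))))
      ((extChartAt (cylinderModel k) p).symm q).2
      (mfderiv (cylinderModel k) (𝓡 k) (Prod.snd : AddCircle T × UnitSphere k → UnitSphere k)
        ((extChartAt (cylinderModel k) p).symm q)
        (mfderiv 𝓘(ℝ, ℝ × EuclideanSpace ℝ (Fin k)) (cylinderModel k)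
          (extChartAt (cylinderModel k) p).symm q a)) =
      fderiv ℝ (sphereParam p.2) q.2 a.2 := by
  have h1 := mdifferentiableAt_extChartAt_symm_of_mem p hq
  have hs := mdifferentiableAt_snd (I := 𝓘(ℝ, ℝ)) (I' := 𝓡 k)
    (x := (extChartAt (cylinderModel k) p).symm q)
  have hc : MDifferentiableAt (𝓡 k) 𝓘(ℝ, EuclideanSpace ℝ (Fin (k + 1)))
      (fun ξ : UnitSphere k => (ξ : EuclideanSpace ℝ (Fin (k + 1))))
      ((extChartAt (cylinderModel k) p).symm q).2 :=
    contMDiff_coe_unitSphere.mdifferentiable (by simp) _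
  have h2 := mfderiv_comp q (hc.comp _ hs) h1
  rw [mfderiv_comp _ hc hs] at h2
  have h3 : ((fun ξ : UnitSphere k => (ξ : EuclideanSpace ℝ (Fin (k + 1)))) ∘ Prod.snd) ∘
      (extChartAt (cylinderModel k) p).symm = sphereParam p.2 ∘ Prod.snd := by
    funext q
    rw [Function.comp_apply, cylinder_extChartAt_symm]
    rfl
  have h4 : HasFDerivAt (sphereParam p.2 ∘ Prod.snd)
      ((fderiv ℝ (sphereParam p.2) q.2).comp (ContinuousLinearMap.snd ℝ ℝ _)) q :=
    (((contDiff_sphereParam p.2).differentiable (by simp) q.2).hasFDerivAt).comp q hasFDerivAt_snd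
  rw [h3, h4.hasMFDerivAt.mfderiv] at h2
  exact (congrArg (fun A => A a) h2).symm

theorem cylinderMetric_inChart (p : AddCircle T × UnitSphere k)
    {q : ℝ × EuclideanSpace ℝ (Fin k)} (hq : q ∈ (extChartAt (cylinderModel k) p).target)
    (a b : ℝ × EuclideanSpace ℝ (Fin k)) :
    (cylinderMetric T k).inChart p q a b = a.1 * b.1 +
      ⟪fderiv ℝ (sphereParam p.2) q.2 a.2, fderiv ℝ (sphereParam p.2) q.2 b.2⟫ := by
  have h1 := congrArg₂ (fun s t : ℝ => s * t) (mfderiv_fst_chart p hq a) (mfderiv_fst_chart p hq b)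
  have h2 := congrArg₂ (fun s t : EuclideanSpace ℝ (Fin (k + 1)) => inner ℝ s t)
    (mfderiv_snd_chart p hq a) (mfderiv_snd_chart p hq b)
  exact congrArg₂ (fun s t : ℝ => s + t) h1 h2

/-- A metric conformal to the cylindric metric is the pull-back, by polar coordinates, of a
conformally flat metric on the punctured space. -/
theorem inChart_eq_pull {g : MetricTensor (cylinderModel k) (AddCircle T × UnitSphere k)}
    {ρ : AddCircle T × UnitSphere k → ℝ} (hg : ∀ x, g x = ρ x • cylinderMetric T k x)
    {f : EuclideanSpace ℝ (Fin (k + 1)) → ℝ}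
    (hf : ∀ (ξ : UnitSphere k) q, Real.exp (2 * f (polar ξ q)) * Real.exp q.1 ^ 2 =
      ρ ((q.1 : AddCircle T), (extChartAt (𝓡 k) ξ).symm q.2)) (p : AddCircle T × UnitSphere k)
    {τ : ℝ} (hτ : (τ : AddCircle T) = 0) :
    g.inChart p =ᶠ[𝓝 (extChartAt (cylinderModel k) p p)]
      pull (fun q => polar p.2 (q + (τ, 0))) (conf f) := by
  filter_upwards [(isOpen_extChartAt_target (I := cylinderModel k) p).mem_nhds
    (mem_extChartAt_target p)] with q hq
  refine ContinuousLinearMap.ext fun a => ContinuousLinearMap.ext fun b => ?_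
  have h1 : g.inChart p q a b = ρ ((extChartAt (cylinderModel k) p).symm q) *
      (cylinderMetric T k).inChart p q a b := by
    have hx := hg ((extChartAt (cylinderModel k) p).symm q)
    change g ((extChartAt (cylinderModel k) p).symm q) _ _ = _
    rw [hx]
    rfl
  have e1 : (q + (τ, 0)).1 = q.1 + τ := rfl
  have e2 : (q + (τ, 0)).2 = q.2 := add_zero q.2
  have h2 := hf p.2 (q + (τ, 0))
  rw [e2, e1, AddCircle.coe_add, hτ, add_zero] at h2
  rw [h1, cylinderMetric_inChart p hq, pull_apply, conf_apply, fderiv_comp_add_right,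
    inner_fderiv_polar, cylinder_extChartAt_symm, ← h2, e1, e2]
  ring

end CylinderCharts

end

/-! ### Transfer to the punctured space: harmonic curvature, symmetry and the equation of the
factor. -/

noncomputable section

open Filter Topology Coord

local notation "⟪" x ", " y "⟫" => inner ℝ x y

namespace Coord

/-- Smoothness can be checked after composition with a local diffeomorphism. -/
theorem IsLocalDiffeoNear.contDiffAt_of_comp {E E' G : Type*} [NormedAddCommGroup E]
    [NormedSpace ℝ E] [CompleteSpace E] [NormedAddCommGroup E'] [NormedSpace ℝ E']
    [NormedAddCommGroup G] [NormedSpace ℝ G] {Φ : E → E'} {x : E} (hΦ : IsLocalDiffeoNear Φ x)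
    {v : E' → G} (hv : ContDiffAt ℝ ∞ (v ∘ Φ) x) : ContDiffAt ℝ ∞ v (Φ x) := by
  obtain ⟨h1, e, he⟩ := hΦ.self_of_nhds
  have h2 : HasFDerivAt Φ (e : E →L[ℝ] E') x :=
    he ▸ (h1.differentiableAt (by simp)).hasFDerivAt
  have h3 := h1.to_localInverse h2 (by simp)
  have h4 := (h1.hasStrictFDerivAt' h2 (by simp)).eventually_right_inverse
  have h5 : h1.localInverse h2 (by simp) (Φ x) = x := h1.localInverse_apply_image h2 (by simp)
  refine ContDiffAt.congr_of_eventuallyEq (ContDiffAt.comp (Φ x) (h5.symm ▸ hv) h3) ?_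
  filter_upwards [h4] with y hy
  exact (congrArg v hy).symm

end Coord

section Cone

variable {k : ℕ} {T : ℝ} [hT : Fact (0 < T)]

/-- The radial projection to the unit sphere (the value at the origin is irrelevant). -/
def toSphere (x : EuclideanSpace ℝ (Fin (k + 1))) : UnitSphere k :=
  if h : x ≠ 0 then ⟨‖x‖⁻¹ • x, by
    rw [Metric.mem_sphere, dist_zero_right, norm_smul, norm_inv, norm_norm,
      inv_mul_cancel₀ (norm_ne_zero_iff.2 h)]⟩
  else ⟨EuclideanSpace.single 0 1, by simp⟩

theorem norm_coe_unitSphere (ξ : UnitSphere k) : ‖(ξ : EuclideanSpace ℝ (Fin (k + 1)))‖ = 1 :=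
  norm_eq_of_mem_sphere ξ

theorem toSphere_smul (ξ : UnitSphere k) {r : ℝ} (hr : 0 < r) :
    toSphere (r • (ξ : EuclideanSpace ℝ (Fin (k + 1)))) = ξ := by
  have h : r • (ξ : EuclideanSpace ℝ (Fin (k + 1))) ≠ 0 :=
    smul_ne_zero hr.ne' (ne_zero_of_mem_unit_sphere ξ)
  rw [toSphere, dif_pos h]
  apply Subtype.ext
  change ‖r • (ξ : EuclideanSpace ℝ (Fin (k + 1)))‖⁻¹ • r •
    (ξ : EuclideanSpace ℝ (Fin (k + 1))) = ξ
  rw [norm_smul, norm_coe_unitSphere, mul_one, Real.norm_of_nonneg hr.le, smul_smul,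
    inv_mul_cancel₀ hr.ne', one_smul]

theorem norm_smul_toSphere {x : EuclideanSpace ℝ (Fin (k + 1))} (hx : x ≠ 0) :
    ‖x‖ • (toSphere x : EuclideanSpace ℝ (Fin (k + 1))) = x := by
  rw [toSphere, dif_pos hx, smul_smul, mul_inv_cancel₀ (norm_ne_zero_iff.2 hx), one_smul]

theorem polar_toSphere {x : EuclideanSpace ℝ (Fin (k + 1))} (hx : x ≠ 0) :
    polar (toSphere x) (Real.log ‖x‖, extChartAt (𝓡 k) (toSphere x) (toSphere x)) = x := by
  rw [polar, Real.exp_log (norm_pos_iff.2 hx), sphereParam, extChartAt_to_inv]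
  exact norm_smul_toSphere hx

/-- A function on the cylinder, as a function of the punctured space. -/
def coneExtension (u : AddCircle T × UnitSphere k → ℝ) (x : EuclideanSpace ℝ (Fin (k + 1))) : ℝ :=
  u ((Real.log ‖x‖ : ℝ), toSphere x)

variable {u : AddCircle T × UnitSphere k → ℝ}

omit hT in
theorem coneExtension_exp_smul (t : ℝ) (ξ : UnitSphere k) :
    coneExtension u (Real.exp t • (ξ : EuclideanSpace ℝ (Fin (k + 1)))) = u (t, ξ) := by
  rw [coneExtension, toSphere_smul ξ (Real.exp_pos t), norm_smul, norm_coe_unitSphere, mul_one,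
    Real.norm_of_nonneg (Real.exp_pos t).le, Real.log_exp]

omit hT in
theorem coneExtension_polar (ξ : UnitSphere k) (q : ℝ × EuclideanSpace ℝ (Fin k)) :
    coneExtension u (polar ξ q) = u (q.1, (extChartAt (𝓡 k) ξ).symm q.2) :=
  coneExtension_exp_smul _ _

theorem contDiffAt_coneExtension (hu : ContMDiff (cylinderModel k) 𝓘(ℝ, ℝ) ∞ u)
    {x : EuclideanSpace ℝ (Fin (k + 1))} (hx : x ≠ 0) : ContDiffAt ℝ ∞ (coneExtension u) x := by
  set ξ := toSphere x with hξ
  set q : ℝ × EuclideanSpace ℝ (Fin k) := (Real.log ‖x‖, extChartAt (𝓡 k) ξ ξ) with hq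
  have hx' : polar ξ q = x := polar_toSphere hx
  rw [← hx']
  apply (isLocalDiffeoNear_polar ξ q).contDiffAt_of_comp
  have h1 : ContMDiffAt 𝓘(ℝ, ℝ) 𝓘(ℝ, ℝ) ∞ (fun t : ℝ => (t : AddCircle T)) q.1 :=
    AddCircle.contMDiff_coe _
  have h2 : ContMDiffAt 𝓘(ℝ, EuclideanSpace ℝ (Fin k)) (𝓡 k) ∞ (extChartAt (𝓡 k) ξ).symm q.2 :=
    (contMDiffOn_extChartAt_symm ξ).contMDiffAt
      ((isOpen_extChartAt_target ξ).mem_nhds (mem_target_sphere ξ _))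
  have h3 : ContMDiffAt 𝓘(ℝ, ℝ × EuclideanSpace ℝ (Fin k)) 𝓘(ℝ, ℝ) ∞ Prod.fst q :=
    contDiff_fst.contMDiff _
  have h4 : ContMDiffAt 𝓘(ℝ, ℝ × EuclideanSpace ℝ (Fin k)) 𝓘(ℝ, EuclideanSpace ℝ (Fin k)) ∞
      Prod.snd q := contDiff_snd.contMDiff _
  have h5 := (hu _).comp q ((h1.comp q h3).prodMk (h2.comp q h4))
  refine (contMDiffAt_iff_contDiffAt.1 h5).congr_of_eventuallyEq (Eventually.of_forall fun q => ?_)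
  exact coneExtension_polar ξ q

/-- The density of weight `-a` on the punctured space which corresponds to a function on the
cylinder. -/
def coneDensity (u : AddCircle T × UnitSphere k → ℝ) (x : EuclideanSpace ℝ (Fin (k + 1))) : ℝ :=
  ‖x‖ ^ (-(((k : ℝ) - 1) / 2)) * coneExtension u x

theorem contDiffAt_coneDensity (hu : ContMDiff (cylinderModel k) 𝓘(ℝ, ℝ) ∞ u)
    {x : EuclideanSpace ℝ (Fin (k + 1))} (hx : x ≠ 0) : ContDiffAt ℝ ∞ (coneDensity u) x :=
  ((contDiffAt_norm ℝ hx).rpow_const_of_ne (norm_ne_zero_iff.2 hx)).mul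
    (contDiffAt_coneExtension hu hx)

theorem isSmoothNear_coneDensity (hu : ContMDiff (cylinderModel k) 𝓘(ℝ, ℝ) ∞ u)
    {x : EuclideanSpace ℝ (Fin (k + 1))} (hx : x ≠ 0) : IsSmoothNear (coneDensity u) x := by
  filter_upwards [isOpen_ne.mem_nhds hx] with y hy using contDiffAt_coneDensity hu hy

omit hT in
theorem coneDensity_pos (hpos : ∀ x, 0 < u x) {x : EuclideanSpace ℝ (Fin (k + 1))} (hx : x ≠ 0) :
    0 < coneDensity u x :=
  mul_pos (Real.rpow_pos_of_pos (norm_pos_iff.2 hx) _) (hpos _)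

/-- The exponent of the conformal factor on the punctured space. -/
def coneExponent (u : AddCircle T × UnitSphere k → ℝ) (x : EuclideanSpace ℝ (Fin (k + 1))) : ℝ :=
  2 / (((k + 1 : ℕ) : ℝ) - 2) * Real.log (coneDensity u x)

theorem isSmoothNear_coneExponent (hu : ContMDiff (cylinderModel k) 𝓘(ℝ, ℝ) ∞ u)
    (hpos : ∀ x, 0 < u x) {x : EuclideanSpace ℝ (Fin (k + 1))} (hx : x ≠ 0) :
    IsSmoothNear (coneExponent u) x := by
  filter_upwards [isOpen_ne.mem_nhds hx] with y hy
  exact contDiffAt_const.mul ((contDiffAt_coneDensity hu hy).log (coneDensity_pos hpos hy).ne')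

omit hT in
theorem log_coneDensity (hpos : ∀ x, 0 < u x) {x : EuclideanSpace ℝ (Fin (k + 1))} (hx : x ≠ 0) :
    Real.log (coneDensity u x) =
      -(((k : ℝ) - 1) / 2) * Real.log ‖x‖ + Real.log (coneExtension u x) := by
  have h := norm_pos_iff.2 hx
  rw [coneDensity, Real.log_mul (Real.rpow_pos_of_pos h _).ne' (show 0 < coneExtension u x from hpos _).ne', Real.log_rpow h]

variable {g : MetricTensor (cylinderModel k) (AddCircle T × UnitSphere k)} {c : ℝ}

/-- The weight ‖x‖^{-a} in `coneDensity` contributes e^{-2t} to the conformal factor, which cancels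
the e^{2t} coming from polar coordinates. -/
theorem inChart_eq_pull_coneExponent (hk : 2 ≤ k) (hpos : ∀ x, 0 < u x)
    (hg : ∀ x, g x = u x ^ (4 / (((k + 1 : ℕ) : ℝ) - 2)) • cylinderMetric T k x)
    (p : AddCircle T × UnitSphere k) {τ : ℝ} (hτ : (τ : AddCircle T) = 0) :
    g.inChart p =ᶠ[𝓝 (extChartAt (cylinderModel k) p p)]
      pull (fun q => polar p.2 (q + (τ, 0))) (conf (coneExponent u)) := by
  refine inChart_eq_pull hg (fun ξ q => ?_) p hτ
  have hk' : (2 : ℝ) ≤ k := by exact_mod_cast hk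
  have hk1 : (k : ℝ) - 1 ≠ 0 := by linarith
  rw [coneExponent, log_coneDensity hpos (polar_ne_zero ξ q), norm_polar, Real.log_exp,
    coneExtension_polar, Real.rpow_def_of_pos (hpos _), ← Real.exp_nat_mul, ← Real.exp_add]
  congr 1
  push_cast
  rw [show (k : ℝ) + 1 - 2 = k - 1 by ring]
  field_simp
  ring

/-- The punctured space is covered by charts of the cylinder. -/
theorem exists_inChart_eq_pull_coneExponent (hk : 2 ≤ k) (hpos : ∀ x, 0 < u x)
    (hg : ∀ x, g x = u x ^ (4 / (((k + 1 : ℕ) : ℝ) - 2)) • cylinderMetric T k x)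
    {x : EuclideanSpace ℝ (Fin (k + 1))} (hx : x ≠ 0) :
    ∃ (p : AddCircle T × UnitSphere k)
      (Φ : ℝ × EuclideanSpace ℝ (Fin k) → EuclideanSpace ℝ (Fin (k + 1))),
      Φ (extChartAt (cylinderModel k) p p) = x ∧
      IsLocalDiffeoNear Φ (extChartAt (cylinderModel k) p p) ∧
      g.inChart p =ᶠ[𝓝 (extChartAt (cylinderModel k) p p)] pull Φ (conf (coneExponent u)) := by
  set p : AddCircle T × UnitSphere k := ((Real.log ‖x‖ : ℝ), toSphere x) with hp
  set s : ℝ := extChartAt 𝓘(ℝ, ℝ) p.1 p.1 with hs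
  have hq : extChartAt (cylinderModel k) p p = (s, extChartAt (𝓡 k) (toSphere x) (toSphere x)) := by
    rw [extChartAt_prod]
    rfl
  -- The chart sees log‖x‖ only modulo T; the discrepancy is a period and is absorbed by the shift
  -- of the polar coordinates.
  have hτ : ((Real.log ‖x‖ - s : ℝ) : AddCircle T) = 0 := by
    rw [AddCircle.coe_sub, hs, AddCircle.coe_extChartAt, sub_self]
  refine ⟨p, _, ?_, isLocalDiffeoNear_polar_add p.2 _ _,
    inChart_eq_pull_coneExponent hk hpos hg p hτ⟩
  rw [hq]
  change polar (toSphere x) ((s, _) + (Real.log ‖x‖ - s, 0)) = x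
  rw [Prod.mk_add_mk, add_sub_cancel, add_zero]
  exact polar_toSphere hx

theorem scalar_coneExponent (hk : 2 ≤ k) (hu : ContMDiff (cylinderModel k) 𝓘(ℝ, ℝ) ∞ u)
    (hpos : ∀ x, 0 < u x)
    (hg : ∀ x, g x = u x ^ (4 / (((k + 1 : ℕ) : ℝ) - 2)) • cylinderMetric T k x)
    (hc : ∀ x, scalarCurvature g x = c) {x : EuclideanSpace ℝ (Fin (k + 1))} (hx : x ≠ 0) :
    scalar (conf (coneExponent u)) x = c := by
  obtain ⟨p, Φ, h1, h2, h3⟩ := exists_inChart_eq_pull_coneExponent hk hpos hg hx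
  rw [← hc p, scalarCurvature, scalar_pull h2 ?_ h3, h1]
  rw [h1]
  exact (isSmoothNear_coneExponent hu hpos hx).isMetricNear

theorem hasHarmonicCurvature_of_conformal (hk : 2 ≤ k)
    (hu : ContMDiff (cylinderModel k) 𝓘(ℝ, ℝ) ∞ u) (hpos : ∀ x, 0 < u x)
    (hg : ∀ x, g x = u x ^ (4 / (((k + 1 : ℕ) : ℝ) - 2)) • cylinderMetric T k x)
    (hc : ∀ x, scalarCurvature g x = c) : HasHarmonicCurvature g := by
  intro p v w z
  have h0 := inChart_eq_pull_coneExponent hk hpos hg p (τ := 0) (AddCircle.coe_zero T)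
  set q := extChartAt (cylinderModel k) p p
  have h1 := isSmoothNear_coneExponent hu hpos (polar_ne_zero p.2 (q + ((0 : ℝ), 0)))
  rw [divRiemann_pull (isLocalDiffeoNear_polar_add _ _ _) h1.isMetricNear h0]
  refine divRiemann_conf_eq_zero (c := c) ?_ h1 ?_ _ _ _
  · rw [finrank_euclideanSpace_fin]
    omega
  · filter_upwards [isOpen_ne.mem_nhds (polar_ne_zero p.2 (q + ((0 : ℝ), 0)))] with y hy
    exact scalar_coneExponent hk hu hpos hg hc hy

theorem covRicci_coneExponent (hk : 2 ≤ k) (hu : ContMDiff (cylinderModel k) 𝓘(ℝ, ℝ) ∞ u)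
    (hpos : ∀ x, 0 < u x)
    (hg : ∀ x, g x = u x ^ (4 / (((k + 1 : ℕ) : ℝ) - 2)) • cylinderMetric T k x)
    (hr : HasParallelRicci g) {x : EuclideanSpace ℝ (Fin (k + 1))} (hx : x ≠ 0)
    (a v w : EuclideanSpace ℝ (Fin (k + 1))) : covRicci (conf (coneExponent u)) x a v w = 0 := by
  obtain ⟨p, Φ, h1, h2, h3⟩ := exists_inChart_eq_pull_coneExponent hk hpos hg hx
  obtain ⟨a, rfl⟩ := h2.surjective a
  obtain ⟨v, rfl⟩ := h2.surjective v
  obtain ⟨w, rfl⟩ := h2.surjective w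
  have h4 := covRicci_pull h2 (by
    rw [h1]
    exact (isSmoothNear_coneExponent hu hpos hx).isMetricNear) h3 a v w
  rw [← hr p a v w, h4, h1]

/-- The Yamabe equation for the density of a metric of constant scalar curvature. -/
theorem lap_coneDensity (hk : 2 ≤ k) (hu : ContMDiff (cylinderModel k) 𝓘(ℝ, ℝ) ∞ u)
    (hpos : ∀ x, 0 < u x)
    (hg : ∀ x, g x = u x ^ (4 / (((k + 1 : ℕ) : ℝ) - 2)) • cylinderMetric T k x)
    (hc : ∀ x, scalarCurvature g x = c) {x : EuclideanSpace ℝ (Fin (k + 1))} (hx : x ≠ 0) :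
    lap (coneDensity u) x = -(c * (k - 1) / (4 * k)) *
      coneDensity u x ^ ((((k : ℝ) - 1) / 2 + 2) / (((k : ℝ) - 1) / 2)) := by
  have hk' : (2 : ℝ) ≤ k := by exact_mod_cast hk
  have hk1 : (k : ℝ) - 1 ≠ 0 := by linarith
  have hv := coneDensity_pos hpos hx
  have h1 := scalar_conf_log (x := x) (v := coneDensity u)
    (by rw [finrank_euclideanSpace_fin]; omega) (isSmoothNear_coneDensity hu hx) hv
  have h2 := scalar_coneExponent hk hu hpos hg hc hx
  rw [finrank_euclideanSpace_fin] at h1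
  have h3 : c = _ := h2.symm.trans h1
  have h4 : ((((k + 1 : ℕ) : ℝ) + 2) / (((k + 1 : ℕ) : ℝ) - 2)) =
      (((k : ℝ) - 1) / 2 + 2) / (((k : ℝ) - 1) / 2) := by
    push_cast
    rw [show (k : ℝ) + 1 - 2 = k - 1 by ring]
    field_simp
    ring
  rw [h4, Real.rpow_neg hv.le] at h3
  rw [h3]
  have h5 := Real.rpow_pos_of_pos hv ((((k : ℝ) - 1) / 2 + 2) / (((k : ℝ) - 1) / 2))
  generalize coneDensity u x ^ ((((k : ℝ) - 1) / 2 + 2) / (((k : ℝ) - 1) / 2)) = P at h5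
  push_cast
  rw [show (k : ℝ) + 1 - 2 = k - 1 by ring, show (k : ℝ) + 1 - 1 = k by ring]
  field_simp

/-- A metric of constant scalar curvature which is conformal to the cylindric metric has positive
scalar curvature. -/
theorem scalarCurvature_pos (hk : 2 ≤ k) (hu : ContMDiff (cylinderModel k) 𝓘(ℝ, ℝ) ∞ u)
    (hpos : ∀ x, 0 < u x)
    (hg : ∀ x, g x = u x ^ (4 / (((k + 1 : ℕ) : ℝ) - 2)) • cylinderMetric T k x)
    (hc : ∀ x, scalarCurvature g x = c) : 0 < c := by
  have hk' : (2 : ℝ) ≤ k := by exact_mod_cast hk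
  have hk1 : 0 < (k : ℝ) - 1 := by linarith
  obtain ⟨⟨b, ξ⟩, -, hb⟩ := isCompact_univ.exists_isMaxOn ⟨(0, toSphere 0), mem_univ _⟩
    hu.continuous.continuousOn
  obtain ⟨t, rfl⟩ := QuotientAddGroup.mk_surjective b
  set M := u ((t : AddCircle T), ξ) with hM
  set x : EuclideanSpace ℝ (Fin (k + 1)) := Real.exp t • (ξ : EuclideanSpace ℝ (Fin (k + 1)))
    with hxdef
  have hx : x ≠ 0 := smul_ne_zero (Real.exp_pos t).ne' (ne_zero_of_mem_unit_sphere ξ)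
  have hs := isSmoothNear_norm_rpow (sub_ne_zero.1 ((sub_zero x).symm ▸ hx))
    (-(((k : ℝ) - 1) / 2))
  have hl := lap_norm_rpow (sub_ne_zero.1 ((sub_zero x).symm ▸ hx)) (-(((k : ℝ) - 1) / 2))
  simp only [sub_zero] at hs hl
  have hv := isSmoothNear_coneDensity hu hx
  -- The comparison function M‖y‖^{-a} represents the constant M = max u and touches the density
  -- from above at `x`. Its Laplacian there is negative, whereas c ≤ 0 would make that of the
  -- density nonnegative.
  have hmin : IsLocalMin (fun y => M * ‖y‖ ^ (-(((k : ℝ) - 1) / 2)) - coneDensity u y) x := by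
    have h0 : M * ‖x‖ ^ (-(((k : ℝ) - 1) / 2)) - coneDensity u x = 0 := by
      rw [coneDensity, hxdef, coneExtension_exp_smul, ← hM, mul_comm, sub_self]
    refine Eventually.of_forall fun y => ?_
    beta_reduce
    rw [h0, coneDensity, mul_comm, ← mul_sub]
    exact mul_nonneg (Real.rpow_nonneg (norm_nonneg _) _) (sub_nonneg.2 (hb (mem_univ _)))
  have h1 := nonneg_lap_of_isLocalMin ((hs.const_mul M).sub hv) hmin
  rw [lap_sub (hs.const_mul M) hv, lap_const_mul hs, hl, lap_coneDensity hk hu hpos hg hc hx,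
    finrank_euclideanSpace_fin] at h1
  have h2 := Real.rpow_pos_of_pos (coneDensity_pos hpos hx)
    ((((k : ℝ) - 1) / 2 + 2) / (((k : ℝ) - 1) / 2))
  have h3 := Real.rpow_pos_of_pos (norm_pos_iff.2 hx) (-(((k : ℝ) - 1) / 2))
  have h4 : 0 < M := hpos _
  have h5 : M * (-(((k : ℝ) - 1) / 2) * (-(((k : ℝ) - 1) / 2) + ((k + 1 : ℕ) : ℝ) - 2) *
      ‖x‖ ^ (-(((k : ℝ) - 1) / 2)) / ‖x‖ ^ 2) < 0 := by
    have h6 : (-(((k : ℝ) - 1) / 2) + ((k + 1 : ℕ) : ℝ) - 2) = ((k : ℝ) - 1) / 2 := by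
      push_cast
      ring
    rw [h6]
    have h7 : 0 < M * (((k : ℝ) - 1) / 2 * (((k : ℝ) - 1) / 2) *
      ‖x‖ ^ (-(((k : ℝ) - 1) / 2)) / ‖x‖ ^ 2) := by
      have := norm_pos_iff.2 hx
      positivity
    have h8 := neg_lt_zero.2 h7
    rw [← mul_neg, ← neg_div, ← neg_mul, ← neg_mul] at h8
    exact h8
  by_contra hc0
  have h6 : c * (k - 1) / (4 * k) ≤ 0 := by
    apply div_nonpos_of_nonpos_of_nonneg _ (by positivity)
    exact mul_nonpos_of_nonpos_of_nonneg (not_lt.1 hc0) hk1.le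
  have h9 := mul_nonneg (neg_nonneg.2 h6) h2.le
  linarith

/-- Compactness of the cylinder supplies the two-sided lower bound: the constant is min u.
Positivity of the scalar curvature gives K ≥ 0. -/
theorem exists_isSingularSolution (hk : 2 ≤ k) (hu : ContMDiff (cylinderModel k) 𝓘(ℝ, ℝ) ∞ u)
    (hpos : ∀ x, 0 < u x)
    (hg : ∀ x, g x = u x ^ (4 / (((k + 1 : ℕ) : ℝ) - 2)) • cylinderMetric T k x)
    (hc : ∀ x, scalarCurvature g x = c) :
    ∃ b, IsSingularSolution (coneDensity u) (((k : ℝ) - 1) / 2) (c * (k - 1) / (4 * k)) b := by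
  have hk' : (2 : ℝ) ≤ k := by exact_mod_cast hk
  have hk1 : 0 < (k : ℝ) - 1 := by linarith
  obtain ⟨p, -, hp⟩ := isCompact_univ.exists_isMinOn ⟨((0 : AddCircle T), toSphere 0), mem_univ _⟩
    hu.continuous.continuousOn
  refine ⟨u p, ?_, ?_, fun x hx => (contDiffAt_coneDensity hu hx).contDiffWithinAt,
    fun x => coneDensity_pos hpos, fun x => lap_coneDensity hk hu hpos hg hc, ?_, hpos p, ?_⟩
  · rw [finrank_euclideanSpace_fin]
    omega
  · rw [finrank_euclideanSpace_fin]
    push_cast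
    ring
  · have := scalarCurvature_pos hk hu hpos hg hc
    positivity
  · intro x hx
    rw [coneDensity, mul_comm]
    exact mul_le_mul_of_nonneg_left (hp (mem_univ _)) (Real.rpow_nonneg (norm_nonneg _) _)

/-- The conformal factor of a metric of constant scalar curvature does not depend on the point of
the sphere. -/
theorem conformalFactor_eq (hk : 2 ≤ k) (hu : ContMDiff (cylinderModel k) 𝓘(ℝ, ℝ) ∞ u)
    (hpos : ∀ x, 0 < u x)
    (hg : ∀ x, g x = u x ^ (4 / (((k + 1 : ℕ) : ℝ) - 2)) • cylinderMetric T k x)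
    (hc : ∀ x, scalarCurvature g x = c) (t : ℝ) (ξ η : UnitSphere k) : u (t, ξ) = u (t, η) := by
  obtain ⟨b, hb⟩ := exists_isSingularSolution hk hu hpos hg hc
  have hnorm : ∀ ξ : UnitSphere k, ‖Real.exp t • (ξ : EuclideanSpace ℝ (Fin (k + 1)))‖ =
      Real.exp t := fun ξ => by
    rw [norm_smul, norm_coe_unitSphere, mul_one, Real.norm_of_nonneg (Real.exp_pos t).le]
  have h1 := hb.eq_of_norm_eq (smul_ne_zero (Real.exp_pos t).ne' (ne_zero_of_mem_unit_sphere ξ))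
    ((hnorm ξ).trans (hnorm η).symm)
  rw [coneDensity, coneDensity, hnorm, hnorm, coneExtension_exp_smul, coneExtension_exp_smul] at h1
  exact mul_left_cancel₀ (Real.rpow_pos_of_pos (Real.exp_pos t) _).ne' h1

/-- The ordinary differential equation of the conformal factor. -/
theorem deriv_deriv_conformalFactor (hk : 2 ≤ k) (hu : ContMDiff (cylinderModel k) 𝓘(ℝ, ℝ) ∞ u)
    (hpos : ∀ x, 0 < u x)
    (hg : ∀ x, g x = u x ^ (4 / (((k + 1 : ℕ) : ℝ) - 2)) • cylinderMetric T k x)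
    (hc : ∀ x, scalarCurvature g x = c) {w : ℝ → ℝ} (hw : ContDiff ℝ ∞ w)
    (huw : ∀ (t : ℝ) ξ, u (t, ξ) = w t) (t : ℝ) :
    deriv (deriv w) t = (((k : ℝ) - 1) / 2) ^ 2 * w t - c * (k - 1) / (4 * k) *
      w t ^ ((((k : ℝ) - 1) / 2 + 2) / (((k : ℝ) - 1) / 2)) := by
  have hk' : (2 : ℝ) ≤ k := by exact_mod_cast hk
  have hk1 : (k : ℝ) - 1 ≠ 0 := by linarith
  set a : ℝ := ((k : ℝ) - 1) / 2 with ha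
  have ha0 : a ≠ 0 := by
    rw [ha]
    exact div_ne_zero hk1 two_ne_zero
  set ξ : UnitSphere k := toSphere 0
  set x : EuclideanSpace ℝ (Fin (k + 1)) := Real.exp t • (ξ : EuclideanSpace ℝ (Fin (k + 1)))
    with hxdef
  have hnorm : ‖x‖ = Real.exp t := by
    rw [hxdef, norm_smul, norm_coe_unitSphere, mul_one, Real.norm_of_nonneg (Real.exp_pos t).le]
  have hx : x ≠ 0 := smul_ne_zero (Real.exp_pos t).ne' (ne_zero_of_mem_unit_sphere ξ)
  have hw0 : 0 < w t := huw t ξ ▸ hpos _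
  -- This is the density as a function of log‖x‖. In h'' + 2a h' the first derivatives of `w`
  -- cancel, leaving e^{-as}(w'' - a² w).
  set h : ℝ → ℝ := fun s => Real.exp (-a * s) * w s with hh
  have hsm : ContDiff ℝ ∞ h :=
    (Real.contDiff_exp.comp (contDiff_const.mul contDiff_id)).mul hw
  have hv : ∀ y, y ≠ 0 → coneDensity u y = h (Real.log ‖y - 0‖) := fun y hy => by
    rw [sub_zero, coneDensity, coneExtension, huw, Real.rpow_def_of_pos (norm_pos_iff.2 hy),
      mul_comm (Real.log _)]
  have hev : coneDensity u =ᶠ[𝓝 x] fun y => h (Real.log ‖y - 0‖) := by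
    filter_upwards [isOpen_ne.mem_nhds hx] with y hy using hv y hy
  have h1 := lap_coneDensity hk hu hpos hg hc hx
  rw [lap_congr hev, lap_comp_log_norm (sub_ne_zero.1 ((sub_zero x).symm ▸ hx)) hsm, hv x hx,
    finrank_euclideanSpace_fin, sub_zero, hnorm, Real.log_exp] at h1
  have hw1 : ∀ s, HasDerivAt w (deriv w s) s := fun s =>
    (hw.differentiable (by simp) s).hasDerivAt
  have hw2 : ∀ s, HasDerivAt (deriv w) (deriv (deriv w) s) s := fun s =>
    ((contDiff_infty_iff_deriv.1 hw).2.differentiable (by simp) s).hasDerivAt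
  have he : ∀ s, HasDerivAt (fun s => Real.exp (-a * s)) (Real.exp (-a * s) * (-a)) s := fun s => by
    simpa using ((hasDerivAt_id s).const_mul (-a)).exp
  have d1 : deriv h = fun s => Real.exp (-a * s) * (deriv w s - a * w s) := by
    funext s
    have : HasDerivAt h _ s := (he s).mul (hw1 s)
    rw [this.deriv]
    ring
  have d2 : deriv (deriv h) t =
      Real.exp (-a * t) * (deriv (deriv w) t - 2 * a * deriv w t + a ^ 2 * w t) := by
    rw [d1]
    have : HasDerivAt (fun s => Real.exp (-a * s) * (deriv w s - a * w s)) _ t :=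
      (he t).mul ((hw2 t).sub ((hw1 t).const_mul a))
    rw [this.deriv]
    ring
  have h2 : ((k + 1 : ℕ) : ℝ) - 2 = 2 * a := by
    rw [ha]
    push_cast
    ring
  have h3 : h t ^ ((a + 2) / a) =
      Real.exp (-a * t) * w t ^ ((a + 2) / a) / Real.exp t ^ 2 := by
    rw [hh, Real.mul_rpow (Real.exp_pos _).le hw0.le, ← Real.exp_mul, ← Real.exp_nat_mul,
      mul_div_right_comm, ← Real.exp_sub]
    congr 2
    push_cast
    field_simp
    ring
  rw [d2, d1, h2, h3] at h1
  beta_reduce at h1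
  have h4 := Real.exp_pos t
  have h5 := Real.exp_pos (-a * t)
  generalize Real.exp (-a * t) = P at h1 h5
  generalize Real.exp t = Q at h1 h4
  field_simp at h1 ⊢
  linarith

theorem contDiff_slice (hu : ContMDiff (cylinderModel k) 𝓘(ℝ, ℝ) ∞ u) (ξ : UnitSphere k) :
    ContDiff ℝ ∞ fun t : ℝ => u (t, ξ) :=
  contMDiff_iff_contDiff.1 (hu.comp (AddCircle.contMDiff_coe.prodMk contMDiff_const))

end Cone

end

/-! ### The Ricci tensor is not parallel. -/

noncomputable section

open Filter Topology Coord

local notation "⟪" x ", " y "⟫" => inner ℝ x y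

section OrdinaryDifferentialEquation

/-- A bounded solution attaining its bounds of the equations of a conformally flat, rotationally
symmetric metric of constant scalar curvature and parallel Ricci tensor is constant. -/
theorem eq_of_deriv_deriv_deriv_eq {h : ℝ → ℝ} (hh : ContDiff ℝ ∞ h) {b κ t₁ t₂ : ℝ} (hb : 0 < b)
    (h3 : ∀ t, deriv (deriv (deriv h)) t = 2 * deriv h t * deriv (deriv h) t)
    (h2 : ∀ t, deriv (deriv h) t + b * (deriv h t ^ 2 - 1) = κ * Real.exp (2 * h t))
    (hmax : ∀ t, h t ≤ h t₁) (hmin : ∀ t, h t₂ ≤ h t) (t : ℝ) : h t = h t₁ := by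
  have c1 := (contDiff_infty_iff_deriv.1 hh).2
  have c2 := (contDiff_infty_iff_deriv.1 c1).2
  have d0 : ∀ t, HasDerivAt h (deriv h t) t := fun t => (hh.differentiable (by simp) t).hasDerivAt
  have d2 : ∀ t, HasDerivAt (deriv (deriv h)) (deriv (deriv (deriv h)) t) t := fun t =>
    (c2.differentiable (by simp) t).hasDerivAt
  -- The third-order equation says that h'' e^{-2h} is a first integral.
  have hd : ∀ t, HasDerivAt (fun t => deriv (deriv h) t * Real.exp (-2 * h t)) 0 t := fun t => by
    refine ((d2 t).mul ((d0 t).const_mul (-2)).exp).congr_deriv ?_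
    rw [h3]
    ring
  have hconst : ∀ s, deriv (deriv h) s * Real.exp (-2 * h s) =
      deriv (deriv h) t₁ * Real.exp (-2 * h t₁) := fun s =>
    is_const_of_deriv_eq_zero (fun t => (hd t).differentiableAt) (fun t => (hd t).deriv) _ _
  -- At a critical point both equations reduce to a relation that determines e^{2h}, because b ≠ 0.
  -- Applied at a maximum and at a minimum it gives the same value.
  have key : ∀ s, deriv h s = 0 →
      (deriv (deriv h) t₁ * Real.exp (-2 * h t₁) - κ) * Real.exp (2 * h s) = b := by
    intro s hs
    have e1 := h2 s
    rw [hs] at e1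
    have e2 : Real.exp (-2 * h s) * Real.exp (2 * h s) = 1 := by
      rw [← Real.exp_add]
      simp
    rw [← hconst, sub_mul, mul_assoc, e2]
    linarith
  have k1 := key t₁ (IsLocalMax.deriv_eq_zero (Eventually.of_forall hmax))
  have k2 := key t₂ (IsLocalMin.deriv_eq_zero (Eventually.of_forall hmin))
  have h4 : deriv (deriv h) t₁ * Real.exp (-2 * h t₁) - κ ≠ 0 := by
    intro h0
    rw [h0, zero_mul] at k1
    exact hb.ne k1
  have h5 := Real.exp_injective (mul_left_cancel₀ h4 (k1.trans k2.symm))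
  have h6 := hmin t
  have h7 := hmax t
  linarith

end OrdinaryDifferentialEquation

namespace Coord

section RadialMetric

variable {F : Type*} [NormedAddCommGroup F] [InnerProductSpace ℝ F] [FiniteDimensional ℝ F]
  {f : F → ℝ} {h : ℝ → ℝ} {x : F}

omit [InnerProductSpace ℝ F] [FiniteDimensional ℝ F] in
theorem eventuallyEq_comp_log_norm (hf : ∀ x, x ≠ 0 → f x = h (Real.log ‖x‖)) (hx : x ≠ 0) :
    f =ᶠ[𝓝 x] fun y => h (Real.log ‖y - 0‖) := by
  filter_upwards [isOpen_ne.mem_nhds hx] with y hy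
  rw [sub_zero, hf y hy]

omit [FiniteDimensional ℝ F] in
theorem isSmoothNear_of_radial (hh : ContDiff ℝ ∞ h)
    (hf : ∀ x, x ≠ 0 → f x = h (Real.log ‖x‖)) (hx : x ≠ 0) : IsSmoothNear f x := by
  have h1 : IsSmoothNear (fun y => h (Real.log ‖y - 0‖)) x :=
    (isSmoothNear_log_norm hx).comp (Eventually.of_forall fun _ => hh.contDiffAt)
  filter_upwards [h1, (eventuallyEq_comp_log_norm hf hx).eventuallyEq_nhds] with y h2 h3
  exact h2.congr_of_eventuallyEq h3

theorem gradient_congr {u v : F → ℝ} (h : u =ᶠ[𝓝 x] v) : gradient u x = gradient v x := by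
  rw [gradient, gradient, h.fderiv_eq]

theorem gradient_radial (hh : ContDiff ℝ ∞ h)
    (hf : ∀ x, x ≠ 0 → f x = h (Real.log ‖x‖)) (hx : x ≠ 0) :
    gradient f x = (deriv h (Real.log ‖x‖) / ‖x‖ ^ 2) • x := by
  rw [gradient_congr (eventuallyEq_comp_log_norm hf hx),
    gradient_comp ((isSmoothNear_log_norm hx).self_of_nhds.differentiableAt (by simp))
      (hh.differentiable (by simp) _), gradient_log_norm hx, smul_smul, sub_zero, div_eq_mul_inv]

theorem inner_gradient_radial (hh : ContDiff ℝ ∞ h)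
    (hf : ∀ x, x ≠ 0 → f x = h (Real.log ‖x‖)) (hx : x ≠ 0) :
    ⟪gradient f x, x⟫ = deriv h (Real.log ‖x‖) := by
  have h0 := norm_ne_zero_iff.2 hx
  rw [gradient_radial hh hf hx, real_inner_smul_left, real_inner_self_eq_norm_sq]
  field_simp

theorem inner_gradient_self_radial (hh : ContDiff ℝ ∞ h)
    (hf : ∀ x, x ≠ 0 → f x = h (Real.log ‖x‖)) (hx : x ≠ 0) :
    ⟪gradient f x, gradient f x⟫ * ‖x‖ ^ 2 = deriv h (Real.log ‖x‖) ^ 2 := by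
  have h0 := norm_ne_zero_iff.2 hx
  rw [gradient_radial hh hf hx, real_inner_smul_left, real_inner_smul_right,
    real_inner_self_eq_norm_sq]
  field_simp

theorem inner_fderiv_gradient_radial (hh : ContDiff ℝ ∞ h)
    (hf : ∀ x, x ≠ 0 → f x = h (Real.log ‖x‖)) (hx : x ≠ 0) :
    ⟪fderiv ℝ (gradient f) x x, x⟫ =
      deriv (deriv h) (Real.log ‖x‖) - deriv h (Real.log ‖x‖) := by
  have h0 := norm_ne_zero_iff.2 hx
  have h1 : gradient f =ᶠ[𝓝 x] gradient fun y => h (Real.log ‖y - 0‖) := by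
    filter_upwards [(eventuallyEq_comp_log_norm hf hx).eventuallyEq_nhds] with y hy
      using gradient_congr hy
  rw [h1.fderiv_eq, fderiv_gradient_comp (isSmoothNear_log_norm hx)
    (Eventually.of_forall fun _ => hh.contDiffAt), gradient_log_norm hx]
  simp only [_root_.add_apply, _root_.smul_apply, ContinuousLinearMap.smulRight_apply,
    fderiv_gradient_log_norm hx]
  simp only [sub_zero, innerSL_apply_apply, inner_add_left, inner_sub_left,
    real_inner_smul_left, real_inner_self_eq_norm_sq, smul_eq_mul]
  field_simp
  ring

theorem trace_schouten_radial (hh : ContDiff ℝ ∞ h)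
    (hf : ∀ x, x ≠ 0 → f x = h (Real.log ‖x‖)) (hx : x ≠ 0) :
    LinearMap.trace ℝ F (schouten f x) * ‖x‖ ^ 2 =
      deriv (deriv h) (Real.log ‖x‖) + ((Module.finrank ℝ F : ℝ) - 2) *
        (deriv h (Real.log ‖x‖) + deriv h (Real.log ‖x‖) ^ 2 / 2) := by
  have h0 := norm_ne_zero_iff.2 hx
  rw [trace_schouten, add_mul, mul_assoc, inner_gradient_self_radial hh hf hx,
    lap_congr (eventuallyEq_comp_log_norm hf hx), lap_comp_log_norm hx hh, sub_zero]
  field_simp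
  ring

/-- The position vector `x` is the field ∂_t of logarithmic polar coordinates, so this is the
component Ric(∂_t, ∂_t). -/
theorem ricci_radial (hh : ContDiff ℝ ∞ h)
    (hf : ∀ x, x ≠ 0 → f x = h (Real.log ‖x‖)) (hx : x ≠ 0) :
    ricci (conf f) x x x = -((Module.finrank ℝ F : ℝ) - 1) * deriv (deriv h) (Real.log ‖x‖) := by
  rw [ricci_conf (isSmoothNear_of_radial hh hf hx), real_inner_self_eq_norm_sq,
    trace_schouten_radial hh hf hx, schouten_apply, inner_add_left, inner_sub_left,
    real_inner_smul_left, real_inner_smul_left, inner_fderiv_gradient_radial hh hf hx,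
    inner_gradient_radial hh hf hx, real_inner_self_eq_norm_sq x, mul_assoc 2⁻¹,
    inner_gradient_self_radial hh hf hx]
  ring

theorem christoffel_radial (hh : ContDiff ℝ ∞ h)
    (hf : ∀ x, x ≠ 0 → f x = h (Real.log ‖x‖)) (hx : x ≠ 0) :
    christoffel (conf f) x x x = deriv h (Real.log ‖x‖) • x := by
  have h0 := norm_ne_zero_iff.2 hx
  rw [christoffel_conf (isSmoothNear_of_radial hh hf hx), inner_gradient_radial hh hf hx,
    gradient_radial hh hf hx, real_inner_self_eq_norm_sq, smul_smul, mul_div_cancel₀ _ (by positivity)]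
  module

/-- Along the ray γ(s) = e^s e one has γ' = γ and ∇_{γ'}γ' = (1 + h')γ. Differentiating Ric(γ', γ')
= -(m-1)h'' and using the vanishing of ∇Ric gives the equation. -/
theorem deriv_deriv_deriv_of_covRicci (hm : 2 ≤ Module.finrank ℝ F) (hh : ContDiff ℝ ∞ h)
    (hf : ∀ x, x ≠ 0 → f x = h (Real.log ‖x‖))
    (hr : ∀ x, x ≠ 0 → covRicci (conf f) x x x x = 0) (s : ℝ) :
    deriv (deriv (deriv h)) s = 2 * (deriv h s + 1) * deriv (deriv h) s := by
  have : Nontrivial F := Module.nontrivial_of_finrank_pos (R := ℝ) (by omega)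
  obtain ⟨e, he⟩ := exists_norm_eq F zero_le_one
  have hm' : (2 : ℝ) ≤ Module.finrank ℝ F := by exact_mod_cast hm
  have he0 : e ≠ 0 := norm_ne_zero_iff.1 (he ▸ one_ne_zero)
  have hne : ∀ s, Real.exp s • e ≠ 0 := fun s => smul_ne_zero (Real.exp_pos s).ne' he0
  have hlog : ∀ s, Real.log ‖Real.exp s • e‖ = s := fun s => by
    rw [norm_smul, he, mul_one, Real.norm_of_nonneg (Real.exp_pos s).le, Real.log_exp]
  have hγ : HasDerivAt (fun s => Real.exp s • e) (Real.exp s • e) s :=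
    (Real.hasDerivAt_exp s).smul_const e
  have hR := ((contDiffAt_ricci (isSmoothNear_of_radial hh hf (hne s)).isMetricNear).differentiableAt
    (by simp)).hasFDerivAt
  have h0 : HasDerivAt (fun s => ricci (conf f) (Real.exp s • e))
      (fderiv ℝ (ricci (conf f)) (Real.exp s • e) (Real.exp s • e)) s := by
    have := hR.comp_hasDerivAt s hγ
    exact this
  have h1 := (h0.clm_apply hγ).clm_apply hγ
  have h2 : HasDerivAt (fun s => -((Module.finrank ℝ F : ℝ) - 1) * deriv (deriv h) s)
      (-((Module.finrank ℝ F : ℝ) - 1) * deriv (deriv (deriv h)) s) s :=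
    (((contDiff_infty_iff_deriv.1 (contDiff_infty_iff_deriv.1 hh).2).2.differentiable
      (by simp) s).hasDerivAt).const_mul _
  have h3 : ∀ s, ricci (conf f) (Real.exp s • e) (Real.exp s • e) (Real.exp s • e) =
      -((Module.finrank ℝ F : ℝ) - 1) * deriv (deriv h) s := fun s => by
    rw [ricci_radial hh hf (hne s), hlog]
  have h4 := (h2.congr_of_eventuallyEq (Eventually.of_forall h3)).unique h1
  have h5 := hr _ (hne s)
  rw [covRicci, christoffel_radial hh hf (hne s), hlog] at h5
  simp only [map_smul, _root_.smul_apply, _root_.add_apply, smul_eq_mul] at h4 h5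
  have h6 := h3 s
  simp only [map_smul, _root_.smul_apply, smul_eq_mul] at h6
  have h7 : (Module.finrank ℝ F : ℝ) - 1 ≠ 0 := by linarith
  apply mul_left_cancel₀ (neg_ne_zero.2 h7)
  linear_combination h4 + h5 + 2 * (1 + deriv h s) * h6

end RadialMetric

end Coord

section Cone

variable {k : ℕ} {T : ℝ} [hT : Fact (0 < T)] {u : AddCircle T × UnitSphere k → ℝ}
  {g : MetricTensor (cylinderModel k) (AddCircle T × UnitSphere k)} {c : ℝ}

/-- A pseudo-cylindric metric does not have parallel Ricci tensor. -/
theorem not_hasParallelRicci (hk : 2 ≤ k) (hu : ContMDiff (cylinderModel k) 𝓘(ℝ, ℝ) ∞ u)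
    (hpos : ∀ x, 0 < u x) (hne : ¬ ∃ b, ∀ x, u x = b)
    (hg : ∀ x, g x = u x ^ (4 / (((k + 1 : ℕ) : ℝ) - 2)) • cylinderMetric T k x)
    (hc : ∀ x, scalarCurvature g x = c) : ¬ HasParallelRicci g := by
  intro hr
  have hk' : (2 : ℝ) ≤ k := by exact_mod_cast hk
  have hk1 : 0 < (k : ℝ) - 1 := by linarith
  set η : UnitSphere k := toSphere 0
  set h : ℝ → ℝ := fun t => 2 / ((k : ℝ) - 1) * Real.log (u (t, η)) with hh
  have hsm : ContDiff ℝ ∞ h :=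
    contDiff_const.mul ((contDiff_slice hu η).log fun t => (hpos _).ne')
  -- `h` is the exponent relative to the cylinder and `f` the one relative to the Euclidean metric.
  -- The shift by t turns 2(f' + 1)f'' into 2h'h''.
  set f : ℝ → ℝ := fun t => h t - t with hfdef
  have hfs : ContDiff ℝ ∞ f := hsm.sub contDiff_id
  have hf : ∀ x : EuclideanSpace ℝ (Fin (k + 1)), x ≠ 0 →
      coneExponent u x = f (Real.log ‖x‖) := by
    intro x hx
    rw [coneExponent, log_coneDensity hpos hx, coneExtension,
      conformalFactor_eq hk hu hpos hg hc (Real.log ‖x‖) (toSphere x) η, hfdef, hh]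
    push_cast
    rw [show (k : ℝ) + 1 - 2 = k - 1 by ring]
    field_simp
    ring
  have hfin : Module.finrank ℝ (EuclideanSpace ℝ (Fin (k + 1))) = k + 1 := finrank_euclideanSpace_fin
  have d1 : deriv f = fun t => deriv h t - 1 := by
    funext t
    exact ((hsm.differentiable (by simp) t).hasDerivAt.sub (hasDerivAt_id t)).deriv
  have d2 : deriv (deriv f) = deriv (deriv h) := by
    rw [d1]
    funext t
    exact deriv_sub_const _
  have h3 : ∀ t, deriv (deriv (deriv h)) t = 2 * deriv h t * deriv (deriv h) t := fun t => by
    have := deriv_deriv_deriv_of_covRicci (by rw [hfin]; omega) hfs hf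
      (fun x hx => covRicci_coneExponent hk hu hpos hg hr hx x x x) t
    rw [d2, d1] at this
    simpa using this
  -- This is the equation of constant scalar curvature c for e^{2h}(dt² + dξ²).
  have h2 : ∀ t, deriv (deriv h) t + ((k : ℝ) - 1) / 2 * (deriv h t ^ 2 - 1) =
      -(c / (2 * k)) * Real.exp (2 * h t) := fun t => by
    set x : EuclideanSpace ℝ (Fin (k + 1)) := Real.exp t • (η : EuclideanSpace ℝ (Fin (k + 1)))
      with hxdef
    have hnorm : ‖x‖ = Real.exp t := by
      rw [hxdef, norm_smul, norm_coe_unitSphere, mul_one, Real.norm_of_nonneg (Real.exp_pos t).le]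
    have hx : x ≠ 0 := smul_ne_zero (Real.exp_pos t).ne' (ne_zero_of_mem_unit_sphere η)
    have e1 := trace_schouten_radial hfs hf hx
    have e2 := scalar_conf (isSmoothNear_coneExponent hu hpos hx)
    rw [scalar_coneExponent hk hu hpos hg hc hx, hf x hx] at e2
    rw [hfin, hnorm, Real.log_exp, ← Real.exp_nat_mul, d2, d1] at e1
    have e3 : f t = h t - t := rfl
    rw [hfin, hnorm, Real.log_exp, e3] at e2
    push_cast at e1 e2
    have e4 : Real.exp (-2 * (h t - t)) * Real.exp (2 * h t) = Real.exp (2 * t) := by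
      rw [← Real.exp_add]
      congr 1
      ring
    rw [← e4] at e1
    have e5 : c / (2 * k) = -(Real.exp (-2 * (h t - t)) *
        LinearMap.trace ℝ (EuclideanSpace ℝ (Fin (k + 1))) (schouten (coneExponent u) x)) := by
      rw [e2]
      field_simp
      ring
    rw [e5]
    linear_combination -e1
  obtain ⟨⟨b₁, ξ₁⟩, -, hb₁⟩ := isCompact_univ.exists_isMaxOn
    ⟨((0 : AddCircle T), toSphere 0), mem_univ _⟩ hu.continuous.continuousOn
  obtain ⟨⟨b₂, ξ₂⟩, -, hb₂⟩ := isCompact_univ.exists_isMinOn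
    ⟨((0 : AddCircle T), toSphere 0), mem_univ _⟩ hu.continuous.continuousOn
  obtain ⟨t₁, rfl⟩ := QuotientAddGroup.mk_surjective b₁
  obtain ⟨t₂, rfl⟩ := QuotientAddGroup.mk_surjective b₂
  have hmono : ∀ s t : ℝ, u (s, η) ≤ u (t, η) → h s ≤ h t := fun s t hst =>
    mul_le_mul_of_nonneg_left (Real.log_le_log (hpos _) hst) (by positivity)
  have hconst := eq_of_deriv_deriv_deriv_eq hsm (by positivity : 0 < ((k : ℝ) - 1) / 2) h3 h2
    (fun t => hmono t t₁ ((hb₁ (mem_univ _)).trans_eq (conformalFactor_eq hk hu hpos hg hc t₁ _ _)))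
    (fun t => hmono t₂ t ((conformalFactor_eq hk hu hpos hg hc t₂ _ _).trans_le (hb₂ (mem_univ _))))
  refine hne ⟨u (t₁, η), ?_⟩
  rintro ⟨b, ξ⟩
  obtain ⟨t, rfl⟩ := QuotientAddGroup.mk_surjective b
  refine (conformalFactor_eq hk hu hpos hg hc t ξ η).trans ?_
  have h4 : 2 / ((k : ℝ) - 1) ≠ 0 := by positivity
  exact Real.log_injOn_pos (hpos _) (hpos _) (mul_left_cancel₀ h4 (hconst t))

end Cone

end

/-! ### Arc length on the circle and the Derdzinski equation. -/

noncomputable section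

open Filter Topology Coord

local notation "⟪" x ", " y "⟫" => inner ℝ x y

section Reparametrization

/-- The primitive of a positive periodic function has a smooth inverse. -/
theorem exists_inverse_primitive {T : ℝ} (hT : 0 < T) {φ : ℝ → ℝ} (hφ : ContDiff ℝ ∞ φ)
    (hpos : ∀ t, 0 < φ t) (hper : Function.Periodic φ T) :
    ∃ (L : ℝ) (σ τ : ℝ → ℝ), 0 < L ∧ ContDiff ℝ ∞ σ ∧ ContDiff ℝ ∞ τ ∧
      (∀ t, τ (σ t) = t) ∧ (∀ s, σ (τ s) = s) ∧ (∀ t, σ (t + T) = σ t + L) ∧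
      (∀ s, τ (s + L) = τ s + T) ∧ ∀ s, HasDerivAt τ (φ (τ s))⁻¹ s := by
  set σ : ℝ → ℝ := fun t => ∫ r in (0 : ℝ)..t, φ r with hσ
  have hint : ∀ a b, IntervalIntegrable φ MeasureTheory.volume a b := fun a b =>
    hφ.continuous.intervalIntegrable a b
  have hd : ∀ t, HasDerivAt σ (φ t) t := fun t =>
    intervalIntegral.integral_hasDerivAt_right (hint 0 t)
      (hφ.continuous.stronglyMeasurableAtFilter _ _) hφ.continuous.continuousAt
  have hderiv : deriv σ = φ := funext fun t => (hd t).deriv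
  have hsm : ContDiff ℝ ∞ σ :=
    contDiff_infty_iff_deriv.2 ⟨fun t => (hd t).differentiableAt, hderiv.symm ▸ hφ⟩
  have hmono : StrictMono σ := strictMono_of_deriv_pos fun t => by
    rw [hderiv]
    exact hpos t
  have hσ0 : σ 0 = 0 := intervalIntegral.integral_same
  have hadd : ∀ t, σ (t + T) = σ t + σ T := fun t => by
    have h1 := intervalIntegral.integral_add_adjacent_intervals (hint 0 t) (hint t (t + T))
    rw [hper.intervalIntegral_add_eq t 0, zero_add] at h1
    exact h1.symm
  have hL : 0 < σ T := hσ0 ▸ hmono hT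
  -- Values at multiples of the period show that the primitive is unbounded in both directions,
  -- hence surjective.
  have hnat : ∀ n : ℕ, σ (n * T) = n * σ T ∧ σ (-(n * T)) = -(n * σ T) := by
    intro n
    induction n with
    | zero => simp [hσ0]
    | succ n ih =>
      have h1 := hadd (n * T)
      have h2 := hadd (-((n + 1 : ℕ) * T))
      rw [show -(((n + 1 : ℕ) : ℝ) * T) + T = -(n * T) by push_cast; ring, ih.2] at h2
      rw [ih.1] at h1
      refine ⟨?_, ?_⟩
      · push_cast
        rw [add_mul, one_mul, h1]
        ring
      · push_cast at h2 ⊢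
        linarith
  have hsurj : Function.Surjective σ := by
    intro s
    obtain ⟨n, hn⟩ := exists_nat_gt (|s| / σ T)
    rw [div_lt_iff₀ hL] at hn
    have h1 := abs_lt.1 hn
    have h2 : s ∈ Icc (σ (-(n * T))) (σ (n * T)) := by
      rw [(hnat n).1, (hnat n).2]
      exact ⟨h1.1.le, h1.2.le⟩
    have h3 : -(n * T) ≤ n * T := by
      have : 0 ≤ n * T := by positivity
      linarith
    obtain ⟨t, -, ht⟩ := intermediate_value_Icc h3 hsm.continuous.continuousOn h2
    exact ⟨t, ht⟩
  set e : ℝ ≃ₜ ℝ := (hmono.orderIsoOfSurjective σ hsurj).toHomeomorph with he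
  have hτσ : ∀ t, e.symm (σ t) = t := e.symm_apply_apply
  have hστ : ∀ s, σ (e.symm s) = s := e.apply_symm_apply
  refine ⟨σ T, σ, e.symm, hL, hsm, ?_, hτσ, hστ, hadd, fun s => ?_, fun s => ?_⟩
  · exact contDiff_iff_contDiffAt.2 fun s =>
      e.toOpenPartialHomeomorph.contDiffAt_symm_deriv (hpos (e.symm s)).ne' (mem_univ s)
        (hd (e.symm s)) hsm.contDiffAt
  · apply hmono.injective
    rw [hστ, hadd, hστ]
  · exact (hd (e.symm s)).of_local_left_inverse e.symm.continuous.continuousAt (hpos _).ne'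
      (Eventually.of_forall hστ)

end Reparametrization

section CircleDiffeomorphism

variable {T L : ℝ} [hT : Fact (0 < T)] [hL : Fact (0 < L)]

/-- Smoothness on the circle can be checked on the universal covering. -/
theorem AddCircle.contMDiff_of_comp_coe {E : Type*} [NormedAddCommGroup E] [NormedSpace ℝ E]
    {H : Type*} [TopologicalSpace H] {I : ModelWithCorners ℝ E H} {M : Type*} [TopologicalSpace M]
    [ChartedSpace H M] {f : AddCircle L → M}
    (hf : ContMDiff 𝓘(ℝ, ℝ) I ∞ fun s : ℝ => f (s : AddCircle L)) :
    ContMDiff 𝓘(ℝ, ℝ) I ∞ f := by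
  intro p
  have h1 := (hf (extChartAt 𝓘(ℝ, ℝ) p p)).comp p (contMDiffAt_extChartAt (I := 𝓘(ℝ, ℝ)))
  refine h1.congr_of_eventuallyEq ?_
  filter_upwards [extChartAt_source_mem_nhds (I := 𝓘(ℝ, ℝ)) p] with q hq
  have h2 := (extChartAt 𝓘(ℝ, ℝ) p).left_inv hq
  rw [AddCircle.extChartAt_symm_apply] at h2
  exact (congrArg f h2).symm

omit hT hL in
theorem AddCircle.periodic_coe_comp {τ : ℝ → ℝ} (hτ : ∀ s, τ (s + L) = τ s + T) :
    Function.Periodic (fun s => (τ s : AddCircle T)) L := fun s => by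
  beta_reduce
  rw [hτ, AddCircle.coe_add, AddCircle.coe_period, add_zero]

/-- The diffeomorphism of circles induced by an equivariant diffeomorphism of the line. -/
def AddCircle.diffeomorphOfEquivariant {σ τ : ℝ → ℝ} (hσ : ContDiff ℝ ∞ σ) (hτ : ContDiff ℝ ∞ τ)
    (hτσ : ∀ t, τ (σ t) = t) (hστ : ∀ s, σ (τ s) = s) (hσT : ∀ t, σ (t + T) = σ t + L)
    (hτL : ∀ s, τ (s + L) = τ s + T) :
    Diffeomorph 𝓘(ℝ, ℝ) 𝓘(ℝ, ℝ) (AddCircle L) (AddCircle T) ∞ where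
  toFun := (AddCircle.periodic_coe_comp hτL).lift
  invFun := (AddCircle.periodic_coe_comp hσT).lift
  left_inv b := by
    obtain ⟨s, rfl⟩ := QuotientAddGroup.mk_surjective b
    exact congrArg _ (hστ s)
  right_inv b := by
    obtain ⟨t, rfl⟩ := QuotientAddGroup.mk_surjective b
    exact congrArg _ (hτσ t)
  contMDiff_toFun := AddCircle.contMDiff_of_comp_coe (AddCircle.contMDiff_coe.comp hτ.contMDiff)
  contMDiff_invFun := AddCircle.contMDiff_of_comp_coe (AddCircle.contMDiff_coe.comp hσ.contMDiff)

/-- The covering projections have identity derivative in the canonical trivialisation, so the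
derivative can be read off on the line. -/
theorem AddCircle.mfderiv_of_comp_coe {f : AddCircle L → AddCircle T} {τ : ℝ → ℝ}
    (hf : ContMDiff 𝓘(ℝ, ℝ) 𝓘(ℝ, ℝ) ∞ f) (hfτ : ∀ s : ℝ, f s = τ s) {s d : ℝ}
    (hτ : HasDerivAt τ d s) (v : ℝ) :
    mfderiv 𝓘(ℝ, ℝ) 𝓘(ℝ, ℝ) f (s : AddCircle L) v = v * d := by
  have h1 : HasMFDerivAt 𝓘(ℝ, ℝ) 𝓘(ℝ, ℝ) (f ∘ fun s : ℝ => (s : AddCircle L)) s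
      ((mfderiv 𝓘(ℝ, ℝ) 𝓘(ℝ, ℝ) f (s : AddCircle L)).comp (ContinuousLinearMap.id ℝ ℝ)) :=
    (hf.mdifferentiable (by simp) _).hasMFDerivAt.comp s (AddCircle.hasMFDerivAt_coe s)
  have h2 := (AddCircle.hasMFDerivAt_coe (T := T) (τ s)).comp s hτ.hasFDerivAt.hasMFDerivAt
  have h3 : (f ∘ fun s : ℝ => (s : AddCircle L)) = (fun s : ℝ => (s : AddCircle T)) ∘ τ :=
    funext hfτ
  rw [h3] at h1
  exact congrArg (fun A => A v) (hasMFDerivAt_unique h1 h2)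

end CircleDiffeomorphism

section Derdzinski

/-- The Yamabe equation on the cylinder turns into the equation of Derdzinski metrics, when the
arc length is used as a parameter. -/
theorem derdzinski_equation {m K : ℝ} (hm : 2 < m) {w τ : ℝ → ℝ} (hw : ContDiff ℝ ∞ w)
    (hpos : ∀ t, 0 < w t)
    (hode : ∀ t, deriv (deriv w) t = ((m - 2) / 2) ^ 2 * w t - K *
      w t ^ (((m - 2) / 2 + 2) / ((m - 2) / 2)))
    (hτ : ∀ s, HasDerivAt τ (w (τ s) ^ (2 / (m - 2)))⁻¹ s) (s : ℝ) :
    iteratedDeriv 2 (fun s => w (τ s) ^ (m / (m - 2))) s -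
        m * ((m - 1) * (m - 2)) / (4 * (m - 1)) * (w (τ s) ^ (m / (m - 2))) ^ (1 - 4 / m) =
      -(m / 4 * (4 * K / (m - 2)) * w (τ s) ^ (m / (m - 2))) := by
  have h2 : m - 2 ≠ 0 := by linarith
  have h0 : m ≠ 0 := by linarith
  have h1 : m - 1 ≠ 0 := by linarith
  have hd1 : ∀ t, HasDerivAt w (deriv w t) t := fun t => (hw.differentiable (by simp) t).hasDerivAt
  have hd2 : ∀ t, HasDerivAt (deriv w) (deriv (deriv w) t) t := fun t =>
    ((contDiff_infty_iff_deriv.1 hw).2.differentiable (by simp) t).hasDerivAt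
  -- The exponent m/(m-2) makes the factor w^{2/(m-2)} of the chain rule cancel against τ', so the
  -- first derivative is linear in w'.
  have e1 : deriv (fun s => w (τ s) ^ (m / (m - 2))) = fun s => m / (m - 2) * deriv w (τ s) := by
    funext s
    have hc : HasDerivAt (fun s => w (τ s)) _ s := (hd1 (τ s)).comp s (hτ s)
    rw [(hc.rpow_const (Or.inl (hpos _).ne')).deriv]
    have : m / (m - 2) - 1 = 2 / (m - 2) := by
      field_simp
      ring
    rw [this]
    have := (Real.rpow_pos_of_pos (hpos (τ s)) (2 / (m - 2))).ne'
    field_simp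
  have hc : HasDerivAt (fun s => deriv w (τ s)) _ s := (hd2 (τ s)).comp s (hτ s)
  rw [iteratedDeriv_succ, iteratedDeriv_one, e1, (hc.const_mul (m / (m - 2))).deriv, hode,
    ← Real.rpow_mul (hpos _).le, ← Real.rpow_neg (hpos _).le]
  have hw0 := hpos (τ s)
  generalize w (τ s) = y at hw0
  -- After multiplication by τ' the two terms exchange roles: the linear term of the Yamabe equation
  -- becomes h^{1-4/m}, and the nonlinear one becomes linear in h.
  have e2 : m / (m - 2) * (1 - 4 / m) = 1 + -(2 / (m - 2)) := by
    field_simp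
    ring
  have e3 : y ^ (m / (m - 2)) = y ^ (((m - 2) / 2 + 2) / ((m - 2) / 2)) * y ^ (-(2 / (m - 2))) := by
    rw [← Real.rpow_add hw0]
    congr 1
    field_simp
    ring
  rw [e2, e3, Real.rpow_add hw0, Real.rpow_one]
  field_simp
  ring

end Derdzinski

end

/-! ### The isometry with a Derdzinski metric. -/

noncomputable section

open Filter Topology Coord

local notation "⟪" x ", " y "⟫" => inner ℝ x y

section Main

variable {k : ℕ} {T L : ℝ} [hT : Fact (0 < T)] [hL : Fact (0 < L)]

theorem cylinderMetric_apply (p : AddCircle T × UnitSphere k)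
    (v w : ℝ × EuclideanSpace ℝ (Fin k)) :
    cylinderMetric T k p v w = v.1 * w.1 + roundMetric k p.2 v.2 w.2 := by
  have h1 : ∀ v, mfderiv (cylinderModel k) 𝓘(ℝ, ℝ)
      (Prod.fst : AddCircle T × UnitSphere k → AddCircle T) p v = v.1 := fun v => by
    rw [mfderiv_fst]
    rfl
  have h2 : ∀ v, mfderiv (cylinderModel k) (𝓡 k)
      (Prod.snd : AddCircle T × UnitSphere k → UnitSphere k) p v = v.2 := fun v => by
    rw [mfderiv_snd]
    rfl
  exact congrArg₂ (fun s t : ℝ => s + t) (congrArg₂ (fun s t : ℝ => s * t) (h1 v) (h1 w))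
    (congrArg₂ (fun s t => roundMetric k p.2 s t) (h2 v) (h2 w))

theorem warpedMetric_apply (φ : AddCircle L → ℝ) (p : AddCircle L × UnitSphere k)
    (v w : ℝ × EuclideanSpace ℝ (Fin k)) :
    warpedMetric L φ (roundMetric k) p v w = v.1 * w.1 + φ p.1 * roundMetric k p.2 v.2 w.2 := by
  have h1 : ∀ v, mfderiv (cylinderModel k) 𝓘(ℝ, ℝ)
      (Prod.fst : AddCircle L × UnitSphere k → AddCircle L) p v = v.1 := fun v => by
    rw [mfderiv_fst]
    rfl
  have h2 : ∀ v, mfderiv (cylinderModel k) (𝓡 k)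
      (Prod.snd : AddCircle L × UnitSphere k → UnitSphere k) p v = v.2 := fun v => by
    rw [mfderiv_snd]
    rfl
  exact congrArg₂ (fun s t : ℝ => s + t) (congrArg₂ (fun s t : ℝ => s * t) (h1 v) (h1 w))
    (congrArg (fun t : ℝ => φ p.1 * t)
      (congrArg₂ (fun s t => roundMetric k p.2 s t) (h2 v) (h2 w)))

/-- The pull-back of the cylindric metric by a reparametrization of the circle. -/
theorem pullback_cylinderMetric_apply
    (Ψ : Diffeomorph 𝓘(ℝ, ℝ) 𝓘(ℝ, ℝ) (AddCircle L) (AddCircle T) ∞) {τ : ℝ → ℝ}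
    (hΨ : ∀ s : ℝ, Ψ s = τ s) {s d : ℝ} (hτ : HasDerivAt τ d s) (ξ : UnitSphere k)
    (v w : ℝ × EuclideanSpace ℝ (Fin k)) :
    MetricTensor.pullback (cylinderModel k)
      (Ψ.prodCongr (Diffeomorph.refl (𝓡 k) (UnitSphere k) ∞)) (cylinderMetric T k)
      ((s : AddCircle L), ξ) v w = (v.1 * d) * (w.1 * d) + roundMetric k ξ v.2 w.2 := by
  have h1 : HasMFDerivAt 𝓘(ℝ, ℝ) 𝓘(ℝ, ℝ) Ψ (s : AddCircle L)
      (mfderiv 𝓘(ℝ, ℝ) 𝓘(ℝ, ℝ) Ψ (s : AddCircle L)) :=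
    (Ψ.contMDiff.mdifferentiable (by simp) _).hasMFDerivAt
  have h2 : HasMFDerivAt (cylinderModel k) (cylinderModel k)
      (Prod.map Ψ (id : UnitSphere k → UnitSphere k)) ((s : AddCircle L), ξ) _ :=
    HasMFDerivAt.prodMap h1 (hasMFDerivAt_id ξ)
  have h3 : ∀ v : ℝ × EuclideanSpace ℝ (Fin k), mfderiv (cylinderModel k) (cylinderModel k)
      (Ψ.prodCongr (Diffeomorph.refl (𝓡 k) (UnitSphere k) ∞)) ((s : AddCircle L), ξ) v =
      ((v.1 * d, v.2) : ℝ × EuclideanSpace ℝ (Fin k)) := fun v => by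
    change mfderiv (cylinderModel k) (cylinderModel k)
      (Prod.map Ψ (id : UnitSphere k → UnitSphere k)) ((s : AddCircle L), ξ) v = _
    rw [h2.mfderiv]
    refine Prod.ext (AddCircle.mfderiv_of_comp_coe Ψ.contMDiff hΨ hτ v.1) ?_
    change mfderiv (𝓡 k) (𝓡 k) (id : UnitSphere k → UnitSphere k) ξ v.2 = v.2
    rw [mfderiv_id]
    rfl
  have h4 := cylinderMetric_apply (Ψ (s : AddCircle L), ξ) (v.1 * d, v.2) (w.1 * d, w.2)
  rw [← h4]
  exact congrArg₂ (fun v w : ℝ × EuclideanSpace ℝ (Fin k) =>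
    cylinderMetric T k (Ψ (s : AddCircle L), ξ) v w) (h3 v) (h3 w)

variable {u : AddCircle T × UnitSphere k → ℝ}
  {g : MetricTensor (cylinderModel k) (AddCircle T × UnitSphere k)} {c : ℝ}

/-- Every pseudo-cylindric metric is isometric to a Derdzinski metric. -/
theorem exists_isDerdzinskiMetric (hk : 2 ≤ k) (hu : ContMDiff (cylinderModel k) 𝓘(ℝ, ℝ) ∞ u)
    (hpos : ∀ x, 0 < u x) (hne : ¬ ∃ b, ∀ x, u x = b)
    (hg : ∀ x, g x = u x ^ (4 / (((k + 1 : ℕ) : ℝ) - 2)) • cylinderMetric T k x)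
    (hc : ∀ x, scalarCurvature g x = c) :
    ∃ (L : ℝ) (_ : Fact (0 < L))
      (gD : MetricTensor (cylinderModel k) (AddCircle L × UnitSphere k))
      (F : Diffeomorph (cylinderModel k) (cylinderModel k)
        (AddCircle L × UnitSphere k) (AddCircle T × UnitSphere k) ∞)
      (ψ : AddCircle L × UnitSphere k → ℝ),
      IsDerdzinskiMetric (k + 1) L (roundMetric k) gD ∧
      gD = MetricTensor.pullback (cylinderModel k) F g ∧
      ContMDiff (cylinderModel k) 𝓘(ℝ, ℝ) ∞ ψ ∧ (∀ x, 0 < ψ x) ∧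
      ∀ x, MetricTensor.pullback (cylinderModel k) F (cylinderMetric T k) x = ψ x • gD x := by
  have hk' : (2 : ℝ) ≤ k := by exact_mod_cast hk
  set m : ℝ := ((k + 1 : ℕ) : ℝ) with hm
  have hmk : m = k + 1 := by rw [hm]; push_cast; rfl
  have hm2 : 2 < m := by linarith
  have hm2' : m - 2 ≠ 0 := by linarith
  have hm0 : m ≠ 0 := by linarith
  set η : UnitSphere k := toSphere 0
  set w : ℝ → ℝ := fun t => u (t, η) with hw
  have hwsm : ContDiff ℝ ∞ w := contDiff_slice hu η
  have hwpos : ∀ t, 0 < w t := fun t => hpos _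
  have huw : ∀ (t : ℝ) ξ, u (t, ξ) = w t := fun t ξ => conformalFactor_eq hk hu hpos hg hc t ξ η
  -- The metric restricted to a circle is w^{4/(m-2)} dt², so its length element is w^{2/(m-2)} dt.
  -- σ is arc length, τ its inverse, and L the length of the circle in the given metric.
  obtain ⟨L, σ, τ, hL0, hσ, hτ, hτσ, hστ, hσT, hτL, hder⟩ :=
    exists_inverse_primitive hT.out (φ := fun t => w t ^ (2 / (m - 2)))
      (hwsm.rpow_const_of_ne fun t => (hwpos t).ne')
      (fun t => Real.rpow_pos_of_pos (hwpos t) _) (fun t => by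
        simp only [hw]
        rw [AddCircle.coe_add, AddCircle.coe_period, add_zero])
  have hLf : Fact (0 < L) := ⟨hL0⟩
  set Ψ := AddCircle.diffeomorphOfEquivariant hσ hτ hτσ hστ hσT hτL with hΨdef
  have hΨ : ∀ s : ℝ, Ψ s = τ s := fun s => rfl
  set F := Ψ.prodCongr (Diffeomorph.refl (𝓡 k) (UnitSphere k) ∞) with hF
  have hFapply : ∀ (s : ℝ) ξ, F ((s : AddCircle L), ξ) = ((τ s : AddCircle T), ξ) :=
    fun s ξ => rfl
  set h : AddCircle L → ℝ := fun b => u (Ψ b, η) ^ (m / (m - 2)) with hh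
  have hhs : ∀ s : ℝ, h s = w (τ s) ^ (m / (m - 2)) := fun s => rfl
  have hpull : ∀ x v w, MetricTensor.pullback (cylinderModel k) F g x v w =
      u (F x) ^ (4 / (m - 2)) *
        MetricTensor.pullback (cylinderModel k) F (cylinderMetric T k) x v w := fun x v w => by
    rw [MetricTensor.pullback_apply, MetricTensor.pullback_apply, hg]
    rfl
  have hode : ∀ t, deriv (deriv w) t = ((m - 2) / 2) ^ 2 * w t - c * (k - 1) / (4 * k) *
      w t ^ (((m - 2) / 2 + 2) / ((m - 2) / 2)) := fun t => by
    rw [deriv_deriv_conformalFactor hk hu hpos hg hc hwsm huw t, hmk,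
      show (k : ℝ) + 1 - 2 = k - 1 by ring]
  have hcpos := scalarCurvature_pos hk hu hpos hg hc
  -- The fibre has scalar curvature k(k-1), and C = 4K/(m-2) with K = c(k-1)/(4k). The factor ψ is
  -- the reciprocal of the conformal factor of `g`, carried along `F`.
  refine ⟨L, hLf, MetricTensor.pullback (cylinderModel k) F g, F,
    fun x => u (F x) ^ (-(4 / (m - 2))), ⟨by simp, (k : ℝ) * (k - 1), ?_,
      isEinstein_roundMetric (by omega), h, ?_, ?_, ?_, ⟨4 * (c * (k - 1) / (4 * k)) / (m - 2), ?_,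
        fun s => ?_⟩, ?_⟩, rfl, ?_, ?_, ?_⟩
  · have : 0 < (k : ℝ) - 1 := by linarith
    positivity
  · exact fun b => Real.rpow_pos_of_pos (hpos _) _
  · rintro ⟨b, hb⟩
    refine hne ⟨b ^ ((m - 2) / m), ?_⟩
    rintro ⟨q, ξ⟩
    obtain ⟨t, rfl⟩ := QuotientAddGroup.mk_surjective q
    rw [← hb (σ t), hhs, hτσ, ← Real.rpow_mul (hwpos t).le,
      show m / (m - 2) * ((m - 2) / m) = 1 by field_simp, Real.rpow_one]
    exact huw t ξ
  · exact (hwsm.comp hτ).rpow_const_of_ne fun s => (hwpos _).ne'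
  · have : 0 < (k : ℝ) - 1 := by linarith
    have : 0 < m - 2 := by linarith
    positivity
  · have e := derdzinski_equation hm2 hwsm hwpos hode hder s
    rw [show (k : ℝ) * (k - 1) = (m - 1) * (m - 2) by rw [hmk]; ring]
    exact e
  · refine funext fun x => ContinuousLinearMap.ext fun v => ContinuousLinearMap.ext fun z => ?_
    obtain ⟨b, ξ⟩ := x
    obtain ⟨s, rfl⟩ := QuotientAddGroup.mk_surjective b
    have e1 := pullback_cylinderMetric_apply Ψ hΨ (hder s) ξ v z
    have e2 := warpedMetric_apply (fun t => h t ^ (4 / m)) ((s : AddCircle L), ξ) v z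
    refine (hpull _ v z).trans (Eq.trans ?_ e2.symm)
    refine (congrArg (fun r => u (F ((s : AddCircle L), ξ)) ^ (4 / (m - 2)) * r) e1).trans ?_
    rw [hFapply, huw]
    beta_reduce
    rw [hhs, ← Real.rpow_mul (hwpos _).le, show m / (m - 2) * (4 / m) = 4 / (m - 2) by field_simp]
    -- In the circle direction the conformal factor is the square of w^{2/(m-2)} and cancels the
    -- square of τ'; in the fibre direction it is h^{4/m}.
    have e3 : w (τ s) ^ (4 / (m - 2)) = w (τ s) ^ (2 / (m - 2)) * w (τ s) ^ (2 / (m - 2)) := by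
      rw [← Real.rpow_add (hwpos _)]
      congr 1
      ring
    have e4 := (Real.rpow_pos_of_pos (hwpos (τ s)) (2 / (m - 2))).ne'
    rw [e3]
    field_simp
  · intro x
    exact (Real.contDiffAt_rpow_const_of_ne (hpos (F x)).ne').contMDiffAt.comp x
      ((hu.comp F.contMDiff) x)
  · exact fun x => Real.rpow_pos_of_pos (hpos _) _
  · intro x
    refine ContinuousLinearMap.ext fun v => ContinuousLinearMap.ext fun z => ?_
    change _ = u (F x) ^ (-(4 / (m - 2))) * MetricTensor.pullback (cylinderModel k) F g x v z
    rw [hpull, ← mul_assoc, ← Real.rpow_add (hpos _), neg_add_cancel, Real.rpow_zero, one_mul]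

end Main

end

theorem theorem1 (n : ℕ) (hn : 3 ≤ n) (T : ℝ) [Fact (0 < T)]
    (hT : T > 2 * Real.pi / √((n : ℝ) - 2))
    (g : MetricTensor (cylinderModel (n - 1)) (AddCircle T × UnitSphere (n - 1)))
    (hg : IsPseudoCylindric n T g) :
    HasHarmonicCurvature g ∧ ¬ HasParallelRicci g ∧
    ∃ (L : ℝ) (_ : Fact (0 < L))
      (gD : MetricTensor (cylinderModel (n - 1)) (AddCircle L × UnitSphere (n - 1)))
      (F : Diffeomorph (cylinderModel (n - 1)) (cylinderModel (n - 1))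
        (AddCircle L × UnitSphere (n - 1)) (AddCircle T × UnitSphere (n - 1)) ∞)
      (ψ : AddCircle L × UnitSphere (n - 1) → ℝ),
      IsDerdzinskiMetric n L (roundMetric (n - 1)) gD ∧
      gD = MetricTensor.pullback (cylinderModel (n - 1)) F g ∧
      ContMDiff (cylinderModel (n - 1)) 𝓘(ℝ, ℝ) ∞ ψ ∧ (∀ x, 0 < ψ x) ∧
      ∀ x, MetricTensor.pullback (cylinderModel (n - 1)) F (cylinderMetric T (n - 1)) x
        = ψ x • gD x := by
  obtain ⟨k, rfl⟩ : ∃ k, n = k + 1 := ⟨n - 1, by omega⟩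
  obtain ⟨u, hu, hpos, hne, hgu, c, hc⟩ := hg
  have hk : 2 ≤ k := by omega
  exact ⟨hasHarmonicCurvature_of_conformal hk hu hpos hgu hc,
    not_hasParallelRicci hk hu hpos hne hgu hc,
    exists_isDerdzinskiMetric hk hu hpos hne hgu hc⟩
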